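/- Let $\ell>0$, $m\in\mathbb R$, let $V:[0,\ell]\to\mathbb R$ be continuous, let $\alpha\in[0,\pi)$, and let $\beta_1,\beta_2,\beta_1',\beta_2'\in\mathbb R$ satisfy $\rho:=\beta_1'\beta_2-\beta_1\beta_2'>0$. Let $\mathcal H=L^2((0,\ell))\oplus\mathbb C$ with inner product $(\varphi,\chi)=\int_0^\ell\overline{\varphi_1}\chi_1\,dz+\rho^{-1}\overline{\varphi_2}\chi_2$, and let $A$ be the operator $$A\varphi=\bigl((-\partial_z^2+m^2+V)\varphi_1,\ -[\beta_1\varphi_1(\ell)-\beta_2\partial_z\varphi_1(\ell)]\bigr),$$ whose domain $D(A)$ consists of all $\varphi=(\varphi_1,\varphi_2)\in\mathcal H$ such that $\varphi_1,\partial_z\varphi_1$ are absolutely continuous on $[0,\ell]$, $\partial_z^2\varphi_1\in L^2((0,\ell))$, $\cos\alpha\,\varphi_1(0)+\sin\alpha\,\partial_z\varphi_1(0)=0$ and $\varphi_2=\beta_1'\varphi_1(\ell)-\beta_2'\partial_z\varphi_1(\ell)$. Endow $D(A)$ with the graph norm $\|\varphi\|_{\mathcal H}+\|A\varphi\|_{\mathcal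 H}$. Let $C^2(\mathbb R,D(A))$ be the space of twice continuously differentiable functions $\mathbb R\to D(A)$, and $C^2_0(\mathbb R,D(A))$ the subspace of those with compact support. Put $Q_A=\partial_t^2+A$. For $f:\mathbb R\to D(A)$ let $\operatorname{supp}f_1$ be the closure in $\mathbb R\times[0,\ell]$ of $\{(t,z): f_1(t,z)\ne0\}$, where $f_1(t,\cdot)$ is the continuous representative of the first component of $f(t)$. For $O\subset\mathbb R\times[0,\ell]$ let $J(O)=J_+(O)\cup J_-(O)$ be the union of its causal future and past in the flat strip, i.e. the set of $(t,z)\in\mathbb R\times[0,\ell]$ such that $|z-z'|\le|t-t'|$ for some $(t',z')\in O$. **Theorem.** Assume that $m^2+V\ge0$ on $[0,\ell]$; that $\alpha=0$ or $\pi/2\le\alpha<\pi$; that $\beta_2\neq0$ and $\beta_2'\ne0$; that if $\beta_2'>0$ then $\beta_1\ge0$, $\beta_2<0$, $\beta_1'<0$; and that if $\beta_2'<0$ then $\beta_1\le0$, $\beta_2>0$, $\beta_1'>0$. Then $A$ is self-adjoint, its eigenvalues are non-negative, its eigenvectors are complete in $\mathcal H$, and for every $t\in\mathbb R$ $$E(t)=-\frac{\sin(\sqrt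 A\,t)}{\sqrt A}=-\sum_{\lambda}\frac{\sin(\sqrt\lambda\,t)}{\sqrt\lambda}\,P_\lambda\qquad(\text{strongly convergent})$$ defines a bounded operator on $\mathcal H$; here $\lambda$ runs through the eigenvalues of $A$, $P_\lambda$ is the orthogonal projection onto the eigenspace, and $\sin(\sqrt\lambda\,t)/\sqrt\lambda$ is read as $t$ if $\lambda=0$. The integral operator $$(\mathsf Ef)(t)=\int_{\mathbb R}E(t-t')f(t')\,dt'$$ maps $C^2_0(\mathbb R,D(A))$ into $C^2(\mathbb R,D(A))$ and is a causal propagator. That is, the kernel $t\mapsto E(t)$ is norm continuous into the bounded operators on $\mathcal H$, strongly $C^1$ on $\mathcal H$, and $C^2$ in norm into the bounded operators from $D(A)$ to $\mathcal H$, and: 1. $Q_A\mathsf Ef=0$ and $\mathsf EQ_Af=0$ for all $f\in C^2_0(\mathbb R,D(A))$ (where $\mathsf EQ_Af$ is given by the same integral applied to the continuous $\mathcal H$-valued function $Q_Af$); 2. $\operatorname{supp}(\mathsf Ef)_1\subset J(\operatorname{supp}f_1)$ for all $f\in C^2_0(\mathbb R,D(A))$; 3. $E(0)=0$ and $\partial_tE(0)=-I$,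 the derivative being taken strongly on $\mathcal H$. -/

import Mathlib

open MeasureTheory Set

noncomputable section

/-! ## Graph norm, eigenprojections and functional calculus of an unbounded operator -/

namespace UnboundedOp

variable {H : Type*} [NormedAddCommGroup H] [InnerProductSpace ℂ H]

/-- The domain `D(A)` of an unbounded operator, to be endowed with the graph norm
(a type synonym, since `A.domain` already carries the norm of `H`). -/
def GraphDomain (A : H →ₗ.[ℂ] H) : Type _ := A.domain

instance (A : H →ₗ.[ℂ] H) : AddCommGroup (GraphDomain A) :=
  inferInstanceAs (AddCommGroup A.domain)

instance (A : H →ₗ.[ℂ] H) : Module ℂ (GraphDomain A) :=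
  inferInstanceAs (Module ℂ A.domain)

/-- The inclusion `D(A) → H`, as a linear map. -/
def GraphDomain.inclₗ (A : H →ₗ.[ℂ] H) : GraphDomain A →ₗ[ℂ] H := A.domain.subtype

/-- The operator `A : D(A) → H`, as a linear map. -/
def GraphDomain.opₗ (A : H →ₗ.[ℂ] H) : GraphDomain A →ₗ[ℂ] H := A.toFun

/-- The map `φ ↦ (φ, A φ)` into `H × H` with the norm `‖x‖ + ‖y‖`. -/
def GraphDomain.toGraph (A : H →ₗ.[ℂ] H) : GraphDomain A →ₗ[ℂ] WithLp 1 (H × H) :=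
  (WithLp.linearEquiv 1 ℂ (H × H)).symm.toLinearMap ∘ₗ
    (GraphDomain.inclₗ A).prod (GraphDomain.opₗ A)

theorem GraphDomain.toGraph_injective (A : H →ₗ.[ℂ] H) :
    Function.Injective (GraphDomain.toGraph A) := by
  intro x y h
  have h1 : (GraphDomain.inclₗ A) x = (GraphDomain.inclₗ A) y :=
    congrArg (fun p : WithLp 1 (H × H) => p.fst) h
  exact Subtype.ext h1

instance (A : H →ₗ.[ℂ] H) : NormedAddCommGroup (GraphDomain A) :=
  NormedAddCommGroup.induced (GraphDomain A) (WithLp 1 (H × H)) (GraphDomain.toGraph A)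
    (GraphDomain.toGraph_injective A)

instance (A : H →ₗ.[ℂ] H) : NormedSpace ℂ (GraphDomain A) :=
  NormedSpace.induced ℂ (GraphDomain A) (WithLp 1 (H × H)) (GraphDomain.toGraph A)

/-- The norm of `D(A)` is the graph norm `‖φ‖ + ‖A φ‖`. -/
theorem GraphDomain.norm_def (A : H →ₗ.[ℂ] H) (φ : GraphDomain A) :
    ‖φ‖ = ‖GraphDomain.inclₗ A φ‖ + ‖GraphDomain.opₗ A φ‖ := by
  change ‖GraphDomain.toGraph A φ‖ = _
  rw [WithLp.prod_norm_eq_of_L1]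
  rfl

/-- The inclusion `D(A) → H`, bounded for the graph norm. -/
def GraphDomain.incl (A : H →ₗ.[ℂ] H) : GraphDomain A →L[ℂ] H :=
  (GraphDomain.inclₗ A).mkContinuous 1 (fun φ => by
    rw [one_mul, GraphDomain.norm_def]
    exact le_add_of_nonneg_right (norm_nonneg _))

/-- The operator `A : D(A) → H`, bounded for the graph norm. -/
def GraphDomain.op (A : H →ₗ.[ℂ] H) : GraphDomain A →L[ℂ] H :=
  (GraphDomain.opₗ A).mkContinuous 1 (fun φ => by
    rw [one_mul, GraphDomain.norm_def]
    exact le_add_of_nonneg_left (norm_nonneg _))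

/-- `C²(ℝ, D(A))`, with `D(A)` carrying the graph norm. -/
def C2 (A : H →ₗ.[ℂ] H) : Submodule ℂ (ℝ → GraphDomain A) where
  carrier := {f | ContDiff ℝ 2 f}
  add_mem' := by
    intro f g hf hg
    exact ContDiff.add (mem_ofPred_eq ▸ hf) (mem_ofPred_eq ▸ hg)
  zero_mem' := by
    exact (contDiff_const : ContDiff ℝ 2 (fun _ : ℝ => (0 : GraphDomain A)))
  smul_mem' := by
    intro c f hf
    exact ContDiff.const_smul c (mem_ofPred_eq ▸ hf)

/-- `C²₀(ℝ, D(A))`: the elements of `C²(ℝ, D(A))` with compact support in `ℝ`. -/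
def C2c (A : H →ₗ.[ℂ] H) : Submodule ℂ (ℝ → GraphDomain A) where
  carrier := {f | ContDiff ℝ 2 f ∧ HasCompactSupport f}
  add_mem' := fun hf hg => ⟨ContDiff.add hf.1 hg.1, hf.2.add hg.2⟩
  zero_mem' := ⟨contDiff_const, HasCompactSupport.zero⟩
  smul_mem' := fun c _ hf =>
    ⟨ContDiff.const_smul c hf.1, HasCompactSupport.smul_left (f := fun _ => c) hf.2⟩

/-- The abstract Klein-Gordon operator `Q_A f = ∂_t² f + A f`, with values in `H`. -/
def kleinGordon (A : H →ₗ.[ℂ] H) (f : ℝ → GraphDomain A) (t : ℝ) : H :=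
  GraphDomain.incl A (iteratedDeriv 2 f t) + GraphDomain.op A (f t)

/-- The convolution-type integral operator `(Eop h)(t) = ∫ K(t - t') h(t') dt'`. -/
def integralOp (K : ℝ → H →L[ℂ] H) (h : ℝ → H) (t : ℝ) : H :=
  ∫ t', K (t - t') (h t')

/-- The eigenspace `{φ ∈ D(A) | A φ = lam φ}`. -/
def eigenspace (A : H →ₗ.[ℂ] H) (lam : ℝ) : Submodule ℂ H :=
  A.graph.comap ((LinearMap.id : H →ₗ[ℂ] H).prod ((lam : ℂ) • (LinearMap.id : H →ₗ[ℂ] H)))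

/-- The orthogonal projection onto the (closed) eigenspace of `A` at `lam`; it is `0` unless `lam`
is an eigenvalue. -/
def spectralProj [CompleteSpace H] (A : H →ₗ.[ℂ] H) (lam : ℝ) : H →L[ℂ] H :=
  (eigenspace A lam).topologicalClosure.starProjection

/-- `B = f(A)` in the sense of the functional calculus of an operator with a complete system of
eigenvectors: the eigenprojections `P_lam` resolve the identity, and
`B φ = ∑_lam f(lam) P_lam φ`, with convergence in `H`. -/
structure IsFunctionOf [CompleteSpace H] (A : H →ₗ.[ℂ] H) (f : ℝ → ℝ) (B : H →L[ℂ] H) :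
    Prop where
  resolution : ∀ φ : H, HasSum (fun lam : ℝ => spectralProj A lam φ) φ
  hasSum : ∀ φ : H, HasSum (fun lam : ℝ => ((f lam : ℝ) : ℂ) • spectralProj A lam φ) (B φ)

/-- `Eop : C²₀(ℝ, D(A)) → C²(ℝ, D(A))` is an integral operator with kernel `K(t - t')`, where the
`K(t)` are bounded operators on `H`. Regularity of `K`: norm continuous in `t`, strongly `C¹`
on `H`, and `C²` as a map into the bounded operators from `D(A)` to `H`. -/
structure IsIntegralOperator (A : H →ₗ.[ℂ] H) (Eop : C2c A →ₗ[ℂ] C2 A) (K : ℝ → H →L[ℂ] H) :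
    Prop where
  continuous_kernel : Continuous K
  strong_C1 : ∀ φ : H, ContDiff ℝ 1 (fun t => K t φ)
  C2_on_domain : ContDiff ℝ 2 (fun t => (K t).comp (GraphDomain.incl A))
  eq_integral : ∀ (f : C2c A) (t : ℝ),
    GraphDomain.incl A ((Eop f : ℝ → GraphDomain A) t)
      = integralOp K (fun t' => GraphDomain.incl A ((f : ℝ → GraphDomain A) t')) t

end UnboundedOp

/-- The function `lam ↦ sin(√lam t)/√lam` on `[0, ∞)`, with its limit value `t` at `lam = 0`. -/
def sinSqrtDivSqrt (t lam : ℝ) : ℝ :=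
  if lam = 0 then t else Real.sin (Real.sqrt lam * t) / Real.sqrt lam

/-! ## The bulk-boundary system -/

/-- The data of the system on `[0, ℓ]`: mass `m`, continuous potential `V`, angle `α ∈ [0, π)` and
boundary parameters `β₁, β₂, β₁', β₂'` with positive determinant. -/
structure BulkBoundarySystem where
  ℓ : ℝ
  m : ℝ
  V : ℝ → ℝ
  α : ℝ
  β₁ : ℝ
  β₂ : ℝ
  β₁' : ℝ
  β₂' : ℝ
  ℓ_pos : 0 < ℓ
  V_cont : ContinuousOn V (Icc 0 ℓ)
  α_mem : α ∈ Ico 0 Real.pi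
  det_pos : 0 < β₁' * β₂ - β₁ * β₂'

namespace BulkBoundarySystem

open UnboundedOp

variable (P : BulkBoundarySystem)

/-- The determinant `ρ`. -/
def ρ : ℝ := P.β₁' * P.β₂ - P.β₁ * P.β₂'

theorem ρ_pos : 0 < P.ρ := P.det_pos

/-- Lebesgue measure on `(0, ℓ)`. -/
def μ : Measure ℝ := volume.restrict (Ioo 0 P.ℓ)

/-- `ℂ` with the inner product `ρ⁻¹ x̄ y`. -/
def BoundarySpace (_P : BulkBoundarySystem) : Type := ℂ

instance : AddCommGroup P.BoundarySpace := inferInstanceAs (AddCommGroup ℂ)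

instance : Module ℂ P.BoundarySpace := inferInstanceAs (Module ℂ ℂ)

/-- A complex number as an element of the boundary space. -/
def BoundarySpace.mk (z : ℂ) : P.BoundarySpace := z

/-- An element of the boundary space as a complex number. -/
def BoundarySpace.val {P : BulkBoundarySystem} (x : P.BoundarySpace) : ℂ := x

@[simp] theorem BoundarySpace.val_add (x y : P.BoundarySpace) : (x + y).val = x.val + y.val := rfl

@[simp] theorem BoundarySpace.val_zero : (0 : P.BoundarySpace).val = 0 := rfl

@[simp] theorem BoundarySpace.val_smul (c : ℂ) (x : P.BoundarySpace) :
    (c • x).val = c * x.val := rfl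

/-- The weighted inner product on the boundary space. -/
@[reducible] def boundaryCore : InnerProductSpace.Core ℂ P.BoundarySpace where
  inner x y := ((P.ρ⁻¹ : ℝ) : ℂ) * ((starRingEnd ℂ) x.val * y.val)
  conj_inner_symm x y := by
    simp only [map_mul, Complex.conj_ofReal, Complex.conj_conj]
    ring
  re_inner_nonneg x := by
    have h : (starRingEnd ℂ) x.val * x.val = ((Complex.normSq x.val : ℝ) : ℂ) := by
      rw [mul_comm, Complex.mul_conj]
    rw [h, ← Complex.ofReal_mul]
    exact mul_nonneg (inv_nonneg.2 P.ρ_pos.le) (Complex.normSq_nonneg _)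
  add_left x y z := by
    simp only [BoundarySpace.val_add, map_add]
    ring
  smul_left x y r := by
    simp only [BoundarySpace.val_smul, map_mul]
    ring
  definite x h := by
    have hρ : ((P.ρ⁻¹ : ℝ) : ℂ) ≠ 0 := Complex.ofReal_ne_zero.2 (inv_ne_zero P.ρ_pos.ne')
    have h2 : (starRingEnd ℂ) x.val * x.val = 0 := (mul_eq_zero.1 h).resolve_left hρ
    have h3 : x.val = 0 := by simpa using h2
    exact h3

instance : NormedAddCommGroup P.BoundarySpace := P.boundaryCore.toNormedAddCommGroup

instance : InnerProductSpace ℂ P.BoundarySpace := InnerProductSpace.ofCore P.boundaryCore.toCore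

theorem boundary_inner (x y : P.BoundarySpace) :
    inner ℂ x y = ((P.ρ⁻¹ : ℝ) : ℂ) * ((starRingEnd ℂ) x.val * y.val) := rfl

instance : FiniteDimensional ℂ P.BoundarySpace := inferInstanceAs (FiniteDimensional ℂ ℂ)

instance : CompleteSpace P.BoundarySpace := FiniteDimensional.complete ℂ P.BoundarySpace

/-- The Hilbert space `L²((0, ℓ)) ⊕ ℂ`, with inner product
`∫ φ̄₁ χ₁ + ρ⁻¹ φ̄₂ χ₂`. -/
abbrev Hil : Type := WithLp 2 (Lp ℂ 2 P.μ × P.BoundarySpace)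

theorem hil_inner (φ χ : P.Hil) :
    inner ℂ φ χ = (∫ z, (starRingEnd ℂ) (φ.fst z) * χ.fst z ∂P.μ)
      + ((P.ρ⁻¹ : ℝ) : ℂ) * ((starRingEnd ℂ) φ.snd.val * χ.snd.val) := by
  rw [WithLp.prod_inner_apply, L2.inner_def, boundary_inner]
  congr 1
  refine integral_congr_ae (Filter.Eventually.of_forall fun z => ?_)
  simp [RCLike.inner_apply, mul_comm]

/-- The function `u` on `[0, ℓ]` is a representative of the class `φ₁`, both `u` and its derivative
`v = ∂_z u` (one-sided at the end points) are absolutely continuous on `[0, ℓ]`, and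
`∂_z² u = w` almost everywhere with `w` square integrable. -/
structure IsProfile (φ₁ : Lp ℂ 2 P.μ) (u v w : ℝ → ℂ) : Prop where
  rep : φ₁ =ᵐ[P.μ] u
  ac_u : AbsolutelyContinuousOnInterval u 0 P.ℓ
  ac_v : AbsolutelyContinuousOnInterval v 0 P.ℓ
  deriv_u : ∀ z ∈ Icc 0 P.ℓ, HasDerivWithinAt u (v z) (Icc 0 P.ℓ) z
  deriv_v : ∀ᵐ z ∂P.μ, HasDerivAt v (w z) z
  memLp_w : MemLp w 2 P.μ

/-- `(φ, ψ)` is in the graph of `A`: `φ ∈ D(A)` and `ψ = A φ`. -/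
structure IsGraphPair (φ ψ : P.Hil) (u v w : ℝ → ℂ) : Prop where
  profile : P.IsProfile φ.fst u v w
  bc_left : (Real.cos P.α : ℂ) * u 0 + (Real.sin P.α : ℂ) * v 0 = 0
  bc_right : φ.snd.val = (P.β₁' : ℂ) * u P.ℓ - (P.β₂' : ℂ) * v P.ℓ
  bulk_eq : ψ.fst =ᵐ[P.μ] fun z => - w z + ((P.m ^ 2 + P.V z : ℝ) : ℂ) * u z
  boundary_eq : ψ.snd.val = - ((P.β₁ : ℂ) * u P.ℓ - (P.β₂ : ℂ) * v P.ℓ)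

/-- The graph of `A`. -/
def opGraph : Submodule ℂ (P.Hil × P.Hil) where
  carrier := {p | ∃ u v w : ℝ → ℂ, P.IsGraphPair p.1 p.2 u v w}
  add_mem' := by
    rintro ⟨φ, ψ⟩ ⟨φ', ψ'⟩ ⟨u, v, w, h⟩ ⟨u', v', w', h'⟩
    refine ⟨fun z => u z + u' z, fun z => v z + v' z, fun z => w z + w' z,
      ⟨?_, h.profile.ac_u.add h'.profile.ac_u, h.profile.ac_v.add h'.profile.ac_v, ?_, ?_,
        h.profile.memLp_w.add h'.profile.memLp_w⟩, ?_, ?_, ?_, ?_⟩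
    · filter_upwards [Lp.coeFn_add φ.fst φ'.fst, h.profile.rep, h'.profile.rep] with z e1 e2 e3
      exact e1.trans (congrArg₂ (· + ·) e2 e3)
    · exact fun z hz => (h.profile.deriv_u z hz).add (h'.profile.deriv_u z hz)
    · filter_upwards [h.profile.deriv_v, h'.profile.deriv_v] with z e1 e2
      exact e1.add e2
    · linear_combination h.bc_left + h'.bc_left
    · have e : ((φ, ψ) + (φ', ψ')).1.snd.val = φ.snd.val + φ'.snd.val := rfl
      rw [e]
      linear_combination h.bc_right + h'.bc_right
    · filter_upwards [Lp.coeFn_add ψ.fst ψ'.fst, h.bulk_eq, h'.bulk_eq] with z e1 e2 e3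
      refine (e1.trans (congrArg₂ (· + ·) e2 e3)).trans ?_
      ring
    · have e : ((φ, ψ) + (φ', ψ')).2.snd.val = ψ.snd.val + ψ'.snd.val := rfl
      rw [e]
      linear_combination h.boundary_eq + h'.boundary_eq
  zero_mem' := by
    have hac : AbsolutelyContinuousOnInterval (fun _ : ℝ => (0 : ℂ)) 0 P.ℓ := by
      simpa [AbsolutelyContinuousOnInterval] using tendsto_const_nhds
    refine ⟨fun _ => 0, fun _ => 0, fun _ => 0, ⟨?_, hac, hac, ?_, ?_, MemLp.zero⟩, ?_, ?_, ?_, ?_⟩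
    · exact Lp.coeFn_zero ℂ 2 P.μ
    · exact fun z _ => hasDerivWithinAt_const _ _ _
    · exact Filter.Eventually.of_forall fun z => hasDerivAt_const _ _
    · simp
    · simp
    · filter_upwards [Lp.coeFn_zero ℂ 2 P.μ] with z e1
      refine e1.trans ?_
      simp
    · simp
  smul_mem' := by
    rintro c ⟨φ, ψ⟩ ⟨u, v, w, h⟩
    refine ⟨fun z => c • u z, fun z => c • v z, fun z => c • w z,
      ⟨?_, h.profile.ac_u.const_smul c, h.profile.ac_v.const_smul c, ?_, ?_,
        h.profile.memLp_w.const_smul c⟩, ?_, ?_, ?_, ?_⟩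
    · filter_upwards [Lp.coeFn_smul c φ.fst, h.profile.rep] with z e1 e2
      exact e1.trans (congrArg (c • ·) e2)
    · exact fun z hz => (h.profile.deriv_u z hz).const_smul c
    · filter_upwards [h.profile.deriv_v] with z e1
      exact e1.const_smul c
    · simp only [smul_eq_mul]
      linear_combination c * h.bc_left
    · have e : (c • (φ, ψ)).1.snd.val = c * φ.snd.val := rfl
      rw [e]
      simp only [smul_eq_mul]
      linear_combination c * h.bc_right
    · filter_upwards [Lp.coeFn_smul c ψ.fst, h.bulk_eq] with z e1 e2
      refine (e1.trans (congrArg (c • ·) e2)).trans ?_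
      simp only [smul_eq_mul]
      ring
    · have e : (c • (φ, ψ)).2.snd.val = c * ψ.snd.val := rfl
      rw [e]
      simp only [smul_eq_mul]
      linear_combination c * h.boundary_eq

/-- A continuous function on `[0, ℓ]` is determined by its class. -/
theorem eqOn_of_ae_eq {u u' : ℝ → ℂ} (hu : ContinuousOn u (Icc 0 P.ℓ))
    (hu' : ContinuousOn u' (Icc 0 P.ℓ)) (h : u =ᵐ[P.μ] u') : EqOn u u' (Icc 0 P.ℓ) := by
  have h1 : EqOn u u' (Ioo 0 P.ℓ) :=
    Measure.eqOn_open_of_ae_eq h isOpen_Ioo (hu.mono Ioo_subset_Icc_self)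
      (hu'.mono Ioo_subset_Icc_self)
  refine h1.of_subset_closure hu hu' Ioo_subset_Icc_self ?_
  rw [closure_Ioo P.ℓ_pos.ne]

theorem IsProfile.continuousOn {φ₁ : Lp ℂ 2 P.μ} {u v w : ℝ → ℂ} (h : P.IsProfile φ₁ u v w) :
    ContinuousOn u (Icc 0 P.ℓ) := fun z hz => (h.deriv_u z hz).continuousWithinAt

/-- The graph of `A` is the graph of a function. -/
theorem opGraph_functional (p : P.Hil × P.Hil) (hp : p ∈ P.opGraph) (h0 : p.1 = 0) :
    p.2 = 0 := by
  obtain ⟨φ, ψ⟩ := p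
  obtain ⟨u, v, w, h⟩ := hp
  simp only at h0 h
  subst h0
  have hu : EqOn u (fun _ => 0) (Icc 0 P.ℓ) :=
    P.eqOn_of_ae_eq h.profile.continuousOn continuousOn_const
      (h.profile.rep.symm.trans (Lp.coeFn_zero ℂ 2 P.μ))
  have hv : EqOn v (fun _ => 0) (Icc 0 P.ℓ) := fun z hz =>
    (uniqueDiffOn_Icc P.ℓ_pos z hz).eq_deriv _ (h.profile.deriv_u z hz)
      ((hasDerivWithinAt_const z (Icc 0 P.ℓ) (0 : ℂ)).congr hu (hu hz))
  have hℓ : P.ℓ ∈ Icc 0 P.ℓ := right_mem_Icc.2 P.ℓ_pos.le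
  have hmem : ∀ᵐ z ∂P.μ, z ∈ Ioo 0 P.ℓ := ae_restrict_mem measurableSet_Ioo
  have h1 : ψ.fst = 0 := by
    rw [Lp.eq_zero_iff_ae_eq_zero]
    filter_upwards [h.bulk_eq, h.profile.deriv_v, hmem] with z e1 e2 e3
    have e4 : w z = 0 := by
      refine e2.unique ((hasDerivAt_const z (0 : ℂ)).congr_of_eventuallyEq ?_)
      filter_upwards [isOpen_Ioo.mem_nhds e3] with y hy using hv (Ioo_subset_Icc_self hy)
    rw [e1, e4, hu (Ioo_subset_Icc_self e3)]
    simp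
  have h2 : ψ.snd = 0 := by
    have e : ψ.snd.val = 0 := by
      rw [h.boundary_eq, hu hℓ, hv hℓ]
      simp
    exact e
  exact WithLp.ofLp_injective 2 (Prod.ext h1 h2)

/-- The operator `A`, with `D(A)` the set of `φ = (φ₁, φ₂)` such that `φ₁, ∂_z φ₁` are absolutely
continuous on `[0, ℓ]`, `∂_z² φ₁ ∈ L²`, `cos α φ₁(0) + sin α ∂_z φ₁(0) = 0` and
`φ₂ = β₁' φ₁(ℓ) - β₂' ∂_z φ₁(ℓ)`, and
`A φ = ((-∂_z² + m² + V) φ₁, -(β₁ φ₁(ℓ) - β₂ ∂_z φ₁(ℓ)))`. -/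
def A : P.Hil →ₗ.[ℂ] P.Hil := P.opGraph.toLinearPMap

/-- `φ ∈ D(A)` and `A φ = ψ` if and only if `(φ, ψ)` is in the graph. -/
theorem A_graph : P.A.graph = P.opGraph :=
  P.opGraph.toLinearPMap_graph_eq P.opGraph_functional

/-- The continuous representative on `[0, ℓ]` of a class in `L²((0, ℓ))` (if there is one). -/
def contRep (φ₁ : Lp ℂ 2 P.μ) : ℝ → ℂ :=
  open Classical in
  if h : ∃ u : ℝ → ℂ, ContinuousOn u (Icc 0 P.ℓ) ∧ φ₁ =ᵐ[P.μ] u then h.choose else 0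

theorem contRep_eqOn {φ₁ : Lp ℂ 2 P.μ} {u : ℝ → ℂ} (hu : ContinuousOn u (Icc 0 P.ℓ))
    (h : φ₁ =ᵐ[P.μ] u) : EqOn (P.contRep φ₁) u (Icc 0 P.ℓ) := by
  have hex : ∃ u : ℝ → ℂ, ContinuousOn u (Icc 0 P.ℓ) ∧ φ₁ =ᵐ[P.μ] u := ⟨u, hu, h⟩
  have hs := hex.choose_spec
  rw [contRep, dif_pos hex]
  exact P.eqOn_of_ae_eq hs.1 hu (hs.2.symm.trans h)

/-- The bulk component `f₁(t, z)` of a function `f : ℝ → D(A)`, for `z ∈ [0, ℓ]`. -/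
def bulkField (f : ℝ → GraphDomain P.A) (t : ℝ) (z : Icc (0 : ℝ) P.ℓ) : ℂ :=
  P.contRep (GraphDomain.incl P.A (f t)).fst z

/-- The spacetime `ℝ × [0, ℓ]`. -/
abbrev Spacetime : Type := ℝ × Icc (0 : ℝ) P.ℓ

/-- The support of `f₁` in `ℝ × [0, ℓ]`. -/
def bulkSupport (f : ℝ → GraphDomain P.A) : Set P.Spacetime :=
  closure {p | P.bulkField f p.1 p.2 ≠ 0}

/-- The causal future `J₊(O)` in the flat strip `ℝ × [0, ℓ]`. -/
def causalFuture (O : Set P.Spacetime) : Set P.Spacetime :=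
  {q | ∃ p ∈ O, |(q.2 : ℝ) - p.2| ≤ q.1 - p.1}

/-- The causal past `J₋(O)` in the flat strip `ℝ × [0, ℓ]`. -/
def causalPast (O : Set P.Spacetime) : Set P.Spacetime :=
  {q | ∃ p ∈ O, |(q.2 : ℝ) - p.2| ≤ p.1 - q.1}

/-- `J(O) = J₊(O) ∪ J₋(O)`. -/
def causalHull (O : Set P.Spacetime) : Set P.Spacetime := P.causalFuture O ∪ P.causalPast O

/-- The hypotheses on the parameters under which `A` is positive. -/
structure PositivityHypotheses : Prop where
  potential : ∀ z ∈ Icc 0 P.ℓ, 0 ≤ P.m ^ 2 + P.V z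
  β₂'_ne : P.β₂' ≠ 0
  angle : P.α = 0 ∨ (Real.pi / 2 ≤ P.α ∧ P.α < Real.pi)
  case_pos : 0 < P.β₂' → 0 ≤ P.β₁ ∧ P.β₂ < 0 ∧ P.β₁' < 0
  case_neg : P.β₂' < 0 → P.β₁ ≤ 0 ∧ 0 < P.β₂ ∧ 0 < P.β₁'

/-- `Eop : C²₀(ℝ, D(A)) → C²(ℝ, D(A))` is a causal propagator with integral kernel `K(t - t')`. -/
structure IsCausalPropagator (Eop : C2c P.A →ₗ[ℂ] C2 P.A) (K : ℝ → P.Hil →L[ℂ] P.Hil) : Prop where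
  integralOperator : IsIntegralOperator P.A Eop K
  solution : ∀ (f : C2c P.A) (t : ℝ), kleinGordon P.A (Eop f) t = 0
  annihilates : ∀ (f : C2c P.A) (t : ℝ), integralOp K (kleinGordon P.A f) t = 0
  causal_support : ∀ f : C2c P.A, P.bulkSupport (Eop f) ⊆ P.causalHull (P.bulkSupport f)
  kernel_zero : K 0 = 0
  kernel_deriv : ∀ φ : P.Hil, HasDerivAt (fun t => K t φ) (-φ) 0

end BulkBoundarySystem

end

/-! Everything about `A` is encoded in one bounded operator, the resolvent `R = (A + 1)⁻¹`. Once `R`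
is known to be compact, symmetric and injective, with `(φ, ψ)` in the graph of `A` exactly when `R
(φ + ψ) = φ`, and `A ≥ 0`, the spectral theorem for `R` gives self-adjointness, non-negative
eigenvalues and completeness of the eigenvectors; this is packaged as `IsNonnegResolvent`.

The resolvent is constructed variationally. The form domain consists of pairs `(u, η)` with `u = sin
α · c + ∫₀ g`, so that for `α = 0` the Dirichlet condition is built in. Integrating `(A + 1) φ` by
parts and eliminating `∂_z u(ℓ)` through `η = β₁' u(ℓ) - β₂' ∂_z u(ℓ)` gives a symmetric form; the
sign hypotheses make its boundary terms non-negative, hence the form coercive and its operator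
invertible. Weak solutions are strong ones by testing, and conversely by integration by parts
(`mem_opGraph`, `incl_formSolve_of_mem_opGraph`). Compactness of `R` is that of the embedding of the
form domain, by Arzelà-Ascoli.

Functions of `A` bounded on `[0, ∞)` are summed over eigenprojections. The kernel `-sin(√λ t)/√λ` is
1-Lipschitz in `t` uniformly in `λ`, whence norm continuity; its slopes are uniformly bounded,
whence strong differentiability by dominated convergence; its second order Taylor remainders are at
most `(s - t)² (1 + λ)`, which the graph norm absorbs, whence norm differentiability from `D(A)` to
`H`. The kernel commutes with `A`, so the propagator is an honest convolution in `D(A)`, and both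
wave equation identities come from integrating a total derivative over a compactly supported
function.

Causality is a weighted energy estimate. For a positive weight with `|n'| ≤ L n`, the energy of a
solution weighted by `n` grows at most like `exp ((L + 1) t)`. With `n = sech (L (z - z₀))`, data
vanishing within distance `r` of `z₀` have weighted energy of order `exp (-L r)`, while a
contribution within distance `d` of `z₀` is weighted by at least `exp (-L d)`. If `t + d < r`,
letting `L → ∞` kills the solution near `z₀`: the propagation speed is at most 1. The boundary
component is carried along with weight `n(ℓ)`. -/

noncomputable section

open scoped InnerProduct

/-! ### Spectral decomposition of an operator with compact resolvent -/

namespace UnboundedOp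

variable {H : Type*} [NormedAddCommGroup H] [InnerProductSpace ℂ H]

/-- `R` is a compact symmetric operator which inverts `A + 1`, where `A ≥ 0`. -/
structure IsNonnegResolvent (A : H →ₗ.[ℂ] H) (R : H →L[ℂ] H) : Prop where
  mem_graph_iff : ∀ φ ψ : H, (φ, ψ) ∈ A.graph ↔ R (φ + ψ) = φ
  isCompact : IsCompactOperator R
  symm : ∀ φ ψ : H, inner ℂ (R φ) ψ = inner ℂ φ (R ψ)
  nonneg : ∀ χ : H, 0 ≤ (inner ℂ (R χ) (χ - R χ)).re

namespace IsNonnegResolvent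

variable {A : H →ₗ.[ℂ] H} {R : H →L[ℂ] H} (hR : IsNonnegResolvent A R)
include hR

theorem mem_graph (χ : H) : (R χ, χ - R χ) ∈ A.graph := by
  rw [hR.mem_graph_iff]
  simp

theorem eq_zero_of_apply_eq_zero {χ : H} (h : R χ = 0) : χ = 0 := by
  have h1 := hR.mem_graph χ
  rw [h, sub_zero] at h1
  exact A.graph_fst_eq_zero_snd h1 rfl

theorem mem_eigenspace_iff {lam : ℝ} {φ : H} :
    φ ∈ eigenspace A lam ↔ ((1 + lam : ℝ) : ℂ) • R φ = φ := by
  change (φ, (lam : ℂ) • φ) ∈ A.graph ↔ _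
  rw [hR.mem_graph_iff, map_add, map_smul, Complex.ofReal_add, Complex.ofReal_one, add_smul,
    one_smul]

theorem isClosed_eigenspace (lam : ℝ) : IsClosed (eigenspace A lam : Set H) := by
  have : (eigenspace A lam : Set H) = {φ | ((1 + lam : ℝ) : ℂ) • R φ = φ} := by
    ext φ
    exact hR.mem_eigenspace_iff
  rw [this]
  exact isClosed_eq (by fun_prop) continuous_id

theorem nonneg_of_mem_eigenspace {lam : ℝ} {φ : H} (h : φ ∈ eigenspace A lam) (hφ : φ ≠ 0) :
    0 ≤ lam := by
  rw [hR.mem_eigenspace_iff] at h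
  have hR0 : R φ ≠ 0 := fun h0 => hφ (hR.eq_zero_of_apply_eq_zero h0)
  have h1 := hR.nonneg φ
  have h2 : φ - R φ = (lam : ℂ) • R φ := by
    nth_rewrite 1 [← h]
    push_cast
    module
  have h5 : (inner ℂ (R φ) (R φ)).re = ‖R φ‖ ^ 2 := inner_self_eq_norm_sq (𝕜 := ℂ) (R φ)
  rw [h2, inner_smul_right, Complex.re_ofReal_mul, h5] at h1
  have h3 : 0 < ‖R φ‖ ^ 2 := by positivity
  exact nonneg_of_mul_nonneg_left h1 h3

theorem eigenspace_nonneg {lam : ℝ} (h : eigenspace A lam ≠ ⊥) : 0 ≤ lam := by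
  obtain ⟨φ, hφ, h0⟩ := Submodule.exists_mem_ne_zero_of_ne_bot h
  exact hR.nonneg_of_mem_eigenspace hφ h0

theorem inner_eq_zero_of_mem_eigenspace {lam nu : ℝ} (hne : lam ≠ nu) {φ ψ : H}
    (hφ : φ ∈ eigenspace A lam) (hψ : ψ ∈ eigenspace A nu) : inner ℂ φ ψ = (0 : ℂ) := by
  rw [hR.mem_eigenspace_iff] at hφ hψ
  have h1 := hR.symm φ ψ
  have e1 : inner ℂ φ ψ = ((1 + lam : ℝ) : ℂ) * inner ℂ (R φ) ψ := by
    nth_rewrite 1 [← hφ]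
    rw [inner_smul_left, Complex.conj_ofReal]
  have e2 : inner ℂ φ ψ = ((1 + nu : ℝ) : ℂ) * inner ℂ φ (R ψ) := by
    nth_rewrite 1 [← hψ]
    rw [inner_smul_right]
  rw [← h1] at e2
  have e3 : ((lam : ℂ) - nu) * inner ℂ (R φ) ψ = 0 := by
    rw [e1] at e2
    push_cast at e2
    linear_combination e2
  have e4 : inner ℂ (R φ) ψ = (0 : ℂ) := by
    refine (mul_eq_zero.1 e3).resolve_left ?_
    exact sub_ne_zero.2 (by exact_mod_cast hne)
  rw [e1, e4, mul_zero]

theorem orthogonalFamily_eigenspace :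
    OrthogonalFamily ℂ (fun lam : ℝ => eigenspace A lam)
      (fun lam => (eigenspace A lam).subtypeₗᵢ) := by
  intro lam nu hne φ ψ
  exact hR.inner_eq_zero_of_mem_eigenspace hne φ.2 ψ.2

theorem isSymmetric : (R : H →ₗ[ℂ] H).IsSymmetric := hR.symm

/-- An eigenvalue `μ` of `R` is real by symmetry and nonzero because `R` is injective, so it
corresponds to the eigenvalue `μ⁻¹ - 1` of `A`. -/
theorem eigenspace_le_iSup (μ : ℂ) :
    Module.End.eigenspace (R : Module.End ℂ H) μ ≤ ⨆ lam : ℝ, eigenspace A lam := by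
  intro φ hφ
  by_cases h0 : φ = 0
  · rw [h0]
    exact zero_mem _
  have hev : Module.End.HasEigenvalue (R : Module.End ℂ H) μ :=
    Module.End.hasEigenvalue_of_hasEigenvector ⟨hφ, h0⟩
  have hreal := LinearMap.IsSymmetric.conj_eigenvalue_eq_self hR.isSymmetric hev
  have hre : ((μ.re : ℝ) : ℂ) = μ := Complex.conj_eq_iff_re.1 hreal
  rw [Module.End.mem_eigenspace_iff] at hφ
  have hφ' : R φ = μ • φ := hφ
  have hμ : μ ≠ 0 := by
    rintro rfl
    rw [zero_smul] at hφ'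
    exact h0 (hR.eq_zero_of_apply_eq_zero hφ')
  refine Submodule.mem_iSup_of_mem (μ.re⁻¹ - 1) ?_
  rw [hR.mem_eigenspace_iff, hφ', smul_smul]
  have : ((1 + (μ.re⁻¹ - 1) : ℝ) : ℂ) * μ = 1 := by
    push_cast
    rw [hre]
    field_simp
    ring
  rw [this, one_smul]

variable [CompleteSpace H]

/-- The domain contains the range of `R`, and a vector orthogonal to that range is in the kernel of
the symmetric operator `R`, hence zero. -/
theorem dense_domain : Dense (A.domain : Set H) := by
  have h : (A.domain)ᗮ = ⊥ := by
    rw [Submodule.eq_bot_iff]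
    intro χ hχ
    refine hR.eq_zero_of_apply_eq_zero ?_
    refine ext_inner_left ℂ fun ψ => ?_
    rw [← hR.symm, inner_zero_right]
    exact hχ (R ψ) (A.mem_domain_of_mem_graph (hR.mem_graph ψ))
  exact Submodule.dense_iff_topologicalClosure_eq_top.2
    (Submodule.topologicalClosure_eq_top_iff.2 h)

/-- Parametrising the graph as `(R χ, χ - R χ)`, the defining relation of the adjoint graph turns,
by symmetry of `R`, into `R (φ + ψ) = φ`, which is the relation defining the graph of `A`. -/
theorem isSelfAdjoint : IsSelfAdjoint A := by
  rw [LinearPMap.isSelfAdjoint_def]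
  apply LinearPMap.eq_of_eq_graph
  rw [LinearPMap.adjoint_graph_eq_graph_adjoint hR.dense_domain]
  ext ⟨φ, ψ⟩
  rw [Submodule.mem_adjoint_iff, hR.mem_graph_iff]
  constructor
  · intro h
    refine ext_inner_left ℂ fun χ => ?_
    have h1 := h _ _ (hR.mem_graph χ)
    simp only [inner_sub_left, hR.symm] at h1
    rw [map_add, inner_add_right]
    linear_combination -h1
  · intro h a b hab
    rw [hR.mem_graph_iff] at hab
    have e1 : inner ℂ a φ = inner ℂ a (R (φ + ψ)) := by rw [h]
    have e2 : inner ℂ (R (a + b)) (φ + ψ) = inner ℂ (a + b) (R (φ + ψ)) := hR.symm _ _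
    rw [hab, h, inner_add_right, inner_add_left] at e2
    linear_combination -e2

theorem completeSpace_eigenspace (lam : ℝ) : CompleteSpace (eigenspace A lam) :=
  (hR.isClosed_eigenspace lam).completeSpace_coe

theorem isHilbertSum_eigenspace :
    IsHilbertSum ℂ (fun lam : ℝ => eigenspace A lam)
      (fun lam => (eigenspace A lam).subtypeₗᵢ) := by
  have := hR.completeSpace_eigenspace
  refine IsHilbertSum.mkInternal _ hR.orthogonalFamily_eigenspace ?_
  rw [top_le_iff, Submodule.topologicalClosure_eq_top_iff, ← le_bot_iff,
    ← ContinuousLinearMap.orthogonalComplement_iSup_eigenspaces_eq_bot hR.isCompact hR.isSymmetric]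
  exact Submodule.orthogonal_le (iSup_le hR.eigenspace_le_iSup)

theorem spectralProj_mem (lam : ℝ) (φ : H) : spectralProj A lam φ ∈ eigenspace A lam := by
  have h : spectralProj A lam φ ∈ (eigenspace A lam).topologicalClosure :=
    Submodule.starProjection_apply_mem _ _
  rwa [(hR.isClosed_eigenspace lam).submodule_topologicalClosure_eq] at h

omit hR in
theorem spectralProj_of_mem {lam : ℝ} {φ : H} (h : φ ∈ eigenspace A lam) :
    spectralProj A lam φ = φ :=
  Submodule.starProjection_eq_self_iff.2 (Submodule.le_topologicalClosure _ h)

theorem spectralProj_of_mem_ne {lam nu : ℝ} (hne : lam ≠ nu) {φ : H} (h : φ ∈ eigenspace A nu) :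
    spectralProj A lam φ = 0 := by
  rw [spectralProj, Submodule.starProjection_apply_eq_zero_iff,
    (hR.isClosed_eigenspace lam).submodule_topologicalClosure_eq]
  exact fun ψ hψ => hR.inner_eq_zero_of_mem_eigenspace hne hψ h

theorem spectralProj_of_neg {lam : ℝ} (h : lam < 0) (φ : H) : spectralProj A lam φ = 0 := by
  by_contra h0
  exact absurd (hR.nonneg_of_mem_eigenspace (hR.spectralProj_mem lam φ) h0) (not_le.2 h)

/-- Uniqueness of the expansion in eigenvectors. Later identities between functions of `A` are all
checked one eigenspace at a time, through this and `ext_spectralProj`. -/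
theorem spectralProj_hasSum {g : ℝ → H} (hg : ∀ lam, g lam ∈ eigenspace A lam) {φ : H}
    (h : HasSum g φ) (lam : ℝ) : spectralProj A lam φ = g lam := by
  have h1 := (spectralProj A lam).hasSum h
  refine h1.unique ?_
  convert hasSum_single (f := fun nu => spectralProj A lam (g nu)) lam ?_ using 1
  · exact (spectralProj_of_mem (hg lam)).symm
  · intro nu hne
    exact hR.spectralProj_of_mem_ne hne.symm (hg nu)

theorem hasSum_spectralProj (φ : H) : HasSum (fun lam : ℝ => spectralProj A lam φ) φ := by
  have hV := hR.isHilbertSum_eigenspace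
  have h := hV.hasSum_linearIsometryEquiv_symm (hV.linearIsometryEquiv φ)
  rw [LinearIsometryEquiv.symm_apply_apply] at h
  convert h using 2 with lam
  exact hR.spectralProj_hasSum (g := fun lam => (hV.linearIsometryEquiv φ lam : H))
    (fun lam => (hV.linearIsometryEquiv φ lam).2) h lam

omit [CompleteSpace H] in
theorem hasSum_norm_sq {g : ℝ → H} (hg : ∀ lam, g lam ∈ eigenspace A lam) {φ : H}
    (h : HasSum g φ) : HasSum (fun lam => ‖g lam‖ ^ 2) (‖φ‖ ^ 2) := by
  have h1 : Filter.Tendsto (fun s : Finset ℝ => ‖∑ lam ∈ s, g lam‖ ^ 2) Filter.atTop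
      (nhds (‖φ‖ ^ 2)) := ((h.norm).pow 2)
  refine h1.congr fun s => ?_
  exact hR.orthogonalFamily_eigenspace.norm_sum (fun lam => ⟨g lam, hg lam⟩) s

theorem ext_spectralProj {φ ψ : H} (h : ∀ lam, spectralProj A lam φ = spectralProj A lam ψ) :
    φ = ψ := by
  refine (hR.hasSum_spectralProj φ).unique ?_
  simp only [h]
  exact hR.hasSum_spectralProj ψ

theorem spectralProj_resolvent (lam : ℝ) (φ : H) :
    ((1 + lam : ℝ) : ℂ) • spectralProj A lam (R φ) = spectralProj A lam φ := by
  have h := R.hasSum (hR.hasSum_spectralProj φ)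
  have hmem : ∀ nu, R (spectralProj A nu φ) ∈ eigenspace A nu := by
    intro nu
    have := hR.spectralProj_mem nu φ
    rw [hR.mem_eigenspace_iff] at this ⊢
    rw [← map_smul, this]
  rw [hR.spectralProj_hasSum hmem h]
  exact hR.mem_eigenspace_iff.1 (hR.spectralProj_mem lam φ)

theorem spectralProj_of_mem_graph {φ ψ : H} (h : (φ, ψ) ∈ A.graph) (lam : ℝ) :
    spectralProj A lam ψ = (lam : ℂ) • spectralProj A lam φ := by
  rw [hR.mem_graph_iff] at h
  have h1 := hR.spectralProj_resolvent lam (φ + ψ)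
  rw [h, map_add, Complex.ofReal_add, Complex.ofReal_one, add_smul, one_smul] at h1
  exact (add_left_cancel h1).symm

end IsNonnegResolvent

end UnboundedOp

/-! ### Bounded functional calculus on the eigenspaces -/

namespace UnboundedOp

variable {H : Type*} [NormedAddCommGroup H] [InnerProductSpace ℂ H]

/-- Boundedness on the half-line which contains the spectrum. -/
def BoundedOnNonneg (f : ℝ → ℝ) (C : ℝ) : Prop := ∀ lam, 0 ≤ lam → |f lam| ≤ C

theorem BoundedOnNonneg.sub {f g : ℝ → ℝ} {C C' : ℝ} (hf : BoundedOnNonneg f C)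
    (hg : BoundedOnNonneg g C') : BoundedOnNonneg (fun lam => f lam - g lam) (C + C') :=
  fun lam hl => (abs_sub _ _).trans (add_le_add (hf lam hl) (hg lam hl))

theorem BoundedOnNonneg.neg {f : ℝ → ℝ} {C : ℝ} (hf : BoundedOnNonneg f C) :
    BoundedOnNonneg (fun lam => - f lam) C := fun lam hl => by
  rw [abs_neg]
  exact hf lam hl

namespace IsNonnegResolvent

variable {A : H →ₗ.[ℂ] H} {R : H →L[ℂ] H} [CompleteSpace H] (hR : IsNonnegResolvent A R)
include hR

theorem hasSum_norm_sq_spectralProj (φ : H) :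
    HasSum (fun lam => ‖spectralProj A lam φ‖ ^ 2) (‖φ‖ ^ 2) :=
  hR.hasSum_norm_sq (fun lam => hR.spectralProj_mem lam φ) (hR.hasSum_spectralProj φ)

theorem norm_smul_spectralProj_sq_le {f : ℝ → ℝ} {C : ℝ} (hf : BoundedOnNonneg f C) (φ : H)
    (lam : ℝ) :
    ‖(f lam : ℂ) • spectralProj A lam φ‖ ^ 2 ≤ C ^ 2 * ‖spectralProj A lam φ‖ ^ 2 := by
  rcases lt_or_ge lam 0 with h | h
  · simp [hR.spectralProj_of_neg h]
  · rw [norm_smul, mul_pow, Complex.norm_real, Real.norm_eq_abs]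
    gcongr
    exact hf lam h

theorem summable_smul_spectralProj {f : ℝ → ℝ} {C : ℝ} (hf : BoundedOnNonneg f C) (φ : H) :
    Summable fun lam => (f lam : ℂ) • spectralProj A lam φ := by
  have h := (hR.orthogonalFamily_eigenspace.summable_iff_norm_sq_summable
    (fun lam => ⟨(f lam : ℂ) • spectralProj A lam φ,
      Submodule.smul_mem _ _ (hR.spectralProj_mem lam φ)⟩)).2 ?_
  · exact h
  · exact Summable.of_nonneg_of_le (fun _ => by positivity)
      (hR.norm_smul_spectralProj_sq_le hf φ)
      ((hR.hasSum_norm_sq_spectralProj φ).summable.mul_left (C ^ 2))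

theorem norm_le_of_hasSum {f : ℝ → ℝ} {C : ℝ} (hC : 0 ≤ C) (hf : BoundedOnNonneg f C) {φ ψ : H}
    (h : HasSum (fun lam => (f lam : ℂ) • spectralProj A lam φ) ψ) : ‖ψ‖ ≤ C * ‖φ‖ := by
  have h1 := hR.hasSum_norm_sq
    (fun lam => Submodule.smul_mem _ _ (hR.spectralProj_mem lam φ)) h
  have h2 := (hR.hasSum_norm_sq_spectralProj φ).mul_left (C ^ 2)
  have h3 := hasSum_le (hR.norm_smul_spectralProj_sq_le hf φ) h1 h2
  rw [← mul_pow] at h3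
  exact le_of_sq_le_sq h3 (by positivity)

theorem exists_diag {f : ℝ → ℝ} {C : ℝ} (hC : 0 ≤ C) (hf : BoundedOnNonneg f C) :
    ∃ B : H →L[ℂ] H, ∀ φ, HasSum (fun lam => (f lam : ℂ) • spectralProj A lam φ) (B φ) := by
  have hs := fun φ => (hR.summable_smul_spectralProj hf φ).hasSum
  refine ⟨LinearMap.mkContinuous
    { toFun := fun φ => ∑' lam, (f lam : ℂ) • spectralProj A lam φ
      map_add' := fun φ ψ => ?_
      map_smul' := fun c φ => ?_ } C fun φ => hR.norm_le_of_hasSum hC hf (hs φ), hs⟩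
  · refine HasSum.tsum_eq ?_
    simp only [map_add, smul_add]
    exact (hs φ).add (hs ψ)
  · refine HasSum.tsum_eq ?_
    simp only [map_smul, RingHom.id_apply, smul_comm _ c]
    exact (hs φ).const_smul c

end IsNonnegResolvent

open Classical in
/-- The function `f(A)` of an operator with a complete system of eigenvectors, for `f` bounded on
the spectrum. -/
def diag [CompleteSpace H] (A : H →ₗ.[ℂ] H) (f : ℝ → ℝ) : H →L[ℂ] H :=
  if h : ∃ B : H →L[ℂ] H, ∀ φ, HasSum (fun lam => (f lam : ℂ) • spectralProj A lam φ) (B φ)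
  then h.choose else 0

namespace IsNonnegResolvent

variable {A : H →ₗ.[ℂ] H} {R : H →L[ℂ] H} [CompleteSpace H] (hR : IsNonnegResolvent A R)
include hR

theorem hasSum_diag {f : ℝ → ℝ} {C : ℝ} (hC : 0 ≤ C) (hf : BoundedOnNonneg f C) (φ : H) :
    HasSum (fun lam => (f lam : ℂ) • spectralProj A lam φ) (diag A f φ) := by
  have h := hR.exists_diag hC hf
  rw [diag, dif_pos h]
  exact h.choose_spec φ

theorem isFunctionOf_diag {f : ℝ → ℝ} {C : ℝ} (hC : 0 ≤ C) (hf : BoundedOnNonneg f C) :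
    IsFunctionOf A f (diag A f) :=
  ⟨hR.hasSum_spectralProj, hR.hasSum_diag hC hf⟩

theorem norm_diag_apply_le {f : ℝ → ℝ} {C : ℝ} (hC : 0 ≤ C) (hf : BoundedOnNonneg f C) (φ : H) :
    ‖diag A f φ‖ ≤ C * ‖φ‖ :=
  hR.norm_le_of_hasSum hC hf (hR.hasSum_diag hC hf φ)

theorem spectralProj_diag {f : ℝ → ℝ} {C : ℝ} (hC : 0 ≤ C) (hf : BoundedOnNonneg f C) (φ : H)
    (lam : ℝ) : spectralProj A lam (diag A f φ) = (f lam : ℂ) • spectralProj A lam φ :=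
  hR.spectralProj_hasSum (fun nu => Submodule.smul_mem _ _ (hR.spectralProj_mem nu φ))
    (hR.hasSum_diag hC hf φ) lam

theorem diag_resolvent {f : ℝ → ℝ} {C : ℝ} (hC : 0 ≤ C) (hf : BoundedOnNonneg f C) (φ : H) :
    diag A f (R φ) = R (diag A f φ) := by
  refine hR.ext_spectralProj fun lam => ?_
  rcases lt_or_ge lam 0 with h | h
  · simp [hR.spectralProj_of_neg h]
  · have h1 := hR.spectralProj_resolvent lam φ
    have h2 := hR.spectralProj_resolvent lam (diag A f φ)
    rw [hR.spectralProj_diag hC hf, ← h1, smul_comm] at h2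
    rw [hR.spectralProj_diag hC hf]
    have h3 : ((1 + lam : ℝ) : ℂ) ≠ 0 := Complex.ofReal_ne_zero.2 (by positivity)
    exact (smul_right_injective H h3 h2).symm

theorem diag_mem_graph {f : ℝ → ℝ} {C : ℝ} (hC : 0 ≤ C) (hf : BoundedOnNonneg f C) {φ ψ : H}
    (h : (φ, ψ) ∈ A.graph) : (diag A f φ, diag A f ψ) ∈ A.graph := by
  rw [hR.mem_graph_iff] at h ⊢
  rw [← map_add, ← hR.diag_resolvent hC hf, h]

/-- A function of `A` which grows at most like `1 + lam` is controlled by the graph norm. -/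
theorem norm_le_graph_norm {f : ℝ → ℝ} {c : ℝ} (hc : 0 ≤ c)
    (hfc : ∀ lam, 0 ≤ lam → |f lam| ≤ c * (1 + lam)) {φ ψ χ : H} (h : (φ, ψ) ∈ A.graph)
    (hχ : ∀ lam, spectralProj A lam χ = (f lam : ℂ) • spectralProj A lam φ) :
    ‖χ‖ ≤ c * (‖φ‖ + ‖ψ‖) := by
  have hb : BoundedOnNonneg (fun lam => f lam / (1 + lam)) c := by
    intro lam hl
    rw [abs_div, abs_of_pos (by positivity : 0 < 1 + lam), div_le_iff₀ (by positivity)]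
    exact hfc lam hl
  -- Since `φ + ψ = (1 + A) φ`, the growth of `f` is moved onto the vector and only the bounded
  -- function `f / (1 + λ)` remains.
  have he : diag A (fun lam => f lam / (1 + lam)) (φ + ψ) = χ := by
    refine hR.ext_spectralProj fun lam => ?_
    rw [hR.spectralProj_diag hc hb, hχ, map_add, hR.spectralProj_of_mem_graph h]
    rcases lt_or_ge lam 0 with hl | hl
    · simp [hR.spectralProj_of_neg hl]
    · have h3 : (1 + lam : ℂ) ≠ 0 := by
        exact_mod_cast (by positivity : (1 + lam : ℝ) ≠ 0)
      have e : spectralProj A lam φ + (lam : ℂ) • spectralProj A lam φ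
          = (1 + lam : ℂ) • spectralProj A lam φ := by module
      rw [e, smul_smul]
      congr 1
      push_cast
      field_simp
  rw [← he]
  exact (hR.norm_diag_apply_le hc hb _).trans
    (mul_le_mul_of_nonneg_left (norm_add_le _ _) hc)

/-- Dominated convergence for functions of `A`. -/
theorem tendsto_of_spectralProj {ι : Type*} {l : Filter ι} [l.NeBot] {F : ι → ℝ → ℝ} {C : ℝ}
    (hF : ∀ᶠ i in l, BoundedOnNonneg (F i) C)
    (hlim : ∀ lam, 0 ≤ lam → Filter.Tendsto (fun i => F i lam) l (nhds 0)) {φ : H} {χ : ι → H}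
    (hχ : ∀ i lam, spectralProj A lam (χ i) = (F i lam : ℂ) • spectralProj A lam φ) :
    Filter.Tendsto χ l (nhds 0) := by
  rw [tendsto_zero_iff_norm_tendsto_zero]
  -- By Parseval the norm squared is a sum over eigenvalues, dominated by `C² ‖P_λ φ‖²`, which is
  -- summable.
  have key : Filter.Tendsto (fun i => ∑' lam, ‖spectralProj A lam (χ i)‖ ^ 2) l
      (nhds (∑' _ : ℝ, (0 : ℝ))) := by
    refine tendsto_tsum_of_dominated_convergence
      ((hR.hasSum_norm_sq_spectralProj φ).summable.mul_left (C ^ 2)) ?_ ?_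
    · intro lam
      rcases lt_or_ge lam 0 with hl | hl
      · simp [hR.spectralProj_of_neg hl]
      · simp only [hχ, norm_smul, mul_pow, Complex.norm_real, Real.norm_eq_abs, sq_abs]
        have := ((hlim lam hl).pow 2).mul_const (‖spectralProj A lam φ‖ ^ 2)
        simpa using this
    · filter_upwards [hF] with i hi lam
      rw [Real.norm_of_nonneg (by positivity), hχ]
      exact hR.norm_smul_spectralProj_sq_le hi φ lam
  simp only [(hR.hasSum_norm_sq_spectralProj _).tsum_eq, tsum_zero] at key
  have := key.sqrt
  simpa using this

end IsNonnegResolvent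

end UnboundedOp

/-! ## The scalar functions `sin(√lam t)/√lam` and `cos(√lam t)` -/

theorem hasDerivAt_sinSqrtDivSqrt {lam : ℝ} (hl : 0 ≤ lam) (t : ℝ) :
    HasDerivAt (fun t => sinSqrtDivSqrt t lam) (Real.cos (√lam * t)) t := by
  unfold sinSqrtDivSqrt
  split_ifs with h
  · simpa [h] using hasDerivAt_id' t
  · have hs : √lam ≠ 0 := by
      rw [Real.sqrt_ne_zero hl]
      exact h
    have h1 := (((hasDerivAt_id' t).const_mul √lam).sin).div_const √lam
    rwa [mul_one, mul_div_cancel_right₀ _ hs] at h1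

theorem hasDerivAt_cos_sqrt {lam : ℝ} (hl : 0 ≤ lam) (t : ℝ) :
    HasDerivAt (fun t => Real.cos (√lam * t)) (-(lam * sinSqrtDivSqrt t lam)) t := by
  have h1 := ((hasDerivAt_id' t).const_mul √lam).cos
  convert h1 using 1
  rw [sinSqrtDivSqrt]
  split_ifs with h
  · simp [h]
  · have hs : √lam ≠ 0 := by
      rw [Real.sqrt_ne_zero hl]
      exact h
    field_simp
    rw [Real.sq_sqrt hl]

theorem abs_sub_le_of_hasDerivAt {f f' : ℝ → ℝ} {C : ℝ} (hf : ∀ t, HasDerivAt f (f' t) t)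
    (hC : ∀ t, |f' t| ≤ C) (s t : ℝ) : |f s - f t| ≤ C * |s - t| :=
  convex_univ.norm_image_sub_le_of_norm_hasDerivWithin_le (f := f) (f' := f')
    (fun x _ => (hf x).hasDerivWithinAt) (fun x _ => hC x) (mem_univ t) (mem_univ s)

/-- Mean value inequality for `x ↦ f x - x f' t`. The sharp factor `1/2` is given up, as only the
quadratic order is needed. -/
theorem abs_taylor_le_of_hasDerivAt {f f' : ℝ → ℝ} {C : ℝ} (hf : ∀ t, HasDerivAt f (f' t) t)
    (hC : ∀ s t, |f' s - f' t| ≤ C * |s - t|) (s t : ℝ) :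
    |f s - f t - (s - t) * f' t| ≤ C * (s - t) ^ 2 := by
  have hC0 : 0 ≤ C := by
    have := (abs_nonneg _).trans (hC 1 0)
    simpa using this
  have h1 : ∀ x ∈ uIcc t s, HasDerivWithinAt (fun x => f x - x * f' t) (f' x - f' t) (uIcc t s) x :=
    fun x _ => by
      have h := ((hf x).sub ((hasDerivAt_id' x).mul_const (f' t))).hasDerivWithinAt (s := uIcc t s)
      rwa [one_mul] at h
  have h2 : ∀ x ∈ uIcc t s, ‖f' x - f' t‖ ≤ C * |s - t| := fun x hx =>
    (hC x t).trans (mul_le_mul_of_nonneg_left (abs_sub_left_of_mem_uIcc hx) hC0)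
  have h3 := (convex_uIcc t s).norm_image_sub_le_of_norm_hasDerivWithin_le h1 h2
    left_mem_uIcc right_mem_uIcc
  rw [Real.norm_eq_abs, Real.norm_eq_abs, mul_assoc, abs_mul_abs_self] at h3
  convert h3 using 2 <;> ring

theorem abs_sinSqrtDivSqrt_sub_le {lam : ℝ} (hl : 0 ≤ lam) (s t : ℝ) :
    |sinSqrtDivSqrt s lam - sinSqrtDivSqrt t lam| ≤ |s - t| := by
  simpa using abs_sub_le_of_hasDerivAt (hasDerivAt_sinSqrtDivSqrt hl)
    (fun t => Real.abs_cos_le_one _) s t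

@[simp] theorem sinSqrtDivSqrt_zero (lam : ℝ) : sinSqrtDivSqrt 0 lam = 0 := by
  simp [sinSqrtDivSqrt]

theorem sinSqrtDivSqrt_neg (t lam : ℝ) : sinSqrtDivSqrt (-t) lam = - sinSqrtDivSqrt t lam := by
  unfold sinSqrtDivSqrt
  split_ifs
  · rfl
  · rw [mul_neg, Real.sin_neg, neg_div]

theorem abs_sinSqrtDivSqrt_le {lam : ℝ} (hl : 0 ≤ lam) (t : ℝ) :
    |sinSqrtDivSqrt t lam| ≤ |t| := by
  simpa using abs_sinSqrtDivSqrt_sub_le hl t 0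

theorem sqrt_le_one_add {lam : ℝ} (hl : 0 ≤ lam) : √lam ≤ 1 + lam := by
  rw [Real.sqrt_le_left (by positivity)]
  nlinarith

/-- The natural constant is `√λ`; it is weakened to `1 + λ` because that is the growth which the
graph norm controls. -/
theorem abs_cos_sqrt_sub_le {lam : ℝ} (hl : 0 ≤ lam) (s t : ℝ) :
    |Real.cos (√lam * s) - Real.cos (√lam * t)| ≤ (1 + lam) * |s - t| := by
  refine abs_sub_le_of_hasDerivAt (f := fun t => Real.cos (√lam * t))
    (f' := fun t => -(√lam * Real.sin (√lam * t))) (fun t => ?_) (fun t => ?_) s t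
  · convert ((hasDerivAt_id' t).const_mul √lam).cos using 1
    ring
  · rw [abs_neg, abs_mul, abs_of_nonneg (Real.sqrt_nonneg _)]
    exact (mul_le_of_le_one_right (Real.sqrt_nonneg _) (Real.abs_sin_le_one _)).trans
      (sqrt_le_one_add hl)

theorem abs_sinSqrtDivSqrt_taylor {lam : ℝ} (hl : 0 ≤ lam) (s t : ℝ) :
    |sinSqrtDivSqrt s lam - sinSqrtDivSqrt t lam - (s - t) * Real.cos (√lam * t)|
      ≤ (s - t) ^ 2 * (1 + lam) := by
  rw [mul_comm _ (1 + lam)]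
  exact abs_taylor_le_of_hasDerivAt (hasDerivAt_sinSqrtDivSqrt hl) (abs_cos_sqrt_sub_le hl) s t

theorem abs_cos_sqrt_taylor {lam : ℝ} (hl : 0 ≤ lam) (s t : ℝ) :
    |Real.cos (√lam * s) - Real.cos (√lam * t) - (s - t) * -(lam * sinSqrtDivSqrt t lam)|
      ≤ (s - t) ^ 2 * (1 + lam) := by
  rw [mul_comm _ (1 + lam)]
  refine abs_taylor_le_of_hasDerivAt (hasDerivAt_cos_sqrt hl) (fun s t => ?_) s t
  rw [← neg_sub', abs_neg, ← mul_sub, abs_mul, abs_of_nonneg hl]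
  have := abs_sinSqrtDivSqrt_sub_le hl s t
  nlinarith [abs_nonneg (s - t), mul_le_mul_of_nonneg_left this hl]

/-! ### Time regularity of the sine and cosine families -/

namespace UnboundedOp

variable {H : Type*} [NormedAddCommGroup H] [InnerProductSpace ℂ H] [CompleteSpace H]

/-- The operator `-sin(√A t)/√A`. -/
def waveKernel (A : H →ₗ.[ℂ] H) (t : ℝ) : H →L[ℂ] H := diag A fun lam => - sinSqrtDivSqrt t lam

/-- The operator `cos(√A t)`. -/
def waveCos (A : H →ₗ.[ℂ] H) (t : ℝ) : H →L[ℂ] H := diag A fun lam => Real.cos (√lam * t)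

theorem boundedOnNonneg_sin (t : ℝ) :
    BoundedOnNonneg (fun lam => - sinSqrtDivSqrt t lam) |t| :=
  BoundedOnNonneg.neg fun _ hl => abs_sinSqrtDivSqrt_le hl t

theorem boundedOnNonneg_cos (t : ℝ) : BoundedOnNonneg (fun lam => Real.cos (√lam * t)) 1 :=
  fun _ _ => Real.abs_cos_le_one _

theorem hasDerivAt_of_norm_sub_le_sq {E : Type*} [NormedAddCommGroup E] [NormedSpace ℝ E]
    {f : ℝ → E} {f' : E} {C t : ℝ}
    (h : ∀ s, ‖f s - f t - (s - t) • f'‖ ≤ C * (s - t) ^ 2) : HasDerivAt f f' t := by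
  rw [hasDerivAt_iff_isLittleO]
  refine Asymptotics.IsBigO.trans_isLittleO (g := fun s => (s - t) ^ 2) ?_ ?_
  · refine Asymptotics.IsBigO.of_bound C (Filter.Eventually.of_forall fun s => ?_)
    rw [Real.norm_of_nonneg (sq_nonneg _)]
    exact h s
  · have h1 : Filter.Tendsto (fun s => s - t) (nhds t) (nhds 0) := by
      have : Continuous fun s : ℝ => s - t := by fun_prop
      simpa using this.tendsto t
    exact (Asymptotics.isLittleO_pow_id (𝕜 := ℝ) one_lt_two).comp_tendsto h1

namespace IsNonnegResolvent

variable {A : H →ₗ.[ℂ] H} {R : H →L[ℂ] H} (hR : IsNonnegResolvent A R)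
include hR

theorem spectralProj_waveKernel (t : ℝ) (φ : H) (lam : ℝ) :
    spectralProj A lam (waveKernel A t φ)
      = ((- sinSqrtDivSqrt t lam : ℝ) : ℂ) • spectralProj A lam φ :=
  hR.spectralProj_diag (abs_nonneg t) (boundedOnNonneg_sin t) φ lam

theorem spectralProj_waveCos (t : ℝ) (φ : H) (lam : ℝ) :
    spectralProj A lam (waveCos A t φ)
      = ((Real.cos (√lam * t) : ℝ) : ℂ) • spectralProj A lam φ :=
  hR.spectralProj_diag zero_le_one (boundedOnNonneg_cos t) φ lam

theorem waveKernel_mem_graph (t : ℝ) {φ ψ : H} (h : (φ, ψ) ∈ A.graph) :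
    (waveKernel A t φ, waveKernel A t ψ) ∈ A.graph :=
  hR.diag_mem_graph (abs_nonneg t) (boundedOnNonneg_sin t) h

theorem norm_waveKernel_sub_le (s t : ℝ) : ‖waveKernel A s - waveKernel A t‖ ≤ |s - t| := by
  refine ContinuousLinearMap.opNorm_le_bound _ (abs_nonneg _) fun φ => ?_
  have hb : BoundedOnNonneg (fun lam => - sinSqrtDivSqrt s lam - - sinSqrtDivSqrt t lam) |s - t| := by
    intro lam hl
    beta_reduce
    rw [← neg_sub', abs_neg]
    exact abs_sinSqrtDivSqrt_sub_le hl s t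
  have he : diag A (fun lam => - sinSqrtDivSqrt s lam - - sinSqrtDivSqrt t lam) φ
      = (waveKernel A s - waveKernel A t) φ := by
    refine hR.ext_spectralProj fun lam => ?_
    rw [hR.spectralProj_diag (abs_nonneg _) hb, sub_apply, map_sub,
      hR.spectralProj_waveKernel, hR.spectralProj_waveKernel, ← sub_smul]
    push_cast
    rfl
  rw [← he]
  exact hR.norm_diag_apply_le (abs_nonneg _) hb φ

theorem continuous_waveKernel : Continuous (waveKernel A) := by
  refine LipschitzWith.continuous (K := 1) (LipschitzWith.of_dist_le_mul fun s t => ?_)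
  rw [dist_eq_norm, NNReal.coe_one, one_mul, Real.dist_eq]
  exact hR.norm_waveKernel_sub_le s t

theorem waveKernel_zero : waveKernel A 0 = 0 := by
  ext φ
  refine hR.ext_spectralProj fun lam => ?_
  rw [hR.spectralProj_waveKernel]
  simp

theorem waveCos_zero : waveCos A 0 = ContinuousLinearMap.id ℂ H := by
  ext φ
  refine hR.ext_spectralProj fun lam => ?_
  rw [hR.spectralProj_waveCos]
  simp

theorem waveKernel_neg (t : ℝ) : waveKernel A (-t) = - waveKernel A t := by
  ext φ
  refine hR.ext_spectralProj fun lam => ?_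
  rw [neg_apply, map_neg, hR.spectralProj_waveKernel,
    hR.spectralProj_waveKernel, sinSqrtDivSqrt_neg]
  push_cast
  rw [neg_smul]

/-- On each eigenspace the slopes converge; they are bounded by 1 and so is the limit, hence the
uniform bound `1 + 1` for dominated convergence. The limit is only strong: the rate depends on `λ`.
-/
theorem hasDerivAt_waveKernel (φ : H) (t : ℝ) :
    HasDerivAt (fun t => waveKernel A t φ) (- waveCos A t φ) t := by
  rw [hasDerivAt_iff_tendsto_slope]
  have h0 : Filter.Tendsto (fun s => slope (fun t => waveKernel A t φ) t s - (- waveCos A t φ))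
      (nhdsWithin t {t}ᶜ) (nhds 0) := by
    refine hR.tendsto_of_spectralProj (C := 1 + 1) (φ := φ)
      (F := fun s lam => slope (fun t => - sinSqrtDivSqrt t lam) t s - (- Real.cos (√lam * t)))
      ?_ ?_ ?_
    · filter_upwards [self_mem_nhdsWithin] with s hs
      refine BoundedOnNonneg.sub (fun lam hl => ?_) (boundedOnNonneg_cos t).neg
      have hne : s - t ≠ 0 := sub_ne_zero.2 hs
      rw [slope_def_field, abs_div, div_le_one (abs_pos.2 hne), ← neg_sub', abs_neg]
      exact abs_sinSqrtDivSqrt_sub_le hl s t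
    · intro lam hl
      have h1 := hasDerivAt_iff_tendsto_slope.1 (hasDerivAt_sinSqrtDivSqrt hl t).neg
      simpa using h1.sub_const (- Real.cos (√lam * t))
    · intro s lam
      simp only [slope, vsub_eq_sub]
      rw [← Complex.coe_smul, map_sub, map_smul, map_sub, map_neg, hR.spectralProj_waveKernel,
        hR.spectralProj_waveKernel, hR.spectralProj_waveCos]
      simp only [smul_eq_mul]
      push_cast
      module
  simpa using h0.add_const (- waveCos A t φ)

theorem continuous_waveCos_apply (φ : H) : Continuous fun t => waveCos A t φ := by
  rw [continuous_iff_continuousAt]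
  intro t
  have h0 : Filter.Tendsto (fun s => waveCos A s φ - waveCos A t φ) (nhds t) (nhds 0) := by
    refine hR.tendsto_of_spectralProj (C := 1 + 1) (φ := φ)
      (F := fun s lam => Real.cos (√lam * s) - Real.cos (√lam * t)) ?_ ?_ ?_
    · exact Filter.Eventually.of_forall fun s => (boundedOnNonneg_cos s).sub (boundedOnNonneg_cos t)
    · intro lam hl
      have h1 : Continuous fun s => Real.cos (√lam * s) - Real.cos (√lam * t) := by fun_prop
      simpa using h1.tendsto t
    · intro s lam
      rw [map_sub, hR.spectralProj_waveCos, hR.spectralProj_waveCos, ← sub_smul]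
      push_cast
      rfl
  have h1 := h0.add_const (waveCos A t φ)
  simpa [ContinuousAt] using h1

theorem contDiff_waveKernel_apply (φ : H) : ContDiff ℝ 1 fun t => waveKernel A t φ := by
  rw [contDiff_one_iff_deriv]
  refine ⟨fun t => (hR.hasDerivAt_waveKernel φ t).differentiableAt, ?_⟩
  rw [funext fun t => (hR.hasDerivAt_waveKernel φ t).deriv]
  exact (hR.continuous_waveCos_apply φ).neg

omit hR [CompleteSpace H] in
theorem _root_.UnboundedOp.GraphDomain.mem_graph (φ : GraphDomain A) :
    (GraphDomain.incl A φ, GraphDomain.op A φ) ∈ A.graph :=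
  A.mem_graph φ

/-- On `D(A)` the remainder is at most `(s - t)²` times the graph norm, so here, unlike on `H`, the
difference quotients converge in operator norm. -/
theorem hasDerivAt_waveKernel_comp_incl (t : ℝ) :
    HasDerivAt (fun t => (waveKernel A t).comp (GraphDomain.incl A))
      (- (waveCos A t).comp (GraphDomain.incl A)) t := by
  refine hasDerivAt_of_norm_sub_le_sq (C := 1) fun s => ?_
  rw [one_mul]
  refine ContinuousLinearMap.opNorm_le_bound _ (sq_nonneg _) fun φ => ?_
  rw [GraphDomain.norm_def]
  refine hR.norm_le_graph_norm (f := fun lam => - sinSqrtDivSqrt s lam - - sinSqrtDivSqrt t lam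
    - (s - t) * - Real.cos (√lam * t)) (sq_nonneg _) ?_ φ.mem_graph ?_
  · intro lam hl
    rw [← abs_neg]
    convert abs_sinSqrtDivSqrt_taylor hl s t using 2
    ring
  · intro lam
    change spectralProj A lam (waveKernel A s (GraphDomain.incl A φ)
      - waveKernel A t (GraphDomain.incl A φ)
      - ((s - t : ℝ) : ℂ) • - waveCos A t (GraphDomain.incl A φ))
      = _ • spectralProj A lam (GraphDomain.incl A φ)
    simp only [map_sub, map_smul, map_neg, hR.spectralProj_waveKernel, hR.spectralProj_waveCos]
    push_cast
    module

theorem hasDerivAt_waveCos_comp_incl (t : ℝ) :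
    HasDerivAt (fun t => (waveCos A t).comp (GraphDomain.incl A))
      ((waveKernel A t).comp (GraphDomain.op A)) t := by
  refine hasDerivAt_of_norm_sub_le_sq (C := 1) fun s => ?_
  rw [one_mul]
  refine ContinuousLinearMap.opNorm_le_bound _ (sq_nonneg _) fun φ => ?_
  rw [GraphDomain.norm_def]
  refine hR.norm_le_graph_norm (f := fun lam => Real.cos (√lam * s) - Real.cos (√lam * t)
    - (s - t) * -(lam * sinSqrtDivSqrt t lam)) (sq_nonneg _) ?_ φ.mem_graph ?_
  · intro lam hl
    exact abs_cos_sqrt_taylor hl s t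
  · intro lam
    change spectralProj A lam (waveCos A s (GraphDomain.incl A φ)
      - waveCos A t (GraphDomain.incl A φ)
      - ((s - t : ℝ) : ℂ) • waveKernel A t (GraphDomain.op A φ))
      = _ • spectralProj A lam (GraphDomain.incl A φ)
    simp only [map_sub, map_smul, hR.spectralProj_waveKernel, hR.spectralProj_waveCos,
      hR.spectralProj_of_mem_graph φ.mem_graph]
    push_cast
    module

theorem contDiff_waveKernel_comp_incl :
    ContDiff ℝ 2 fun t => (waveKernel A t).comp (GraphDomain.incl A) := by
  rw [show (2 : WithTop ℕ∞) = 1 + 1 from by norm_num, contDiff_succ_iff_deriv]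
  refine ⟨fun t => (hR.hasDerivAt_waveKernel_comp_incl t).differentiableAt, by simp, ?_⟩
  rw [funext fun t => (hR.hasDerivAt_waveKernel_comp_incl t).deriv]
  refine ContDiff.neg ?_
  rw [contDiff_one_iff_deriv]
  refine ⟨fun t => (hR.hasDerivAt_waveCos_comp_incl t).differentiableAt, ?_⟩
  rw [funext fun t => (hR.hasDerivAt_waveCos_comp_incl t).deriv]
  exact hR.continuous_waveKernel.clm_comp continuous_const

end IsNonnegResolvent

end UnboundedOp

/-! ### The propagator as a convolution in the graph domain -/

namespace UnboundedOp

variable {H : Type*} [NormedAddCommGroup H] [InnerProductSpace ℂ H]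

namespace GraphDomain

variable {A : H →ₗ.[ℂ] H}

/-- The element of `D(A)` given by a point of the graph. -/
def ofMemGraph {φ ψ : H} (h : (φ, ψ) ∈ A.graph) : GraphDomain A :=
  (⟨φ, A.mem_domain_of_mem_graph h⟩ : A.domain)

@[simp] theorem incl_ofMemGraph {φ ψ : H} (h : (φ, ψ) ∈ A.graph) : incl A (ofMemGraph h) = φ := rfl

@[simp] theorem op_ofMemGraph {φ ψ : H} (h : (φ, ψ) ∈ A.graph) : op A (ofMemGraph h) = ψ :=
  A.mem_graph_snd_inj (ofMemGraph h).mem_graph h rfl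

theorem norm_eq (φ : GraphDomain A) : ‖φ‖ = ‖incl A φ‖ + ‖op A φ‖ := norm_def A φ

theorem incl_injective : Function.Injective (incl A) := fun _ _ h => Subtype.ext h

/-- The restriction to `D(A)` of an operator which commutes with `A`. -/
def map (B : H →L[ℂ] H) (hB : ∀ φ ψ, (φ, ψ) ∈ A.graph → (B φ, B ψ) ∈ A.graph) :
    GraphDomain A →L[ℂ] GraphDomain A :=
  LinearMap.mkContinuous
    { toFun := fun φ => ofMemGraph (hB _ _ φ.mem_graph)
      map_add' := fun φ ψ => incl_injective (by simp)
      map_smul' := fun c φ => incl_injective (by simp) } ‖B‖ fun φ => by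
    change ‖ofMemGraph (hB _ _ φ.mem_graph)‖ ≤ _
    rw [norm_eq, norm_eq, incl_ofMemGraph, op_ofMemGraph, mul_add]
    exact add_le_add (B.le_opNorm _) (B.le_opNorm _)

theorem incl_map (B : H →L[ℂ] H) (hB : ∀ φ ψ, (φ, ψ) ∈ A.graph → (B φ, B ψ) ∈ A.graph)
    (φ : GraphDomain A) : incl A (map B hB φ) = B (incl A φ) := rfl

theorem op_map (B : H →L[ℂ] H) (hB : ∀ φ ψ, (φ, ψ) ∈ A.graph → (B φ, B ψ) ∈ A.graph)
    (φ : GraphDomain A) : op A (map B hB φ) = B (op A φ) := op_ofMemGraph (hB _ _ φ.mem_graph)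

/-- The graph norm is a sum of two norms of `H`, and an operator commuting with `A` acts on both
summands alike. Norm continuity of the kernel thus passes to `D(A)`. -/
theorem norm_map_sub_le (B C : H →L[ℂ] H)
    (hB : ∀ φ ψ, (φ, ψ) ∈ A.graph → (B φ, B ψ) ∈ A.graph)
    (hC : ∀ φ ψ, (φ, ψ) ∈ A.graph → (C φ, C ψ) ∈ A.graph) :
    ‖map B hB - map C hC‖ ≤ ‖B - C‖ := by
  refine ContinuousLinearMap.opNorm_le_bound _ (norm_nonneg _) fun φ => ?_
  rw [norm_eq, norm_eq, mul_add, sub_apply, map_sub, map_sub, incl_map, incl_map, op_map, op_map,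
    ← sub_apply, ← sub_apply]
  exact add_le_add ((B - C).le_opNorm _) ((B - C).le_opNorm _)

end GraphDomain

namespace IsNonnegResolvent

variable {A : H →ₗ.[ℂ] H} {R : H →L[ℂ] H} [CompleteSpace H] (hR : IsNonnegResolvent A R)
include hR

/-- The graph is closed, being cut out by the continuous equation `R (φ + ψ) = φ`. Completeness is
what lets Bochner integrals in `D(A)` commute with the inclusion and with `A`. -/
theorem completeSpace_graphDomain : CompleteSpace (GraphDomain A) := by
  have hi : IsUniformInducing (GraphDomain.toGraph A) := ⟨rfl⟩
  rw [completeSpace_iff_isComplete_range hi]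
  refine IsClosed.isComplete ?_
  have : range (GraphDomain.toGraph A) = {p : WithLp 1 (H × H) | R (p.fst + p.snd) = p.fst} := by
    ext p
    constructor
    · rintro ⟨φ, rfl⟩
      exact (hR.mem_graph_iff _ _).1 φ.mem_graph
    · intro hp
      have h := (hR.mem_graph_iff _ _).2 hp
      refine ⟨GraphDomain.ofMemGraph h, WithLp.ofLp_injective 1 (Prod.ext rfl ?_)⟩
      exact GraphDomain.op_ofMemGraph h
  rw [this]
  have h1 : Continuous fun p : WithLp 1 (H × H) => p.fst :=
    continuous_fst.comp (WithLp.prod_continuous_ofLp 1 H H)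
  have h2 : Continuous fun p : WithLp 1 (H × H) => p.snd :=
    continuous_snd.comp (WithLp.prod_continuous_ofLp 1 H H)
  exact isClosed_eq (R.continuous.comp (h1.add h2)) h1

/-- The operator `-sin(√A t)/√A` on `D(A)`. -/
def domainKernel (t : ℝ) : GraphDomain A →L[ℂ] GraphDomain A :=
  GraphDomain.map (waveKernel A t) fun _ _ h => hR.waveKernel_mem_graph t h

theorem continuous_domainKernel : Continuous hR.domainKernel := by
  refine LipschitzWith.continuous (K := 1) (LipschitzWith.of_dist_le_mul fun s t => ?_)
  rw [dist_eq_norm, NNReal.coe_one, one_mul, Real.dist_eq]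
  exact (GraphDomain.norm_map_sub_le _ _ _ _).trans (hR.norm_waveKernel_sub_le s t)

/-- The evaluation pairing, as a real bilinear map. -/
def evalPairing (E : Type*) [NormedAddCommGroup E] [NormedSpace ℂ E] :
    (E →L[ℂ] E) →L[ℝ] E →L[ℝ] E :=
  ContinuousLinearMap.restrictScalarsL ℂ E E ℝ ℝ

/-- The convolution of `f` with the kernel `-sin(√A t)/√A`. -/
def propagate (f : ℝ → GraphDomain A) : ℝ → GraphDomain A :=
  convolution hR.domainKernel f (evalPairing (GraphDomain A)) volume

theorem propagate_apply (f : ℝ → GraphDomain A) (t : ℝ) :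
    hR.propagate f t = ∫ s, hR.domainKernel s (f (t - s)) := rfl

theorem contDiff_propagate {f : ℝ → GraphDomain A} (hf : f ∈ C2c A) :
    ContDiff ℝ 2 (hR.propagate f) :=
  HasCompactSupport.contDiff_convolution_right (n := 2) _ hf.2
    hR.continuous_domainKernel.locallyIntegrable hf.1

theorem hasDerivAt_propagate {f : ℝ → GraphDomain A} (hc : HasCompactSupport f)
    (hf : ContDiff ℝ 1 f) (t : ℝ) : HasDerivAt (hR.propagate f) (hR.propagate (deriv f) t) t :=
  hc.hasDerivAt_convolution_right _ hR.continuous_domainKernel.locallyIntegrable hf t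

theorem integrable_propagate {f : ℝ → GraphDomain A} (hc : HasCompactSupport f)
    (hf : Continuous f) (t : ℝ) : Integrable fun s => hR.domainKernel s (f (t - s)) :=
  hc.convolutionExists_right (evalPairing (GraphDomain A))
    hR.continuous_domainKernel.locallyIntegrable hf t

theorem iteratedDeriv_propagate {f : ℝ → GraphDomain A} (hf : f ∈ C2c A) (t : ℝ) :
    iteratedDeriv 2 (hR.propagate f) t = hR.propagate (iteratedDeriv 2 f) t := by
  have h1 : ContDiff ℝ 1 (deriv f) := by
    have := hf.1
    rw [show (2 : WithTop ℕ∞) = 1 + 1 from by norm_num, contDiff_succ_iff_deriv] at this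
    exact this.2.2
  rw [iteratedDeriv_succ, iteratedDeriv_one, iteratedDeriv_succ, iteratedDeriv_one,
    funext fun t => (hR.hasDerivAt_propagate hf.2 (hf.1.of_le one_le_two) t).deriv]
  exact (hR.hasDerivAt_propagate hf.2.deriv h1 t).deriv

/-- The integral operator with kernel `-sin(√A t)/√A`. -/
def propagator : C2c A →ₗ[ℂ] C2 A where
  toFun f := ⟨hR.propagate f, hR.contDiff_propagate f.2⟩
  map_add' f g := by
    refine Subtype.ext (funext fun t => ?_)
    change hR.propagate (f + g) t = hR.propagate f t + hR.propagate g t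
    rw [propagate_apply, propagate_apply, propagate_apply, ← integral_add
      (hR.integrable_propagate f.2.2 f.2.1.continuous t)
      (hR.integrable_propagate g.2.2 g.2.1.continuous t)]
    simp
  map_smul' c f := by
    refine Subtype.ext (funext fun t => ?_)
    change hR.propagate (c • (f : ℝ → GraphDomain A)) t = c • hR.propagate f t
    rw [propagate_apply, propagate_apply, ← integral_smul]
    simp

theorem incl_propagate {f : ℝ → GraphDomain A} (hc : HasCompactSupport f) (hf : Continuous f)
    (t : ℝ) : GraphDomain.incl A (hR.propagate f t)
      = ∫ s, waveKernel A s (GraphDomain.incl A (f (t - s))) := by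
  have := hR.completeSpace_graphDomain
  rw [propagate_apply]
  exact ((GraphDomain.incl A).integral_comp_comm (hR.integrable_propagate hc hf t)).symm

theorem op_propagate {f : ℝ → GraphDomain A} (hc : HasCompactSupport f) (hf : Continuous f)
    (t : ℝ) : GraphDomain.op A (hR.propagate f t)
      = ∫ s, waveKernel A s (GraphDomain.op A (f (t - s))) := by
  have := hR.completeSpace_graphDomain
  rw [propagate_apply, ← (GraphDomain.op A).integral_comp_comm (hR.integrable_propagate hc hf t)]
  simp only [domainKernel, GraphDomain.op_map]

omit hR [CompleteSpace H] in
theorem integralOp_eq (K : ℝ → H →L[ℂ] H) (h : ℝ → H) (t : ℝ) :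
    integralOp K h t = ∫ s, K s (h (t - s)) := by
  rw [integralOp, ← integral_sub_left_eq_self _ volume t]
  simp

theorem incl_propagate_eq_integralOp {f : ℝ → GraphDomain A} (hf : f ∈ C2c A) (t : ℝ) :
    GraphDomain.incl A (hR.propagate f t)
      = integralOp (waveKernel A) (fun s => GraphDomain.incl A (f s)) t := by
  rw [hR.incl_propagate hf.2 hf.1.continuous, integralOp_eq]

theorem isIntegralOperator_propagator : IsIntegralOperator A hR.propagator (waveKernel A) where
  continuous_kernel := hR.continuous_waveKernel
  strong_C1 := hR.contDiff_waveKernel_apply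
  C2_on_domain := hR.contDiff_waveKernel_comp_incl
  eq_integral f t := hR.incl_propagate_eq_integralOp f.2 t

/-- The pairing of `D(A) → H` with `D(A)`, as a real bilinear map. -/
def _root_.UnboundedOp.domainPairing (A : H →ₗ.[ℂ] H) :
    (GraphDomain A →L[ℂ] H) →L[ℝ] GraphDomain A →L[ℝ] H :=
  ContinuousLinearMap.restrictScalarsL ℂ (GraphDomain A) H ℝ ℝ

/-- With `K = -sin(√A ·)/√A` and `C = cos(√A ·)`, the integrand is the total derivative in `s` of
`K(t - s) f'(s) - C(t - s) f(s)`, which has compact support. -/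
theorem integralOp_kleinGordon {f : ℝ → GraphDomain A} (hf : f ∈ C2c A) (t : ℝ) :
    integralOp (waveKernel A) (kleinGordon A f) t = 0 := by
  have h1 : ContDiff ℝ 1 (deriv f) := by
    have := hf.1
    rw [show (2 : WithTop ℕ∞) = 1 + 1 from by norm_num, contDiff_succ_iff_deriv] at this
    exact this.2.2
  have hd1 : ∀ s, HasDerivAt f (deriv f s) s := fun s =>
    (hf.1.differentiable two_ne_zero s).hasDerivAt
  have hd2 : ∀ s, HasDerivAt (deriv f) (iteratedDeriv 2 f s) s := fun s => by
    rw [iteratedDeriv_succ, iteratedDeriv_one]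
    exact (h1.differentiable one_ne_zero s).hasDerivAt
  have hsub : ∀ s, HasDerivAt (fun s => t - s) (-1 : ℝ) s := fun s => by
    simpa using (hasDerivAt_id' s).const_sub t
  have hk : ∀ s, HasDerivAt (fun s => domainPairing A ((waveKernel A (t - s)).comp (GraphDomain.incl A)))
      (domainPairing A ((waveCos A (t - s)).comp (GraphDomain.incl A))) s := fun s => by
    have := (hR.hasDerivAt_waveKernel_comp_incl (t - s)).scomp s (hsub s)
    simp only [neg_smul, one_smul, neg_neg] at this
    exact (domainPairing A).hasFDerivAt.comp_hasDerivAt s this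
  have hc : ∀ s, HasDerivAt (fun s => domainPairing A ((waveCos A (t - s)).comp (GraphDomain.incl A)))
      (- domainPairing A ((waveKernel A (t - s)).comp (GraphDomain.op A))) s := fun s => by
    have := (hR.hasDerivAt_waveCos_comp_incl (t - s)).scomp s (hsub s)
    simp only [neg_smul, one_smul] at this
    rw [← map_neg]
    exact (domainPairing A).hasFDerivAt.comp_hasDerivAt s this
  have hF : ∀ s, HasDerivAt (fun s =>
      domainPairing A ((waveKernel A (t - s)).comp (GraphDomain.incl A)) (deriv f s)
        - domainPairing A ((waveCos A (t - s)).comp (GraphDomain.incl A)) (f s))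
      (waveKernel A (t - s) (kleinGordon A f s)) s := fun s => by
    refine (((hk s).clm_apply (hd2 s)).sub ((hc s).clm_apply (hd1 s))).congr_deriv ?_
    change waveCos A (t - s) (GraphDomain.incl A (deriv f s))
      + waveKernel A (t - s) (GraphDomain.incl A (iteratedDeriv 2 f s))
      - (- waveKernel A (t - s) (GraphDomain.op A (f s))
        + waveCos A (t - s) (GraphDomain.incl A (deriv f s))) = _
    rw [kleinGordon, map_add]
    abel
  have hcs : HasCompactSupport fun s =>
      domainPairing A ((waveKernel A (t - s)).comp (GraphDomain.incl A)) (deriv f s)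
        - domainPairing A ((waveCos A (t - s)).comp (GraphDomain.incl A)) (f s) := by
    refine HasCompactSupport.sub ?_ ?_
    · exact hf.2.deriv.mono' fun s hs => subset_closure fun h => hs (by simp [h])
    · exact hf.2.mono' fun s hs => subset_closure fun h => hs (by simp [h])
  have hkg : Continuous (kleinGordon A f) := by
    refine ((GraphDomain.incl A).continuous.comp ?_).add
      ((GraphDomain.op A).continuous.comp hf.1.continuous)
    exact hf.1.continuous_iteratedDeriv 2 le_rfl
  have hcont : Continuous fun s => waveKernel A (t - s) (kleinGordon A f s) :=
    (hR.continuous_waveKernel.comp (continuous_const.sub continuous_id)).clm_apply hkg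
  have hcd := hcs.deriv
  rw [funext fun s => (hF s).deriv] at hcd
  exact integral_eq_zero_of_hasDerivAt_of_integrable hF
    (hcont.integrable_of_hasCompactSupport hcd)
    ((continuous_iff_continuousAt.2 fun s => (hF s).continuousAt).integrable_of_hasCompactSupport
      hcs)

/-- Time derivatives of the convolution fall on `f` and `A` commutes with the kernel, so `Q_A` of
the convolution is the convolution with `Q_A f`, which has just been shown to vanish. -/
theorem kleinGordon_propagate {f : ℝ → GraphDomain A} (hf : f ∈ C2c A) (t : ℝ) :
    kleinGordon A (hR.propagate f) t = 0 := by
  have hc2 : HasCompactSupport (iteratedDeriv 2 f) := by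
    rw [iteratedDeriv_succ, iteratedDeriv_one]
    exact hf.2.deriv.deriv
  have hcont2 : Continuous (iteratedDeriv 2 f) := hf.1.continuous_iteratedDeriv 2 le_rfl
  have hi1 := (GraphDomain.incl A).integrable_comp (hR.integrable_propagate hc2 hcont2 t)
  have hi2 := (GraphDomain.op A).integrable_comp
    (hR.integrable_propagate hf.2 hf.1.continuous t)
  simp only [domainKernel, GraphDomain.incl_map, GraphDomain.op_map] at hi1 hi2
  rw [kleinGordon, hR.iteratedDeriv_propagate hf, hR.incl_propagate hc2 hcont2,
    hR.op_propagate hf.2 hf.1.continuous, ← integral_add hi1 hi2,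
    ← hR.integralOp_kleinGordon hf t, integralOp_eq]
  simp [kleinGordon]

theorem waveKernel_resolvent (t : ℝ) (φ : H) :
    waveKernel A t (R φ) = R (waveKernel A t φ) :=
  hR.diag_resolvent (abs_nonneg t) (boundedOnNonneg_sin t) φ

theorem waveCos_resolvent (t : ℝ) (φ : H) : waveCos A t (R φ) = R (waveCos A t φ) :=
  hR.diag_resolvent zero_le_one (boundedOnNonneg_cos t) φ

theorem hasDerivAt_waveCos (φ : GraphDomain A) (t : ℝ) :
    HasDerivAt (fun t => waveCos A t (GraphDomain.incl A φ))
      (waveKernel A t (GraphDomain.op A φ)) t := by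
  have h : HasDerivAt (fun t => domainPairing A ((waveCos A t).comp (GraphDomain.incl A)))
      (domainPairing A ((waveKernel A t).comp (GraphDomain.op A))) t :=
    (domainPairing A).hasFDerivAt.comp_hasDerivAt t (hR.hasDerivAt_waveCos_comp_incl t)
  refine (h.clm_apply (hasDerivAt_const t φ)).congr_deriv ?_
  rw [map_zero, add_zero]
  rfl

end IsNonnegResolvent

end UnboundedOp

/-! ## Absolutely continuous complex functions -/

section AbsolutelyContinuous

variable {a b : ℝ}

theorem AbsolutelyContinuousOnInterval.complex_ofReal {f : ℝ → ℝ}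
    (hf : AbsolutelyContinuousOnInterval f a b) :
    AbsolutelyContinuousOnInterval (fun x => (f x : ℂ)) a b := by
  rw [absolutelyContinuousOnInterval_iff] at hf ⊢
  simpa only [Complex.isometry_ofReal.dist_eq] using hf

theorem IntervalIntegrable.re {f : ℝ → ℂ} (hf : IntervalIntegrable f volume a b) :
    IntervalIntegrable (fun x => (f x).re) volume a b := ⟨hf.1.re, hf.2.re⟩

theorem IntervalIntegrable.im {f : ℝ → ℂ} (hf : IntervalIntegrable f volume a b) :
    IntervalIntegrable (fun x => (f x).im) volume a b := ⟨hf.1.im, hf.2.im⟩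

theorem IntervalIntegrable.complex_ofReal {f : ℝ → ℝ} (hf : IntervalIntegrable f volume a b) :
    IntervalIntegrable (fun x => (f x : ℂ)) volume a b := ⟨hf.1.ofReal, hf.2.ofReal⟩

theorem intervalIntegral_complex_eq {f : ℝ → ℂ} (hf : IntervalIntegrable f volume a b) :
    ∫ x in a..b, f x
      = ((∫ x in a..b, (f x).re : ℝ) : ℂ) + Complex.I * ((∫ x in a..b, (f x).im : ℝ) : ℂ) := by
  rw [← intervalIntegral.integral_ofReal, ← intervalIntegral.integral_ofReal,
    ← intervalIntegral.integral_const_mul, ← intervalIntegral.integral_add hf.re.complex_ofReal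
      (hf.im.complex_ofReal.const_mul _)]
  refine intervalIntegral.integral_congr fun x _ => ?_
  rw [mul_comm]
  exact (Complex.re_add_im (f x)).symm

theorem IntervalIntegrable.absolutelyContinuousOnInterval_complex {f : ℝ → ℂ} {c : ℝ}
    (hf : IntervalIntegrable f volume a b) (hc : c ∈ uIcc a b) :
    AbsolutelyContinuousOnInterval (fun x => ∫ s in c..x, f s) a b := by
  have h := (hf.re.absolutelyContinuousOnInterval_intervalIntegral hc).complex_ofReal.add
    ((hf.im.absolutelyContinuousOnInterval_intervalIntegral hc).complex_ofReal.const_smul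
      Complex.I)
  rw [absolutelyContinuousOnInterval_iff] at h ⊢
  refine fun ε hε => (h ε hε).imp fun δ hδ => ⟨hδ.1, fun E hE hlt => ?_⟩
  refine lt_of_eq_of_lt (Finset.sum_congr rfl fun i hi => ?_) (hδ.2 E hE hlt)
  have hmem := hE.1 i hi
  have hint : ∀ x ∈ uIcc a b, ∫ s in c..x, f s = ((∫ s in c..x, (f s).re : ℝ) : ℂ)
      + Complex.I • ((∫ s in c..x, (f s).im : ℝ) : ℂ) := fun x hx =>
    intervalIntegral_complex_eq (hf.mono_set (uIcc_subset_uIcc hc hx))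
  rw [hint _ hmem.1, hint _ hmem.2]
  rfl

/-- The fundamental theorem of calculus for absolutely continuous functions. -/
theorem AbsolutelyContinuousOnInterval.integral_eq_sub_of_ae_hasDerivAt {f f' : ℝ → ℂ}
    (hf : AbsolutelyContinuousOnInterval f a b) (hf' : IntervalIntegrable f' volume a b)
    (hd : ∀ᵐ x, x ∈ uIcc a b → HasDerivAt f (f' x) x) :
    ∫ x in a..b, f' x = f b - f a := by
  -- The difference of `f` and the primitive of `f'` is absolutely continuous with derivative zero
  -- almost everywhere, hence constant.
  have h1 := hf.sub (hf'.absolutelyContinuousOnInterval_complex (c := a) left_mem_uIcc)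
  have h2 : ∀ᵐ x, x ∈ uIcc a b → HasDerivAt (f - fun x => ∫ s in a..x, f' s) 0 x := by
    filter_upwards [hd, hf'.ae_hasDerivAt_integral] with x hx1 hx2 hx
    simpa using (hx1 hx).sub (hx2 hx a left_mem_uIcc)
  obtain ⟨C, hC⟩ := h1.const_of_ae_hasDerivAt_zero h2
  have e1 := hC a left_mem_uIcc
  have e2 := hC b right_mem_uIcc
  simp only [Pi.sub_apply, intervalIntegral.integral_same] at e1 e2
  linear_combination e1 - e2

/-- Integration by parts for absolutely continuous functions. -/
theorem AbsolutelyContinuousOnInterval.integral_mul_add_mul_eq_sub {f f' g g' : ℝ → ℂ}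
    (hf : AbsolutelyContinuousOnInterval f a b) (hg : AbsolutelyContinuousOnInterval g a b)
    (hf' : IntervalIntegrable f' volume a b) (hg' : IntervalIntegrable g' volume a b)
    (hdf : ∀ᵐ x, x ∈ uIcc a b → HasDerivAt f (f' x) x)
    (hdg : ∀ᵐ x, x ∈ uIcc a b → HasDerivAt g (g' x) x) :
    ∫ x in a..b, (f' x * g x + f x * g' x) = f b * g b - f a * g a := by
  refine (hf.smul hg).integral_eq_sub_of_ae_hasDerivAt
    ((hf'.mul_continuousOn hg.continuousOn).add (hg'.continuousOn_mul hf.continuousOn)) ?_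
  filter_upwards [hdf, hdg] with x h1 h2 hx using (h1 hx).mul (h2 hx)

theorem AbsolutelyContinuousOnInterval.of_forall_hasDerivAt {f f' : ℝ → ℝ}
    (hf : ∀ x, HasDerivAt f (f' x) x) (hf' : Continuous f') :
    AbsolutelyContinuousOnInterval f a b := by
  have h1 : ContDiff ℝ 1 f := by
    rw [contDiff_one_iff_deriv, funext fun x => (hf x).deriv]
    exact ⟨fun x => (hf x).differentiableAt, hf'⟩
  exact h1.contDiffOn.absolutelyContinuousOnInterval

end AbsolutelyContinuous

/-! ### Integration on the interval `(0, ℓ)` -/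

namespace BulkBoundarySystem

variable (P : BulkBoundarySystem)

instance : IsFiniteMeasure P.μ := by
  unfold BulkBoundarySystem.μ
  infer_instance

/-- `L²((0, ℓ))`. -/
abbrev L2 : Type := Lp ℂ 2 P.μ

theorem zero_mem : (0 : ℝ) ∈ Icc 0 P.ℓ := left_mem_Icc.2 P.ℓ_pos.le

theorem ℓ_mem : P.ℓ ∈ Icc 0 P.ℓ := right_mem_Icc.2 P.ℓ_pos.le

theorem ae_mem : ∀ᵐ z ∂P.μ, z ∈ Ioo 0 P.ℓ := ae_restrict_mem measurableSet_Ioo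

theorem μ_eq : P.μ = volume.restrict (Ioc 0 P.ℓ) := Measure.restrict_congr_set Ioo_ae_eq_Ioc

theorem integral_μ (f : ℝ → ℂ) : ∫ z, f z ∂P.μ = ∫ z in 0..P.ℓ, f z := by
  rw [μ_eq, intervalIntegral.integral_of_le P.ℓ_pos.le]

theorem intervalIntegrable_of_integrable {f : ℝ → ℂ} (hf : Integrable f P.μ) {x y : ℝ}
    (hx : x ∈ Icc 0 P.ℓ) (hy : y ∈ Icc 0 P.ℓ) : IntervalIntegrable f volume x y := by
  have h : IntervalIntegrable f volume 0 P.ℓ := by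
    rw [intervalIntegrable_iff_integrableOn_Ioc_of_le P.ℓ_pos.le, IntegrableOn, ← μ_eq]
    exact hf
  refine h.mono_set ?_
  rw [uIcc_of_le P.ℓ_pos.le]
  exact uIcc_subset_Icc hx hy

theorem ae_volume_iff {p : ℝ → Prop} :
    (∀ᵐ z, z ∈ uIcc 0 P.ℓ → p z) ↔ ∀ᵐ z ∂P.μ, p z := by
  rw [uIcc_of_le P.ℓ_pos.le, ← ae_restrict_iff' measurableSet_Icc, BulkBoundarySystem.μ,
    Measure.restrict_congr_set Ioo_ae_eq_Icc]

theorem ae_volume_of_ae {p : ℝ → Prop} (h : ∀ᵐ z ∂P.μ, p z) {x y : ℝ}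
    (hx : x ∈ Icc 0 P.ℓ) (hy : y ∈ Icc 0 P.ℓ) : ∀ᵐ z, z ∈ uIcc x y → p z := by
  filter_upwards [P.ae_volume_iff.2 h] with z hz hm
  refine hz ?_
  rw [uIcc_of_le P.ℓ_pos.le]
  exact uIcc_subset_Icc hx hy hm

theorem integrable_coeFn (g : P.L2) : Integrable g P.μ := (Lp.memLp g).integrable one_le_two

theorem intervalIntegrable_coeFn (g : P.L2) {x y : ℝ} (hx : x ∈ Icc 0 P.ℓ) (hy : y ∈ Icc 0 P.ℓ) :
    IntervalIntegrable g volume x y :=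
  P.intervalIntegrable_of_integrable (P.integrable_coeFn g) hx hy

theorem intervalIntegral_congr_ae {f g : ℝ → ℂ} (h : f =ᵐ[P.μ] g) {x y : ℝ}
    (hx : x ∈ Icc 0 P.ℓ) (hy : y ∈ Icc 0 P.ℓ) : ∫ z in x..y, f z = ∫ z in x..y, g z := by
  refine intervalIntegral.integral_congr_ae ?_
  filter_upwards [P.ae_volume_of_ae h hx hy] with z hz hm using hz (uIoc_subset_uIcc hm)

theorem inner_eq (f g : P.L2) : inner ℂ f g = ∫ z, (starRingEnd ℂ) (f z) * g z ∂P.μ := by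
  rw [L2.inner_def]
  refine integral_congr_ae (Filter.Eventually.of_forall fun z => ?_)
  simp [RCLike.inner_apply, mul_comm]

/-! ### Multiplication operators -/

theorem memLp_mul (n : C(ℝ, ℝ)) {g : ℝ → ℂ} (hg : MemLp g 2 P.μ) :
    MemLp (fun z => (n z : ℂ) * g z) 2 P.μ := by
  obtain ⟨C, hC⟩ := isCompact_Icc.exists_bound_of_continuousOn (s := Icc 0 P.ℓ) n.continuous.continuousOn
  refine MemLp.of_le_mul (c := C) hg
    ((Complex.continuous_ofReal.comp n.continuous).aestronglyMeasurable.mul hg.1) ?_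
  filter_upwards [P.ae_mem] with z hz
  rw [norm_mul, Complex.norm_real]
  exact mul_le_mul_of_nonneg_right (hC z (Ioo_subset_Icc_self hz)) (norm_nonneg _)

/-- Multiplication by a continuous function on `L²((0, ℓ))`. -/
def mulOp (n : C(ℝ, ℝ)) : P.L2 →L[ℂ] P.L2 :=
  LinearMap.mkContinuousOfExistsBound
    { toFun := fun g => (P.memLp_mul n (Lp.memLp g)).toLp
      map_add' := fun f g => by
        rw [← MemLp.toLp_add]
        refine MemLp.toLp_congr _ _ ?_
        filter_upwards [Lp.coeFn_add f g] with z hz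
        rw [hz, Pi.add_apply, Pi.add_apply, mul_add]
      map_smul' := fun c g => by
        rw [RingHom.id_apply, ← MemLp.toLp_const_smul]
        refine MemLp.toLp_congr _ _ ?_
        filter_upwards [Lp.coeFn_smul c g] with z hz
        rw [hz, Pi.smul_apply, Pi.smul_apply, smul_eq_mul, smul_eq_mul]
        ring } (by
    obtain ⟨C, hC⟩ := isCompact_Icc.exists_bound_of_continuousOn (s := Icc 0 P.ℓ)
      n.continuous.continuousOn
    refine ⟨C, fun g => Lp.norm_le_mul_norm_of_ae_le_mul ?_⟩
    filter_upwards [P.ae_mem, (P.memLp_mul n (Lp.memLp g)).coeFn_toLp] with z hz h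
    refine (congrArg norm h).trans_le ?_
    rw [norm_mul, Complex.norm_real]
    exact mul_le_mul_of_nonneg_right (hC z (Ioo_subset_Icc_self hz)) (norm_nonneg _))

theorem coeFn_mulOp (n : C(ℝ, ℝ)) (g : P.L2) :
    P.mulOp n g =ᵐ[P.μ] fun z => (n z : ℂ) * g z :=
  (P.memLp_mul n (Lp.memLp g)).coeFn_toLp

theorem inner_mulOp (n : C(ℝ, ℝ)) (f g : P.L2) :
    inner ℂ f (P.mulOp n g) = ∫ z, (starRingEnd ℂ) (f z) * ((n z : ℂ) * g z) ∂P.μ := by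
  rw [inner_eq]
  refine integral_congr_ae ?_
  filter_upwards [P.coeFn_mulOp n g] with z hz
  rw [hz]

theorem mulOp_symm (n : C(ℝ, ℝ)) (f g : P.L2) :
    inner ℂ (P.mulOp n f) g = inner ℂ f (P.mulOp n g) := by
  rw [inner_mulOp, inner_eq]
  refine integral_congr_ae ?_
  filter_upwards [P.coeFn_mulOp n f] with z hz
  rw [hz, map_mul, Complex.conj_ofReal]
  ring

theorem mulOp_add (n k : C(ℝ, ℝ)) (g : P.L2) :
    P.mulOp (n + k) g = P.mulOp n g + P.mulOp k g := by
  refine Lp.ext ?_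
  filter_upwards [P.coeFn_mulOp (n + k) g, P.coeFn_mulOp n g, P.coeFn_mulOp k g,
    Lp.coeFn_add (P.mulOp n g) (P.mulOp k g)] with z h1 h2 h3 h4
  rw [h1, h4, Pi.add_apply, h2, h3, ContinuousMap.add_apply]
  push_cast
  ring

theorem mulOp_mul (n k : C(ℝ, ℝ)) (g : P.L2) :
    P.mulOp (n * k) g = P.mulOp n (P.mulOp k g) := by
  refine Lp.ext ?_
  filter_upwards [P.coeFn_mulOp (n * k) g, P.coeFn_mulOp n (P.mulOp k g), P.coeFn_mulOp k g]
    with z h1 h2 h3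
  rw [h1, h2, h3, ContinuousMap.mul_apply]
  push_cast
  ring

theorem mulOp_one (g : P.L2) : P.mulOp 1 g = g := by
  refine Lp.ext ?_
  filter_upwards [P.coeFn_mulOp 1 g] with z h1
  simp [h1]

theorem mulOp_smul (c : ℝ) (n : C(ℝ, ℝ)) (g : P.L2) :
    P.mulOp (c • n) g = (c : ℂ) • P.mulOp n g := by
  refine Lp.ext ?_
  filter_upwards [P.coeFn_mulOp (c • n) g, P.coeFn_mulOp n g, Lp.coeFn_smul (c : ℂ) (P.mulOp n g)]
    with z h1 h2 h3
  rw [h1, h3, Pi.smul_apply, h2, ContinuousMap.smul_apply, smul_eq_mul, smul_eq_mul]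
  push_cast
  ring

theorem integrable_mul_conj (n : C(ℝ, ℝ)) (g : P.L2) :
    Integrable (fun z => n z * ‖g z‖ ^ 2) P.μ := by
  have h := (L2.integrable_inner (𝕜 := ℂ) g (P.mulOp n g)).re
  refine h.congr ?_
  filter_upwards [P.coeFn_mulOp n g] with z hz
  rw [hz, RCLike.inner_apply, mul_assoc, Complex.mul_conj, Complex.normSq_eq_norm_sq]
  norm_cast

theorem re_inner_mulOp (n : C(ℝ, ℝ)) (g : P.L2) :
    (inner ℂ g (P.mulOp n g)).re = ∫ z, n z * ‖g z‖ ^ 2 ∂P.μ := by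
  have h : ∀ z, (starRingEnd ℂ) (g z) * ((n z : ℂ) * g z) = ((n z * ‖g z‖ ^ 2 : ℝ) : ℂ) := by
    intro z
    rw [mul_left_comm, mul_comm _ (g z), Complex.mul_conj, Complex.normSq_eq_norm_sq]
    norm_cast
  rw [inner_mulOp, integral_congr_ae (Filter.Eventually.of_forall h), integral_complex_ofReal,
    Complex.ofReal_re]

theorem re_inner_mulOp_mono {n k : C(ℝ, ℝ)} (h : ∀ z ∈ Icc 0 P.ℓ, n z ≤ k z) (g : P.L2) :
    (inner ℂ g (P.mulOp n g)).re ≤ (inner ℂ g (P.mulOp k g)).re := by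
  rw [re_inner_mulOp, re_inner_mulOp]
  refine integral_mono_ae (P.integrable_mul_conj n g) (P.integrable_mul_conj k g) ?_
  filter_upwards [P.ae_mem] with z hz
  exact mul_le_mul_of_nonneg_right (h z (Ioo_subset_Icc_self hz)) (sq_nonneg _)

theorem re_inner_mulOp_nonneg {n : C(ℝ, ℝ)} (h : ∀ z ∈ Icc 0 P.ℓ, 0 ≤ n z) (g : P.L2) :
    0 ≤ (inner ℂ g (P.mulOp n g)).re := by
  rw [re_inner_mulOp]
  refine integral_nonneg_of_ae ?_
  filter_upwards [P.ae_mem] with z hz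
  exact mul_nonneg (h z (Ioo_subset_Icc_self hz)) (sq_nonneg _)

/-- A weighted Cauchy-Schwarz inequality. -/
theorem two_mul_re_inner_mulOp_le {n k : C(ℝ, ℝ)} (h : ∀ z ∈ Icc 0 P.ℓ, |k z| ≤ n z)
    (f g : P.L2) : 2 * (inner ℂ f (P.mulOp k g)).re
      ≤ (inner ℂ f (P.mulOp n f)).re + (inner ℂ g (P.mulOp n g)).re := by
  -- Both `n + k` and `n - k` are non-negative; testing them on `f - g` and `f + g` and adding
  -- leaves only the desired cross term.
  have h1 := P.re_inner_mulOp_nonneg (n := n + k)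
    (fun z hz => by simpa using neg_le_iff_add_nonneg'.1 ((neg_abs_le (k z)).trans' (neg_le_neg (h z hz)))) (f - g)
  have h2 := P.re_inner_mulOp_nonneg (n := n + (-1 : ℝ) • k)
    (fun z hz => by simpa using (le_abs_self (k z)).trans (h z hz)) (f + g)
  have hs : (inner ℂ g (P.mulOp k f)).re = (inner ℂ f (P.mulOp k g)).re := by
    rw [← mulOp_symm, ← inner_conj_symm, Complex.conj_re]
  have hs' : (inner ℂ g (P.mulOp n f)).re = (inner ℂ f (P.mulOp n g)).re := by
    rw [← mulOp_symm, ← inner_conj_symm, Complex.conj_re]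
  simp only [mulOp_add, mulOp_smul, map_sub, map_add, inner_add_left, inner_add_right,
    inner_sub_left, inner_sub_right, inner_smul_right, Complex.add_re, Complex.sub_re,
    Complex.re_ofReal_mul] at h1 h2
  linarith

end BulkBoundarySystem

theorem IsCompactOperator.prodMk {E F G : Type*} [Zero E] [TopologicalSpace E]
    [TopologicalSpace F] [TopologicalSpace G] {f : E → F} {g : E → G} (hf : IsCompactOperator f)
    (hg : IsCompactOperator g) : IsCompactOperator fun x => (f x, g x) := by
  obtain ⟨K, hK, h1⟩ := hf
  obtain ⟨K', hK', h2⟩ := hg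
  refine ⟨K ×ˢ K', hK.prod hK', ?_⟩
  filter_upwards [h1, h2] with x hx hx' using ⟨hx, hx'⟩

namespace BulkBoundarySystem

variable (P : BulkBoundarySystem)

/-! ### Primitives of square integrable functions -/

/-- Cauchy-Schwarz against the indicator of the interval. The resulting Hölder exponent `1/2`
supplies both the bound and the equicontinuity needed for Arzelà-Ascoli. -/
theorem norm_intervalIntegral_le (g : P.L2) {x y : ℝ} (hx : x ∈ Icc 0 P.ℓ) (hy : y ∈ Icc 0 P.ℓ) :
    ‖∫ z in x..y, g z‖ ≤ |y - x| ^ (1 / 2 : ℝ) * ‖g‖ := by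
  have hs : uIoc x y ⊆ Ioc 0 P.ℓ := fun z hz => by
    rw [uIoc, mem_Ioc] at hz
    exact ⟨(le_min hx.1 hy.1).trans_lt hz.1, hz.2.trans (max_le hx.2 hy.2)⟩
  have hμ : P.μ.restrict (uIoc x y) = volume.restrict (uIoc x y) := by
    rw [μ_eq, Measure.restrict_restrict_of_subset hs]
  have hfin : P.μ (uIoc x y) ≠ ⊤ := measure_ne_top _ _
  have h1 : ∫ z in uIoc x y, g z = inner ℂ (indicatorConstLp 2 measurableSet_uIoc hfin (1 : ℂ)) g := by
    rw [L2.inner_indicatorConstLp_one, hμ]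
  have h2 : P.μ.real (uIoc x y) = |y - x| := by
    rw [measureReal_def, ← Measure.restrict_apply_univ, hμ, Measure.restrict_apply_univ,
      Real.volume_uIoc, ENNReal.toReal_ofReal (abs_nonneg _)]
  rw [intervalIntegral.norm_intervalIntegral_eq, h1]
  refine (norm_inner_le_norm _ _).trans ?_
  rw [norm_indicatorConstLp two_ne_zero ENNReal.ofNat_ne_top, h2, norm_one, one_mul]
  simp

theorem prim_sub (g : P.L2) {x y : ℝ} (hx : x ∈ Icc 0 P.ℓ) (hy : y ∈ Icc 0 P.ℓ) :
    (∫ z in 0..y, g z) - ∫ z in 0..x, g z = ∫ z in x..y, g z :=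
  intervalIntegral.integral_interval_sub_left (P.intervalIntegrable_coeFn g P.zero_mem hy)
    (P.intervalIntegrable_coeFn g P.zero_mem hx)

theorem ac_prim (g : P.L2) :
    AbsolutelyContinuousOnInterval (fun x => ∫ z in 0..x, g z) 0 P.ℓ :=
  (P.intervalIntegrable_coeFn g P.zero_mem P.ℓ_mem).absolutelyContinuousOnInterval_complex
    left_mem_uIcc

theorem continuousOn_prim (g : P.L2) : ContinuousOn (fun x => ∫ z in 0..x, g z) (Icc 0 P.ℓ) := by
  have := (P.ac_prim g).continuousOn
  rwa [uIcc_of_le P.ℓ_pos.le] at this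

theorem hasDerivAt_prim (g : P.L2) :
    ∀ᵐ z ∂P.μ, HasDerivAt (fun x => ∫ s in 0..x, g s) (g z) z := by
  rw [← ae_volume_iff]
  filter_upwards [(P.intervalIntegrable_coeFn g P.zero_mem P.ℓ_mem).ae_hasDerivAt_integral]
    with z hz hm using hz hm 0 left_mem_uIcc

/-- The primitive `z ↦ ∫₀^z g` as a continuous function on `[0, ℓ]`. -/
def prim : P.L2 →L[ℂ] BoundedContinuousFunction (Icc (0 : ℝ) P.ℓ) ℂ :=
  LinearMap.mkContinuous
    { toFun := fun g => BoundedContinuousFunction.mkOfCompact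
        ⟨fun x => ∫ z in 0..x, g z, (P.continuousOn_prim g).domRestrict⟩
      map_add' := fun f g => by
        ext x
        change ∫ z in 0..(x : ℝ), (f + g : P.L2) z = (∫ z in 0..(x : ℝ), f z) + ∫ z in 0..(x : ℝ), g z
        rw [P.intervalIntegral_congr_ae (Lp.coeFn_add f g) P.zero_mem x.2]
        exact intervalIntegral.integral_add (P.intervalIntegrable_coeFn f P.zero_mem x.2)
          (P.intervalIntegrable_coeFn g P.zero_mem x.2)
      map_smul' := fun c g => by
        ext x
        change ∫ z in 0..(x : ℝ), (c • g : P.L2) z = c • ∫ z in 0..(x : ℝ), g z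
        rw [P.intervalIntegral_congr_ae (Lp.coeFn_smul c g) P.zero_mem x.2]
        exact intervalIntegral.integral_smul c (fun z => g z) } (P.ℓ ^ (1 / 2 : ℝ)) fun g => by
    refine (BoundedContinuousFunction.norm_le
      (mul_nonneg (Real.rpow_nonneg P.ℓ_pos.le _) (norm_nonneg _))).2 fun x => ?_
    refine (P.norm_intervalIntegral_le g P.zero_mem x.2).trans ?_
    rw [sub_zero, abs_of_nonneg x.2.1]
    exact mul_le_mul_of_nonneg_right (Real.rpow_le_rpow x.2.1 x.2.2 (by norm_num)) (norm_nonneg _)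

theorem prim_apply (g : P.L2) (x : Icc (0 : ℝ) P.ℓ) : P.prim g x = ∫ z in 0..(x : ℝ), g z := rfl

theorem isCompactOperator_prim : IsCompactOperator P.prim := by
  refine (isCompactOperator_iff_isCompact_closure_image_closedBall
    (P.prim : P.L2 →ₗ[ℂ] BoundedContinuousFunction (Icc (0 : ℝ) P.ℓ) ℂ) zero_lt_one).2 ?_
  refine BoundedContinuousFunction.arzela_ascoli (Metric.closedBall 0 ‖P.prim‖)
    (isCompact_closedBall _ _) _ ?_ ?_
  · rintro _ x ⟨g, hg, rfl⟩
    rw [mem_closedBall_zero_iff] at hg ⊢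
    refine ((P.prim g).norm_coe_le_norm x).trans ((P.prim.le_opNorm g).trans ?_)
    exact mul_le_of_le_one_right (norm_nonneg _) hg
  · refine Metric.equicontinuous_of_continuity_modulus (fun d => d ^ (1 / 2 : ℝ)) ?_ _ ?_
    · have : Continuous fun d : ℝ => d ^ (1 / 2 : ℝ) :=
        Real.continuous_rpow_const (by norm_num)
      simpa using this.tendsto 0
    · rintro x y ⟨_, g, hg, rfl⟩
      rw [mem_closedBall_zero_iff] at hg
      change dist (P.prim g x) (P.prim g y) ≤ _
      rw [dist_comm, dist_eq_norm, prim_apply, prim_apply, P.prim_sub g x.2 y.2,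
        dist_comm, Subtype.dist_eq, Real.dist_eq]
      exact (P.norm_intervalIntegral_le g x.2 y.2).trans
        (mul_le_of_le_one_right (by positivity) hg)

/-- The class of a continuous function on `[0, ℓ]`. -/
def classOf : BoundedContinuousFunction (Icc (0 : ℝ) P.ℓ) ℂ →L[ℂ] P.L2 :=
  LinearMap.mkContinuousOfExistsBound
    { toFun := fun u => BoundedContinuousFunction.toLp 2 P.μ ℂ
        (u.compContinuous ⟨projIcc 0 P.ℓ P.ℓ_pos.le, continuous_projIcc⟩)
      map_add' := fun u v => by rw [← map_add]; rfl
      map_smul' := fun c u => by rw [← map_smul]; rfl }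
    ⟨‖(BoundedContinuousFunction.toLp 2 P.μ ℂ : BoundedContinuousFunction ℝ ℂ →L[ℂ] P.L2)‖,
      fun u => ((BoundedContinuousFunction.toLp 2 P.μ ℂ :
          BoundedContinuousFunction ℝ ℂ →L[ℂ] P.L2).le_opNorm _).trans
        (mul_le_mul_of_nonneg_left (BoundedContinuousFunction.norm_compContinuous_le _ _)
          (norm_nonneg _))⟩

theorem coeFn_classOf (u : BoundedContinuousFunction (Icc (0 : ℝ) P.ℓ) ℂ) :
    P.classOf u =ᵐ[P.μ] fun z => u (projIcc 0 P.ℓ P.ℓ_pos.le z) :=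
  BoundedContinuousFunction.coeFn_toLp 2 P.μ ℂ _

/-! ### The form domain -/

/-- The coordinates `(c, (g, η))` of the functions `sin α c + ∫₀^z g` with boundary value `η`. -/
abbrev FormSpace : Type := WithLp 2 (ℂ × P.Hil)

/-- The coordinate `c`. -/
def coordC : P.FormSpace →L[ℂ] ℂ := WithLp.fstL 2 ℂ ℂ P.Hil

/-- The derivative `g`. -/
def coordD : P.FormSpace →L[ℂ] P.L2 :=
  (WithLp.fstL 2 ℂ P.L2 P.BoundarySpace).comp (WithLp.sndL 2 ℂ ℂ P.Hil)

/-- The boundary component, in the boundary space. -/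
def coordB : P.FormSpace →L[ℂ] P.BoundarySpace :=
  (WithLp.sndL 2 ℂ P.L2 P.BoundarySpace).comp (WithLp.sndL 2 ℂ ℂ P.Hil)

/-- The value of an element of the boundary space, as a bounded map. -/
def valL : P.BoundarySpace →L[ℂ] ℂ :=
  LinearMap.toContinuousLinearMap
    { toFun := BoundarySpace.val
      map_add' := fun _ _ => rfl
      map_smul' := fun _ _ => rfl }

/-- The element of the form domain with given coordinates. -/
def mkForm (c : ℂ) (g : P.L2) (η : P.BoundarySpace) : P.FormSpace :=
  WithLp.toLp 2 (c, WithLp.toLp 2 (g, η))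

@[simp] theorem coordC_mkForm (c : ℂ) (g : P.L2) (η : P.BoundarySpace) :
    P.coordC (P.mkForm c g η) = c := rfl

@[simp] theorem coordD_mkForm (c : ℂ) (g : P.L2) (η : P.BoundarySpace) :
    P.coordD (P.mkForm c g η) = g := rfl

@[simp] theorem coordB_mkForm (c : ℂ) (g : P.L2) (η : P.BoundarySpace) :
    P.coordB (P.mkForm c g η) = η := rfl

theorem formSpace_norm_sq (x : P.FormSpace) :
    ‖x‖ ^ 2 = ‖P.coordC x‖ ^ 2 + (‖P.coordD x‖ ^ 2 + ‖P.coordB x‖ ^ 2) := by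
  rw [WithLp.prod_norm_sq_eq_of_L2, WithLp.prod_norm_sq_eq_of_L2]
  rfl

/-- The function `sin α c + ∫₀^z g`. -/
def bulk : P.FormSpace →L[ℂ] BoundedContinuousFunction (Icc (0 : ℝ) P.ℓ) ℂ :=
  P.coordC.smulRight (BoundedContinuousFunction.const _ (Real.sin P.α : ℂ)) + P.prim.comp P.coordD

theorem bulk_apply (x : P.FormSpace) (z : Icc (0 : ℝ) P.ℓ) :
    P.bulk x z = P.coordC x * Real.sin P.α + ∫ s in 0..(z : ℝ), P.coordD x s := rfl

theorem isCompactOperator_bulk : IsCompactOperator P.bulk := by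
  have h1 : IsCompactOperator (P.coordC.smulRight
      (BoundedContinuousFunction.const (Icc (0 : ℝ) P.ℓ) (Real.sin P.α : ℂ))) := by
    have : IsCompactOperator P.coordC :=
      isCompactOperator_of_locallyCompactSpace_dom P.coordC
    exact this.clm_comp ((ContinuousLinearMap.id ℂ ℂ).smulRight
      (BoundedContinuousFunction.const (Icc (0 : ℝ) P.ℓ) (Real.sin P.α : ℂ)))
  exact h1.add (P.isCompactOperator_prim.comp_clm P.coordD)

/-- The class of `sin α c + ∫₀^z g`. -/
def bulkClass : P.FormSpace →L[ℂ] P.L2 := P.classOf.comp P.bulk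

theorem coeFn_bulkClass (x : P.FormSpace) : P.bulkClass x =ᵐ[P.μ]
    fun z => P.coordC x * Real.sin P.α + ∫ s in 0..z, P.coordD x s := by
  filter_upwards [P.coeFn_classOf (P.bulk x), P.ae_mem] with z hz hm
  refine hz.trans ?_
  rw [projIcc_of_mem _ (Ioo_subset_Icc_self hm), bulk_apply]

/-- The boundary value at `ℓ`. -/
def bulkEnd : P.FormSpace →L[ℂ] ℂ :=
  (BoundedContinuousFunction.evalCLM ℂ (⟨P.ℓ, P.ℓ_mem⟩ : Icc (0 : ℝ) P.ℓ)).comp P.bulk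

/-- The inclusion of the form domain into the Hilbert space. -/
def incl : P.FormSpace →L[ℂ] P.Hil :=
  ((WithLp.prodContinuousLinearEquiv 2 ℂ P.L2 P.BoundarySpace).symm : _ →L[ℂ] P.Hil).comp
    (P.bulkClass.prod P.coordB)

/-- The bulk part is a rank one operator plus the compact primitive, and the boundary part has
finite rank. -/
theorem isCompactOperator_incl : IsCompactOperator P.incl := by
  have h1 : IsCompactOperator P.bulkClass := P.isCompactOperator_bulk.clm_comp P.classOf
  have h2 : IsCompactOperator P.coordB :=
    have := FiniteDimensional.proper ℂ P.BoundarySpace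
    isCompactOperator_of_locallyCompactSpace_dom P.coordB
  exact (h1.prodMk h2).clm_comp
    ((WithLp.prodContinuousLinearEquiv 2 ℂ P.L2 P.BoundarySpace).symm : _ →L[ℂ] P.Hil)

end BulkBoundarySystem

namespace BulkBoundarySystem

variable (P : BulkBoundarySystem)

/-! ### The energy form -/

/-- The function `m² + V + 1`, extended from `[0, ℓ]` to a continuous function on `ℝ`. -/
def massFn : C(ℝ, ℝ) where
  toFun := IccExtend P.ℓ_pos.le ((Icc 0 P.ℓ).domRestrict fun z => P.m ^ 2 + P.V z + 1)
  continuous_toFun := continuous_IccExtend_iff.2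
    (((continuousOn_const.add P.V_cont).add continuousOn_const).domRestrict)

theorem massFn_apply {z : ℝ} (hz : z ∈ Icc 0 P.ℓ) : P.massFn z = P.m ^ 2 + P.V z + 1 := by
  rw [massFn, ContinuousMap.coe_mk, IccExtend_of_mem _ _ hz]
  rfl

/-- The coefficient of the form at the left end point. -/
def leftCoeff : ℝ := (if P.α = 0 then 1 else 0) - Real.sin P.α * Real.cos P.α

/-- The boundary component, as a complex number. -/
def coordV : P.FormSpace →L[ℂ] ℂ := P.valL.comp P.coordB

theorem coordV_apply (x : P.FormSpace) : P.coordV x = (P.coordB x).val := rfl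

/-- The operator of the energy form with weight `n`. -/
def formOp (n : C(ℝ, ℝ)) : P.FormSpace →L[ℂ] P.FormSpace :=
  (P.coordD†).comp ((P.mulOp n).comp P.coordD)
    + (P.bulkClass†).comp ((P.mulOp (n * P.massFn)).comp P.bulkClass)
    + ((n 0 * P.leftCoeff : ℝ) : ℂ) • (P.coordC†).comp P.coordC
    + (n P.ℓ : ℂ) • (((-P.β₁' / P.β₂' : ℝ) : ℂ) • (P.bulkEnd†).comp P.bulkEnd
      + ((1 / P.β₂' : ℝ) : ℂ) • ((P.bulkEnd†).comp P.coordV + (P.coordV†).comp P.bulkEnd)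
      + ((-P.β₂ / (P.ρ * P.β₂') + P.ρ⁻¹ : ℝ) : ℂ) • (P.coordV†).comp P.coordV)

/-- For `n = 1` this is `((A + 1) x, y)` after integration by parts. At `ℓ` the condition gives
`-∂_z u = (-β₁' u + η)/β₂'`, hence the first two coefficients; inserting this in the second
component of `A`, weighted by `ρ⁻¹`, gives the same cross coefficient `1/β₂'` by the definition of
`ρ`, together with `-β₂/(ρ β₂')`. The extra `ρ⁻¹` belongs to the `+ 1`. -/
theorem inner_formOp (n : C(ℝ, ℝ)) (y x : P.FormSpace) :
    inner ℂ y (P.formOp n x) = inner ℂ (P.coordD y) (P.mulOp n (P.coordD x))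
      + inner ℂ (P.bulkClass y) (P.mulOp (n * P.massFn) (P.bulkClass x))
      + ((n 0 * P.leftCoeff : ℝ) : ℂ) * ((starRingEnd ℂ) (P.coordC y) * P.coordC x)
      + (n P.ℓ : ℂ) * (((-P.β₁' / P.β₂' : ℝ) : ℂ) * ((starRingEnd ℂ) (P.bulkEnd y) * P.bulkEnd x)
        + ((1 / P.β₂' : ℝ) : ℂ) * ((starRingEnd ℂ) (P.bulkEnd y) * P.coordV x
          + (starRingEnd ℂ) (P.coordV y) * P.bulkEnd x)
        + ((-P.β₂ / (P.ρ * P.β₂') + P.ρ⁻¹ : ℝ) : ℂ)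
          * ((starRingEnd ℂ) (P.coordV y) * P.coordV x)) := by
  simp only [formOp, add_apply, smul_apply, ContinuousLinearMap.comp_apply, inner_add_right,
    inner_smul_right, ContinuousLinearMap.adjoint_inner_right, RCLike.inner_apply]
  ring

theorem formOp_symm (n : C(ℝ, ℝ)) (y x : P.FormSpace) :
    inner ℂ (P.formOp n y) x = inner ℂ y (P.formOp n x) := by
  rw [← inner_conj_symm, inner_formOp, inner_formOp]
  simp only [map_add, map_mul, inner_conj_symm, Complex.conj_ofReal, Complex.conj_conj, mulOp_symm]
  ring

theorem norm_coordB_sq (x : P.FormSpace) : ‖P.coordB x‖ ^ 2 = P.ρ⁻¹ * Complex.normSq (P.coordV x) := by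
  have h : (inner ℂ (P.coordB x) (P.coordB x) : ℂ).re = ‖P.coordB x‖ ^ 2 :=
    inner_self_eq_norm_sq (𝕜 := ℂ) (P.coordB x)
  rw [← h, boundary_inner, Complex.re_ofReal_mul, ← coordV_apply, mul_comm _ (P.coordV x),
    Complex.mul_conj, Complex.ofReal_re]

variable {P}

/-- At `0` the Robin condition reads `u = c sin α`, `∂_z u = -c cos α`, so the boundary term is
`-sin α cos α |c|²`, non-negative for `α` in `[π/2, π)`. For `α = 0` the coordinate `c` drops out of
`u`, and the coefficient 1 only keeps the form definite and forces `c = 0` in solutions. -/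
theorem PositivityHypotheses.leftCoeff_nonneg (hP : P.PositivityHypotheses) : 0 ≤ P.leftCoeff := by
  unfold leftCoeff
  have hs : 0 ≤ Real.sin P.α := Real.sin_nonneg_of_nonneg_of_le_pi P.α_mem.1 P.α_mem.2.le
  rcases hP.angle with h | ⟨h1, h2⟩
  · simp [h]
  · have hc : Real.cos P.α ≤ 0 := Real.cos_nonpos_of_pi_div_two_le_of_le h1 (by linarith [Real.pi_pos])
    have hα : P.α ≠ 0 := by linarith [Real.pi_pos]
    rw [if_neg hα]
    nlinarith

/-- A Hermitian `2 × 2` form with positive leading coefficient `-β₁'/β₂'` and determinant `β₁ β₂' /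
(ρ β₂'²)`; the sign hypotheses say precisely what is needed for both, and completing the square
concludes. -/
theorem PositivityHypotheses.boundary_nonneg (hP : P.PositivityHypotheses) (a b : ℂ) :
    0 ≤ -P.β₁' / P.β₂' * Complex.normSq a
      + 1 / P.β₂' * (2 * ((starRingEnd ℂ) a * b).re)
      + -P.β₂ / (P.ρ * P.β₂') * Complex.normSq b := by
  have hρ := P.ρ_pos
  have hb := hP.β₂'_ne
  have hκ : 0 < -P.β₁' / P.β₂' := by
    rcases lt_or_gt_of_ne hb with h | h
    · exact div_pos_of_neg_of_neg (by linarith [(hP.case_neg h).2.2]) h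
    · exact div_pos (by linarith [(hP.case_pos h).2.2]) h
  have hdisc : 0 ≤ (-P.β₁' / P.β₂') * (-P.β₂ / (P.ρ * P.β₂')) - (1 / P.β₂') ^ 2 := by
    have e : (-P.β₁' / P.β₂') * (-P.β₂ / (P.ρ * P.β₂')) - (1 / P.β₂') ^ 2
        = P.β₁ * P.β₂' / (P.ρ * P.β₂' ^ 2) := by
      field_simp
      unfold ρ
      ring
    rw [e]
    refine div_nonneg ?_ (by positivity)
    rcases lt_or_gt_of_ne hb with h | h
    · exact mul_nonneg_of_nonpos_of_nonpos (hP.case_neg h).1 h.le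
    · exact mul_nonneg (hP.case_pos h).1 h.le
  generalize -P.β₁' / P.β₂' = κ at *
  generalize -P.β₂ / (P.ρ * P.β₂') = γ at *
  generalize 1 / P.β₂' = s at *
  refine nonneg_of_mul_nonneg_right (a := κ) ?_ hκ
  simp only [Complex.normSq_apply, Complex.mul_re, Complex.conj_re, Complex.conj_im]
  nlinarith [sq_nonneg (κ * a.re + s * b.re), sq_nonneg (κ * a.im + s * b.im),
    mul_nonneg hdisc (add_nonneg (mul_self_nonneg b.re) (mul_self_nonneg b.im))]

theorem PositivityHypotheses.le_re_inner_formOp (hP : P.PositivityHypotheses) {n : C(ℝ, ℝ)}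
    (hn : ∀ z ∈ Icc 0 P.ℓ, 0 ≤ n z) (x : P.FormSpace) :
    (inner ℂ (P.coordD x) (P.mulOp n (P.coordD x))).re
      + (inner ℂ (P.bulkClass x) (P.mulOp n (P.bulkClass x))).re
      + n 0 * P.leftCoeff * ‖P.coordC x‖ ^ 2 + n P.ℓ * ‖P.coordB x‖ ^ 2
      ≤ (inner ℂ x (P.formOp n x)).re := by
  have h1 : (inner ℂ (P.bulkClass x) (P.mulOp n (P.bulkClass x))).re
      ≤ (inner ℂ (P.bulkClass x) (P.mulOp (n * P.massFn) (P.bulkClass x))).re := by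
    refine P.re_inner_mulOp_mono (fun z hz => ?_) _
    rw [ContinuousMap.mul_apply, P.massFn_apply hz]
    nlinarith [hn z hz, hP.potential z hz, mul_nonneg (hn z hz) (hP.potential z hz)]
  have h2 := mul_nonneg (hn _ P.ℓ_mem) (hP.boundary_nonneg (P.bulkEnd x) (P.coordV x))
  rw [inner_formOp, norm_coordB_sq]
  have e1 : (starRingEnd ℂ) (P.coordC x) * P.coordC x = ((‖P.coordC x‖ ^ 2 : ℝ) : ℂ) := by
    rw [mul_comm, Complex.mul_conj, Complex.normSq_eq_norm_sq]
  have e2 : ∀ w : ℂ, (starRingEnd ℂ) w * w = ((Complex.normSq w : ℝ) : ℂ) := fun w => by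
    rw [mul_comm, Complex.mul_conj]
  have e3 : ((starRingEnd ℂ) (P.coordV x) * P.bulkEnd x).re
      = ((starRingEnd ℂ) (P.bulkEnd x) * P.coordV x).re := by
    rw [← Complex.conj_re ((starRingEnd ℂ) (P.coordV x) * P.bulkEnd x), map_mul, Complex.conj_conj,
      mul_comm]
  simp only [Complex.add_re, Complex.re_ofReal_mul, e1, e2, e3, Complex.ofReal_re]
  linarith

/-- The left boundary term may vanish (at `α = π/2`), so it need not control `c`. When `sin α ≠ 0`,
the constant function `c sin α` is `u` minus the primitive of `g`, and both are controlled in `L²`.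
-/
theorem PositivityHypotheses.exists_norm_coordC_sq_le (hP : P.PositivityHypotheses) :
    ∃ C : ℝ, 0 ≤ C ∧ ∀ x : P.FormSpace, ‖P.coordC x‖ ^ 2
      ≤ C * (‖P.coordD x‖ ^ 2 + ‖P.bulkClass x‖ ^ 2 + P.leftCoeff * ‖P.coordC x‖ ^ 2) := by
  by_cases hα : P.α = 0
  · refine ⟨1, zero_le_one, fun x => ?_⟩
    have : P.leftCoeff = 1 := by simp [leftCoeff, hα]
    rw [this]
    nlinarith [sq_nonneg ‖P.coordD x‖, sq_nonneg ‖P.bulkClass x‖]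
  · have hs : Real.sin P.α ≠ 0 :=
      (Real.sin_pos_of_pos_of_lt_pi (lt_of_le_of_ne P.α_mem.1 (Ne.symm hα)) P.α_mem.2).ne'
    set e : P.L2 := P.classOf (BoundedContinuousFunction.const _ (Real.sin P.α : ℂ)) with he
    have he0 : e ≠ 0 := by
      intro h0
      have h1 : e =ᵐ[P.μ] fun _ => (Real.sin P.α : ℂ) := P.coeFn_classOf _
      have h2 : (fun _ => (Real.sin P.α : ℂ)) =ᵐ[P.μ] fun _ => (0 : ℂ) := by
        refine h1.symm.trans ?_
        rw [h0]
        exact Lp.coeFn_zero ℂ 2 P.μ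
      have h3 := P.eqOn_of_ae_eq continuousOn_const continuousOn_const h2 P.zero_mem
      exact hs (Complex.ofReal_eq_zero.1 h3)
    have hN : 0 < ‖e‖ := norm_pos_iff.2 he0
    set K := ‖P.classOf.comp P.prim‖ with hK
    -- The constant comes from `(a + K b)² ≤ 2 (1 + K²) (a² + b²)`.
    refine ⟨2 * (1 + K ^ 2) / ‖e‖ ^ 2, by positivity, fun x => ?_⟩
    have e1 : P.coordC x • e = P.bulkClass x - (P.classOf.comp P.prim) (P.coordD x) := by
      rw [eq_sub_iff_add_eq, he, ← map_smul, ContinuousLinearMap.comp_apply, ← map_add]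
      rfl
    have e2 : ‖P.coordC x‖ * ‖e‖ ≤ ‖P.bulkClass x‖ + K * ‖P.coordD x‖ := by
      rw [← norm_smul, e1]
      exact (norm_sub_le _ _).trans (add_le_add_right ((P.classOf.comp P.prim).le_opNorm _) _)
    have e3 : (‖P.coordC x‖ * ‖e‖) ^ 2 ≤ (‖P.bulkClass x‖ + K * ‖P.coordD x‖) ^ 2 := by gcongr
    have h4 : 0 ≤ P.leftCoeff * ‖P.coordC x‖ ^ 2 := mul_nonneg hP.leftCoeff_nonneg (sq_nonneg _)
    rw [div_mul_eq_mul_div, le_div_iff₀ (by positivity), ← mul_pow]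
    refine e3.trans ?_
    nlinarith [sq_nonneg (‖P.bulkClass x‖ - K * ‖P.coordD x‖), sq_nonneg (K * ‖P.bulkClass x‖),
      sq_nonneg ‖P.coordD x‖, mul_nonneg (sq_nonneg K) h4]

/-- Lax-Milgram: the form dominates `‖g‖² + ‖u‖² + ‖η‖²` and the left boundary term, and adding the
bound on `c` gives coercivity with constant `(C + 1)⁻¹`. -/
theorem PositivityHypotheses.isUnit_formOp (hP : P.PositivityHypotheses) :
    IsUnit (P.formOp 1) := by
  obtain ⟨C, hC, h⟩ := hP.exists_norm_coordC_sq_le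
  have hpos : 0 < C + 1 := by positivity
  refine ContinuousLinearMap.isUnit_of_forall_le_norm_inner_map _
    (c := NNReal.mk (C + 1)⁻¹ (inv_pos.2 hpos).le) (by exact inv_pos.2 hpos) fun x => ?_
  rw [NNReal.coe_mk, ← div_eq_mul_inv, div_le_iff₀ hpos, formOp_symm]
  refine le_trans ?_ (mul_le_mul_of_nonneg_right (Complex.re_le_norm _) hpos.le)
  refine le_trans ?_ (mul_le_mul_of_nonneg_right
    (hP.le_re_inner_formOp (fun _ _ => zero_le_one) x) hpos.le)
  have hself : ∀ g : P.L2, (inner ℂ g (P.mulOp 1 g)).re = ‖g‖ ^ 2 := fun g => by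
    rw [mulOp_one]
    exact inner_self_eq_norm_sq (𝕜 := ℂ) g
  simp only [hself, ContinuousMap.one_apply, one_mul]
  rw [formSpace_norm_sq]
  have := h x
  nlinarith [mul_nonneg hC (sq_nonneg ‖P.coordB x‖), sq_nonneg ‖P.bulkClass x‖,
    mul_nonneg hP.leftCoeff_nonneg (sq_nonneg ‖P.coordC x‖)]

variable (P)

/-- The weak solution operator of `(A + 1) φ = χ`. -/
def formSolve : P.Hil →L[ℂ] P.FormSpace := (Ring.inverse (P.formOp 1)).comp (P.incl†)

variable {P}

theorem PositivityHypotheses.formOp_formSolve (hP : P.PositivityHypotheses) (χ : P.Hil) :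
    P.formOp 1 (P.formSolve χ) = (P.incl†) χ := by
  have h := Ring.mul_inverse_cancel _ hP.isUnit_formOp
  exact congrArg (fun B : P.FormSpace →L[ℂ] P.FormSpace => B ((P.incl†) χ)) h

theorem PositivityHypotheses.inner_formOp_formSolve (hP : P.PositivityHypotheses)
    (y : P.FormSpace) (χ : P.Hil) :
    inner ℂ y (P.formOp 1 (P.formSolve χ)) = inner ℂ (P.incl y) χ := by
  rw [hP.formOp_formSolve, ContinuousLinearMap.adjoint_inner_right]

theorem PositivityHypotheses.formSolve_eq (hP : P.PositivityHypotheses) {x : P.FormSpace}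
    {χ : P.Hil} (h : ∀ y, inner ℂ y (P.formOp 1 x) = inner ℂ (P.incl y) χ) :
    P.formSolve χ = x := by
  have h1 : P.formOp 1 x = P.formOp 1 (P.formSolve χ) :=
    ext_inner_left ℂ fun y => by rw [h, hP.inner_formOp_formSolve]
  have h2 := Ring.inverse_mul_cancel _ hP.isUnit_formOp
  have h3 : ∀ y, Ring.inverse (P.formOp 1) (P.formOp 1 y) = y := fun y =>
    congrArg (fun B : P.FormSpace →L[ℂ] P.FormSpace => B y) h2
  rw [← h3 (P.formSolve χ), ← h1, h3]

end BulkBoundarySystem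

/-! ### Weak solutions lie in the operator domain -/

theorem AbsolutelyContinuousOnInterval.complex_conj {a b : ℝ} {f : ℝ → ℂ}
    (hf : AbsolutelyContinuousOnInterval f a b) :
    AbsolutelyContinuousOnInterval (fun x => (starRingEnd ℂ) (f x)) a b := by
  rw [absolutelyContinuousOnInterval_iff] at hf ⊢
  simpa only [Complex.dist_conj_conj] using hf

theorem HasDerivAt.complex_conj {f : ℝ → ℂ} {f' : ℂ} {x : ℝ} (hf : HasDerivAt f f' x) :
    HasDerivAt (fun x => (starRingEnd ℂ) (f x)) ((starRingEnd ℂ) f') x :=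
  Complex.conjCLE.toContinuousLinearMap.hasFDerivAt.comp_hasDerivAt x hf

theorem AbsolutelyContinuousOnInterval.const {X : Type*} [PseudoMetricSpace X] (c : X) (a b : ℝ) :
    AbsolutelyContinuousOnInterval (fun _ => c) a b := by
  simpa [AbsolutelyContinuousOnInterval] using tendsto_const_nhds

namespace BulkBoundarySystem

variable (P : BulkBoundarySystem)

theorem memLp_of_continuousOn {u : ℝ → ℂ} (hu : ContinuousOn u (Icc 0 P.ℓ)) : MemLp u 2 P.μ := by
  obtain ⟨C, hC⟩ := isCompact_Icc.exists_bound_of_continuousOn hu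
  refine MemLp.of_bound ((hu.mono Ioo_subset_Icc_self).aestronglyMeasurable measurableSet_Ioo) C ?_
  filter_upwards [P.ae_mem] with z hz using hC z (Ioo_subset_Icc_self hz)

/-- The function `sin α c + ∫₀^z g` on the real line. -/
def bulkFun (x : P.FormSpace) (z : ℝ) : ℂ := P.coordC x * Real.sin P.α + ∫ s in 0..z, P.coordD x s

theorem bulkFun_zero (x : P.FormSpace) : P.bulkFun x 0 = P.coordC x * Real.sin P.α := by
  simp [bulkFun]

theorem bulkFun_ℓ (x : P.FormSpace) : P.bulkFun x P.ℓ = P.bulkEnd x := rfl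

theorem bulkClass_ae_eq (x : P.FormSpace) : P.bulkClass x =ᵐ[P.μ] P.bulkFun x :=
  P.coeFn_bulkClass x

theorem ac_bulkFun (x : P.FormSpace) : AbsolutelyContinuousOnInterval (P.bulkFun x) 0 P.ℓ :=
  (AbsolutelyContinuousOnInterval.const _ _ _).add (P.ac_prim (P.coordD x))

theorem hasDerivAt_bulkFun (x : P.FormSpace) :
    ∀ᵐ z ∂P.μ, HasDerivAt (P.bulkFun x) (P.coordD x z) z := by
  filter_upwards [P.hasDerivAt_prim (P.coordD x)] with z hz using hz.const_add _

theorem continuousOn_of_ac {u : ℝ → ℂ} (hu : AbsolutelyContinuousOnInterval u 0 P.ℓ) :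
    ContinuousOn u (Icc 0 P.ℓ) := by
  have := hu.continuousOn
  rwa [uIcc_of_le P.ℓ_pos.le] at this

/-- Integration by parts against an element of the form domain. -/
theorem inner_add_inner_eq (y : P.FormSpace) {v : ℝ → ℂ} {f w : P.L2}
    (hv : AbsolutelyContinuousOnInterval v 0 P.ℓ) (hf : f =ᵐ[P.μ] v)
    (hd : ∀ᵐ z ∂P.μ, HasDerivAt v (w z) z) :
    inner ℂ (P.coordD y) f + inner ℂ (P.bulkClass y) w
      = (starRingEnd ℂ) (P.bulkEnd y) * v P.ℓ
        - (starRingEnd ℂ) (P.coordC y * Real.sin P.α) * v 0 := by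
  have hY := (P.ac_bulkFun y).complex_conj
  have hdY : ∀ᵐ z ∂P.μ, HasDerivAt (fun z => (starRingEnd ℂ) (P.bulkFun y z))
      ((starRingEnd ℂ) (P.coordD y z)) z := by
    filter_upwards [P.hasDerivAt_bulkFun y] with z hz using hz.complex_conj
  have hiY : Integrable (fun z => (starRingEnd ℂ) (P.coordD y z)) P.μ :=
    Complex.conjCLE.toContinuousLinearMap.integrable_comp (P.integrable_coeFn (P.coordD y))
  have h := hY.integral_mul_add_mul_eq_sub hv
    (P.intervalIntegrable_of_integrable hiY P.zero_mem P.ℓ_mem)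
    (P.intervalIntegrable_coeFn w P.zero_mem P.ℓ_mem)
    (P.ae_volume_iff.2 hdY) (P.ae_volume_iff.2 hd)
  rw [bulkFun_zero, bulkFun_ℓ, ← integral_μ] at h
  rw [← h, inner_eq, inner_eq, ← integral_add]
  · refine integral_congr_ae ?_
    filter_upwards [hf, P.bulkClass_ae_eq y] with z h1 h2
    rw [h1, h2]
  · exact (L2.integrable_inner (𝕜 := ℂ) (P.coordD y) f).congr
      (Filter.Eventually.of_forall fun z => by simp [RCLike.inner_apply, mul_comm])
  · exact (L2.integrable_inner (𝕜 := ℂ) (P.bulkClass y) w).congr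
      (Filter.Eventually.of_forall fun z => by simp [RCLike.inner_apply, mul_comm])

theorem hasDerivWithinAt_prim {v : ℝ → ℂ} (hv : ContinuousOn v (Icc 0 P.ℓ)) {z : ℝ}
    (hz : z ∈ Icc 0 P.ℓ) : HasDerivWithinAt (fun x => ∫ s in 0..x, v s) (v z) (Icc 0 P.ℓ) z := by
  have hc : Continuous (IccExtend P.ℓ_pos.le ((Icc 0 P.ℓ).domRestrict v)) :=
    continuous_IccExtend_iff.2 hv.domRestrict
  have he : ∀ x ∈ Icc 0 P.ℓ, IccExtend P.ℓ_pos.le ((Icc 0 P.ℓ).domRestrict v) x = v x := fun x hx => by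
    rw [IccExtend_of_mem _ _ hx]
    rfl
  have h1 := (hc.integral_hasStrictDerivAt 0 z).hasDerivAt.hasDerivWithinAt (s := Icc 0 P.ℓ)
  rw [he z hz] at h1
  have h2 : ∀ x ∈ Icc 0 P.ℓ, ∫ s in 0..x, v s
      = ∫ s in 0..x, IccExtend P.ℓ_pos.le ((Icc 0 P.ℓ).domRestrict v) s := fun x hx =>
    intervalIntegral.integral_congr fun s hs =>
      (he s (uIcc_subset_Icc P.zero_mem hx hs)).symm
  exact h1.congr h2 (h2 z hz)

variable {P}

/-- Regularity of weak solutions: the equation dictates what `∂_z u` must be, and the three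
coordinates of the test vector return that identity and the two boundary equations as natural
conditions. -/
theorem PositivityHypotheses.mem_opGraph (hP : P.PositivityHypotheses) (χ : P.Hil) :
    (P.incl (P.formSolve χ), χ - P.incl (P.formSolve χ)) ∈ P.opGraph := by
  have hρ := P.ρ_pos.ne'
  have hb' := hP.β₂'_ne
  set x := P.formSolve χ with hx
  -- `F` is the value that `∂_z² u` must take, `-e` the value that `∂_z u(ℓ)` must take, and `v` the
  -- primitive of `F` normalised by `v(ℓ) = -e`.
  set F : P.L2 := P.mulOp P.massFn (P.bulkClass x) - χ.fst with hF
  set e : ℂ := ((-P.β₁' / P.β₂' : ℝ) : ℂ) * P.bulkEnd x + ((1 / P.β₂' : ℝ) : ℂ) * P.coordV x with he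
  set v : ℝ → ℂ := fun z => (- e - ∫ s in 0..P.ℓ, F s) + ∫ s in 0..z, F s with hv
  have hvℓ : v P.ℓ = -e := by simp [hv]
  have hvac : AbsolutelyContinuousOnInterval v 0 P.ℓ :=
    (AbsolutelyContinuousOnInterval.const _ _ _).add (P.ac_prim F)
  have hvd : ∀ᵐ z ∂P.μ, HasDerivAt v (F z) z := by
    filter_upwards [P.hasDerivAt_prim F] with z hz using hz.const_add _
  have hvc := P.continuousOn_of_ac hvac
  set f : P.L2 := (P.memLp_of_continuousOn hvc).toLp with hf
  have hfv : f =ᵐ[P.μ] v := MemLp.coeFn_toLp _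
  have weak : ∀ y : P.FormSpace, inner ℂ (P.coordD y) (P.coordD x)
      + ((starRingEnd ℂ) (P.bulkEnd y) * - e
        - (starRingEnd ℂ) (P.coordC y * Real.sin P.α) * v 0 - inner ℂ (P.coordD y) f)
      + (P.leftCoeff : ℂ) * ((starRingEnd ℂ) (P.coordC y) * P.coordC x)
      + ((starRingEnd ℂ) (P.bulkEnd y) * e
        + (starRingEnd ℂ) (P.coordV y) * (((1 / P.β₂' : ℝ) : ℂ) * P.bulkEnd x
          + ((-P.β₂ / (P.ρ * P.β₂') + P.ρ⁻¹ : ℝ) : ℂ) * P.coordV x))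
      = (P.ρ⁻¹ : ℝ) * ((starRingEnd ℂ) (P.coordV y) * χ.snd.val) := by
    intro y
    have h1 := hP.inner_formOp_formSolve y χ
    have h2 := P.inner_add_inner_eq y hvac hfv hvd
    rw [hvℓ, hF, inner_sub_right] at h2
    rw [← hx, inner_formOp, WithLp.prod_inner_apply, boundary_inner, mulOp_one, one_mul] at h1
    simp only [ContinuousMap.one_apply, one_mul, Complex.ofReal_one] at h1
    change _ = inner ℂ (P.bulkClass y) χ.fst + _ * ((starRingEnd ℂ) (P.coordV y) * χ.snd.val) at h1
    rw [he] at h2 ⊢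
    linear_combination h1 - h2
  -- The derivative `k` of the test function is arbitrary; its value at `ℓ` does not vanish in
  -- general, but the terms containing it cancel thanks to `v(ℓ) = -e`.
  have hD : P.coordD x = f := by
    refine ext_inner_left ℂ fun k => ?_
    have := weak (P.mkForm 0 k 0)
    simp only [coordD_mkForm, coordC_mkForm, coordV_apply, coordB_mkForm, map_zero, zero_mul,
      mul_zero, BoundarySpace.val_zero] at this
    linear_combination this
  have hB : ((1 / P.β₂' : ℝ) : ℂ) * P.bulkEnd x
      + ((-P.β₂ / (P.ρ * P.β₂') + P.ρ⁻¹ : ℝ) : ℂ) * P.coordV x = (P.ρ⁻¹ : ℝ) * χ.snd.val := by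
    have h1 := weak (P.mkForm 0 0 (BoundarySpace.mk P 1))
    have h2 : (BoundarySpace.mk P 1).val = 1 := rfl
    simp only [coordD_mkForm, coordC_mkForm, coordV_apply, coordB_mkForm, map_zero, zero_mul,
      mul_zero, h2, inner_zero_left, map_one, one_mul] at h1
    rw [coordV_apply]
    linear_combination h1
  have hC : (P.leftCoeff : ℂ) * P.coordC x = Real.sin P.α * v 0 := by
    have h1 := weak (P.mkForm 1 0 0)
    simp only [coordD_mkForm, coordC_mkForm, coordV_apply, coordB_mkForm, map_zero, zero_mul,
      mul_zero, BoundarySpace.val_zero, inner_zero_left, map_one, one_mul, Complex.conj_ofReal] at h1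
    linear_combination h1
  have hρ' : (P.ρ : ℂ) ≠ 0 := Complex.ofReal_ne_zero.2 hρ
  have hb'' : (P.β₂' : ℂ) ≠ 0 := Complex.ofReal_ne_zero.2 hb'
  have hχ : χ.snd.val = (P.ρ : ℂ) * (((1 / P.β₂' : ℝ) : ℂ) * P.bulkEnd x
      + ((-P.β₂ / (P.ρ * P.β₂') + P.ρ⁻¹ : ℝ) : ℂ) * P.coordV x) := by
    rw [hB]
    push_cast
    field_simp
  refine ⟨P.bulkFun x, v, F, ⟨P.bulkClass_ae_eq x, P.ac_bulkFun x, hvac, fun z hz => ?_, hvd,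
    Lp.memLp F⟩, ?_, ?_, ?_, ?_⟩
  · have h1 : ∀ z ∈ Icc 0 P.ℓ, P.bulkFun x z
        = P.coordC x * Real.sin P.α + ∫ s in 0..z, v s := fun z hz => by
      rw [bulkFun, hD, P.intervalIntegral_congr_ae hfv P.zero_mem hz]
    exact ((P.hasDerivWithinAt_prim hvc hz).const_add _).congr h1 (h1 z hz)
  · rw [bulkFun_zero]
    unfold leftCoeff at hC
    split_ifs at hC with hα
    · simp [hα]
    · push_cast at hC ⊢
      linear_combination -hC
  · change P.coordV x = _
    rw [hvℓ, bulkFun_ℓ, he]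
    push_cast
    field_simp
    ring
  · filter_upwards [Lp.coeFn_sub χ.fst (P.bulkClass x), P.coeFn_mulOp P.massFn (P.bulkClass x),
      Lp.coeFn_sub (P.mulOp P.massFn (P.bulkClass x)) χ.fst, P.bulkClass_ae_eq x, P.ae_mem]
      with z h1 h2 h3 h4 h5
    refine h1.trans ?_
    rw [hF, h3, Pi.sub_apply, Pi.sub_apply, h2, h4, P.massFn_apply (Ioo_subset_Icc_self h5)]
    push_cast
    ring
  · change χ.snd.val - P.coordV x = _
    rw [hvℓ, bulkFun_ℓ, he, hχ]
    unfold ρ at hρ' ⊢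
    push_cast at hρ' ⊢
    field_simp
    ring

end BulkBoundarySystem

/-! ### Domain elements are weak solutions; the resolvent -/

namespace BulkBoundarySystem

variable {P : BulkBoundarySystem}

theorem PositivityHypotheses.incl_formSolve_of_mem_opGraph (hP : P.PositivityHypotheses)
    {φ ψ : P.Hil} (h : (φ, ψ) ∈ P.opGraph) : P.incl (P.formSolve (φ + ψ)) = φ := by
  obtain ⟨u, v, w, h⟩ := h
  simp only at h
  have hb' : (P.β₂' : ℂ) ≠ 0 := Complex.ofReal_ne_zero.2 hP.β₂'_ne
  have hρ' : (P.ρ : ℂ) ≠ 0 := Complex.ofReal_ne_zero.2 P.ρ_pos.ne'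
  have hvc := P.continuousOn_of_ac h.profile.ac_v
  set f : P.L2 := (P.memLp_of_continuousOn hvc).toLp with hf
  have hfv : f =ᵐ[P.μ] v := MemLp.coeFn_toLp _
  set W : P.L2 := h.profile.memLp_w.toLp with hW
  have hWw : W =ᵐ[P.μ] w := MemLp.coeFn_toLp _
  have hvd : ∀ᵐ z ∂P.μ, HasDerivAt v (W z) z := by
    filter_upwards [h.profile.deriv_v, hWw] with z h1 h2
    rwa [h2]
  -- For `α = 0` the function `u` leaves `c` undetermined; the choice 0 is the one for which the
  -- left boundary term of the form vanishes.
  set x : P.FormSpace := P.mkForm (if P.α = 0 then 0 else u 0 / Real.sin P.α) f φ.snd with hx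
  have hx0 : P.coordC x * Real.sin P.α = u 0 := by
    rw [hx, coordC_mkForm]
    split_ifs with hα
    · have := h.bc_left
      simp only [hα, Real.cos_zero, Real.sin_zero, Complex.ofReal_one, Complex.ofReal_zero] at this
      linear_combination -this
    · have hs : Real.sin P.α ≠ 0 :=
        (Real.sin_pos_of_pos_of_lt_pi (lt_of_le_of_ne P.α_mem.1 (Ne.symm hα)) P.α_mem.2).ne'
      exact div_mul_cancel₀ _ (Complex.ofReal_ne_zero.2 hs)
  have hu : ∀ z ∈ Icc 0 P.ℓ, P.bulkFun x z = u z := by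
    intro z hz
    have h1 : ∫ s in 0..z, v s = u z - u 0 := by
      refine intervalIntegral.integral_eq_sub_of_hasDeriv_right_of_le hz.1
        (h.profile.continuousOn.mono (Icc_subset_Icc_right hz.2)) (fun s hs => ?_)
        (P.intervalIntegrable_of_integrable
          ((P.memLp_of_continuousOn hvc).integrable one_le_two) P.zero_mem hz)
      have hs' : s ∈ Ioo 0 P.ℓ := ⟨hs.1, hs.2.trans_le hz.2⟩
      exact ((h.profile.deriv_u s (Ioo_subset_Icc_self hs')).hasDerivAt
        (Icc_mem_nhds hs'.1 hs'.2)).hasDerivWithinAt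
    rw [bulkFun, hx0, hx, coordD_mkForm, P.intervalIntegral_congr_ae hfv P.zero_mem hz, h1]
    ring
  have hxu : P.bulkClass x =ᵐ[P.μ] u := by
    filter_upwards [P.bulkClass_ae_eq x, P.ae_mem] with z h1 h2
    rw [h1, hu z (Ioo_subset_Icc_self h2)]
  have hincl : P.incl x = φ :=
    WithLp.ofLp_injective 2 (Prod.ext (Lp.ext (hxu.trans h.profile.rep.symm)) rfl)
  have hend : P.bulkEnd x = u P.ℓ := hu _ P.ℓ_mem
  have hV : P.coordV x = φ.snd.val := rfl
  have hmass : P.mulOp P.massFn (P.bulkClass x) = φ.fst + ψ.fst + W := by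
    refine Lp.ext ?_
    filter_upwards [P.coeFn_mulOp P.massFn (P.bulkClass x), hxu, Lp.coeFn_add (φ.fst + ψ.fst) W,
      Lp.coeFn_add φ.fst ψ.fst, h.profile.rep, h.bulk_eq, hWw, P.ae_mem]
      with z h1 h2 h3 h4 h5 h6 h7 h8
    rw [h1, h2, h3, Pi.add_apply, h4, Pi.add_apply, h5, h6, h7,
      P.massFn_apply (Ioo_subset_Icc_self h8)]
    push_cast
    ring
  have hleft : (P.leftCoeff : ℂ) * P.coordC x = Real.sin P.α * v 0 := by
    unfold leftCoeff
    have hbc := h.bc_left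
    rw [← hx0] at hbc
    split_ifs with hα
    · simp [hx, hα]
    · push_cast at hbc ⊢
      linear_combination -hbc
  rw [hP.formSolve_eq (x := x) fun y => ?_, hincl]
  have h1 := P.inner_add_inner_eq y h.profile.ac_v hfv hvd
  rw [inner_formOp, WithLp.prod_inner_apply, boundary_inner, mulOp_one, one_mul, hmass]
  simp only [ContinuousMap.one_apply, one_mul, Complex.ofReal_one]
  change _ = inner ℂ (P.bulkClass y) (φ.fst + ψ.fst)
    + _ * ((starRingEnd ℂ) (P.coordV y) * (φ.snd.val + ψ.snd.val))
  have hD : P.coordD x = f := rfl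
  rw [inner_add_right _ _ W, hend, hV, hD, h.boundary_eq, h.bc_right]
  have e1 : inner ℂ (P.coordD y) f = (starRingEnd ℂ) (P.bulkEnd y) * v P.ℓ
        - (starRingEnd ℂ) (P.coordC y * Real.sin P.α) * v 0 - inner ℂ (P.bulkClass y) W := by
    linear_combination h1
  have e2 : ((P.leftCoeff : ℝ) : ℂ) * ((starRingEnd ℂ) (P.coordC y) * P.coordC x)
      = (starRingEnd ℂ) (P.coordC y) * (Real.sin P.α * v 0) := by
    rw [← hleft]
    ring
  rw [e1, e2, map_mul, Complex.conj_ofReal]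
  have hρe : (P.ρ : ℂ) = P.β₁' * P.β₂ - P.β₁ * P.β₂' := by
    unfold ρ
    push_cast
    ring
  push_cast
  field_simp
  rw [hρe]
  ring

variable (P)

/-- The operator `(A + 1)⁻¹`. -/
def resolvent : P.Hil →L[ℂ] P.Hil := P.incl.comp P.formSolve

theorem resolvent_apply (χ : P.Hil) : P.resolvent χ = P.incl (P.formSolve χ) := rfl

variable {P}

/-- Symmetry is that of the form. Non-negativity holds because `(R χ, χ)` is the form at the weak
solution, which dominates `‖R χ‖²` thanks to the `+ 1`. -/
theorem PositivityHypotheses.isNonnegResolvent (hP : P.PositivityHypotheses) :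
    UnboundedOp.IsNonnegResolvent P.A P.resolvent where
  mem_graph_iff φ ψ := by
    rw [A_graph]
    refine ⟨hP.incl_formSolve_of_mem_opGraph, fun h => ?_⟩
    have h1 := hP.mem_opGraph (φ + ψ)
    rw [resolvent_apply] at h
    rwa [h, add_sub_cancel_left] at h1
  isCompact := P.isCompactOperator_incl.comp_clm P.formSolve
  symm φ ψ := by
    rw [resolvent_apply, resolvent_apply, ← hP.inner_formOp_formSolve, ← inner_conj_symm φ,
      ← hP.inner_formOp_formSolve, inner_conj_symm, formOp_symm]
  nonneg χ := by
    rw [resolvent_apply, inner_sub_right, ← hP.inner_formOp_formSolve, Complex.sub_re, sub_nonneg]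
    refine le_trans ?_ (hP.le_re_inner_formOp (fun _ _ => zero_le_one) (P.formSolve χ))
    have h1 : 0 ≤ (inner ℂ (P.coordD (P.formSolve χ))
        (P.mulOp 1 (P.coordD (P.formSolve χ)))).re :=
      P.re_inner_mulOp_nonneg (fun _ _ => zero_le_one) _
    have h2 : 0 ≤ P.leftCoeff * ‖P.coordC (P.formSolve χ)‖ ^ 2 :=
      mul_nonneg hP.leftCoeff_nonneg (sq_nonneg _)
    have h3 : (inner ℂ (P.coordB (P.formSolve χ)) (P.coordB (P.formSolve χ)) : ℂ).re
        = ‖P.coordB (P.formSolve χ)‖ ^ 2 := inner_self_eq_norm_sq (𝕜 := ℂ) (P.coordB (P.formSolve χ))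
    rw [WithLp.prod_inner_apply, Complex.add_re]
    simp only [ContinuousMap.one_apply, one_mul, mulOp_one] at h1 ⊢
    change (inner ℂ (P.bulkClass (P.formSolve χ)) (P.bulkClass (P.formSolve χ))).re
      + (inner ℂ (P.coordB (P.formSolve χ)) (P.coordB (P.formSolve χ))).re ≤ _
    linarith

end BulkBoundarySystem

theorem hasDerivAt_re_inner_apply_self {E : Type*} [NormedAddCommGroup E] [InnerProductSpace ℂ E]
    {S : E →L[ℂ] E} (hS : ∀ x y, inner ℂ (S x) y = inner ℂ x (S y)) {a : ℝ → E} {a' : E} {t : ℝ}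
    (ha : HasDerivAt a a' t) :
    HasDerivAt (fun t => (inner ℂ (a t) (S (a t))).re) (2 * (inner ℂ a' (S (a t))).re) t := by
  have h1 : HasDerivAt (fun t => S (a t)) (S a') t :=
    (S.restrictScalars ℝ).hasFDerivAt.comp_hasDerivAt t ha
  have h2 := Complex.reCLM.hasFDerivAt.comp_hasDerivAt t (ha.inner ℂ h1)
  refine h2.congr_deriv ?_
  have e : (inner ℂ (a t) (S a')).re = (inner ℂ a' (S (a t))).re := by
    rw [← hS, ← inner_conj_symm, Complex.conj_re]
  rw [map_add, Complex.reCLM_apply, Complex.reCLM_apply, e]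
  ring

namespace BulkBoundarySystem

open UnboundedOp

variable (P : BulkBoundarySystem)

/-! ### Weighted energies -/

/-- Multiplication by `n` on the Hilbert space, with the value `n(ℓ)` on the boundary component. -/
def weightOp (n : C(ℝ, ℝ)) : P.Hil →L[ℂ] P.Hil :=
  ((WithLp.prodContinuousLinearEquiv 2 ℂ P.L2 P.BoundarySpace).symm : _ →L[ℂ] P.Hil).comp
    (((P.mulOp n).comp (WithLp.fstL 2 ℂ P.L2 P.BoundarySpace)).prod
      ((n P.ℓ : ℂ) • WithLp.sndL 2 ℂ P.L2 P.BoundarySpace))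

theorem inner_weightOp (n : C(ℝ, ℝ)) (f g : P.Hil) :
    inner ℂ f (P.weightOp n g)
      = inner ℂ f.fst (P.mulOp n g.fst) + (n P.ℓ : ℂ) * inner ℂ f.snd g.snd := by
  rw [WithLp.prod_inner_apply, ← inner_smul_right]
  rfl

theorem weightOp_symm (n : C(ℝ, ℝ)) (f g : P.Hil) :
    inner ℂ (P.weightOp n f) g = inner ℂ f (P.weightOp n g) := by
  rw [← inner_conj_symm, inner_weightOp, inner_weightOp, map_add, map_mul, inner_conj_symm,
    inner_conj_symm, Complex.conj_ofReal, mulOp_symm]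

theorem re_inner_weightOp (n : C(ℝ, ℝ)) (f : P.Hil) :
    (inner ℂ f (P.weightOp n f)).re
      = (inner ℂ f.fst (P.mulOp n f.fst)).re + n P.ℓ * ‖f.snd‖ ^ 2 := by
  have h : (inner ℂ f.snd f.snd : ℂ).re = ‖f.snd‖ ^ 2 := inner_self_eq_norm_sq (𝕜 := ℂ) f.snd
  rw [inner_weightOp, Complex.add_re, Complex.re_ofReal_mul, h]

theorem two_mul_re_inner_weightOp_le {n : C(ℝ, ℝ)} (hn : ∀ z ∈ Icc 0 P.ℓ, 0 ≤ n z) (f g : P.Hil) :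
    2 * (inner ℂ f (P.weightOp n g)).re
      ≤ (inner ℂ f (P.weightOp n f)).re + (inner ℂ g (P.weightOp n g)).re := by
  have h1 := P.two_mul_re_inner_mulOp_le (n := n) (k := n)
    (fun z hz => (abs_of_nonneg (hn z hz)).le) f.fst g.fst
  have h2 : 2 * (inner ℂ f.snd g.snd : ℂ).re ≤ ‖f.snd‖ ^ 2 + ‖g.snd‖ ^ 2 := by
    have h3 : (inner ℂ f.snd g.snd : ℂ).re ≤ ‖f.snd‖ * ‖g.snd‖ :=
      re_inner_le_norm (𝕜 := ℂ) f.snd g.snd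
    nlinarith [sq_nonneg (‖f.snd‖ - ‖g.snd‖)]
  have h4 := mul_le_mul_of_nonneg_left h2 (hn _ P.ℓ_mem)
  rw [re_inner_weightOp, re_inner_weightOp, inner_weightOp, Complex.add_re, Complex.re_ofReal_mul]
  linarith

/-- Multiplication by `n`, with derivative `n'`, on the form domain. -/
def weightForm (n n' : C(ℝ, ℝ)) (y : P.FormSpace) : P.FormSpace :=
  P.mkForm ((n 0 : ℂ) * P.coordC y)
    (P.mulOp n (P.coordD y) + P.mulOp n' (P.bulkClass y)) ((n P.ℓ : ℂ) • P.coordB y)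

/-- The product rule in integrated form: the coordinate `g` of the weighted element is the
derivative of `n u`, and its coordinate `c` gives the right value at `0`. -/
theorem bulkFun_weightForm {n n' : C(ℝ, ℝ)} (hn : ∀ z, HasDerivAt n (n' z) z) (y : P.FormSpace)
    {z : ℝ} (hz : z ∈ Icc 0 P.ℓ) : P.bulkFun (P.weightForm n n' y) z = n z * P.bulkFun y z := by
  have hac : AbsolutelyContinuousOnInterval (fun z => (n z : ℂ)) 0 z :=
    (AbsolutelyContinuousOnInterval.of_forall_hasDerivAt hn n'.continuous).complex_ofReal
  have hsub : uIcc 0 z ⊆ uIcc 0 P.ℓ := by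
    rw [uIcc_of_le hz.1, uIcc_of_le P.ℓ_pos.le]
    exact Icc_subset_Icc_right hz.2
  have h := hac.integral_mul_add_mul_eq_sub ((P.ac_bulkFun y).mono hsub)
    (Continuous.intervalIntegrable (by fun_prop : Continuous fun z => (n' z : ℂ)) _ _)
    (P.intervalIntegrable_coeFn (P.coordD y) P.zero_mem hz)
    (Filter.Eventually.of_forall fun s _ => (hn s).ofReal_comp)
    (P.ae_volume_of_ae (P.hasDerivAt_bulkFun y) P.zero_mem hz)
  have hD : P.coordD (P.weightForm n n' y)
      =ᵐ[P.μ] fun s => (n' s : ℂ) * P.bulkFun y s + (n s : ℂ) * P.coordD y s := by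
    change (P.mulOp n (P.coordD y) + P.mulOp n' (P.bulkClass y) : P.L2) =ᵐ[P.μ] _
    filter_upwards [Lp.coeFn_add (P.mulOp n (P.coordD y)) (P.mulOp n' (P.bulkClass y)),
      P.coeFn_mulOp n (P.coordD y), P.coeFn_mulOp n' (P.bulkClass y), P.bulkClass_ae_eq y]
      with s h1 h2 h3 h4
    rw [h1, Pi.add_apply, h2, h3, h4, add_comm]
  have hC : P.coordC (P.weightForm n n' y) = (n 0 : ℂ) * P.coordC y := rfl
  rw [bulkFun, P.intervalIntegral_congr_ae hD P.zero_mem hz, h, hC, bulkFun_zero]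
  ring

theorem bulkClass_weightForm {n n' : C(ℝ, ℝ)} (hn : ∀ z, HasDerivAt n (n' z) z)
    (y : P.FormSpace) : P.bulkClass (P.weightForm n n' y) = P.mulOp n (P.bulkClass y) := by
  refine Lp.ext ?_
  filter_upwards [P.bulkClass_ae_eq (P.weightForm n n' y), P.bulkClass_ae_eq y,
    P.coeFn_mulOp n (P.bulkClass y), P.ae_mem] with z h1 h2 h3 h4
  rw [h1, h3, h2, P.bulkFun_weightForm hn y (Ioo_subset_Icc_self h4)]

theorem bulkEnd_weightForm {n n' : C(ℝ, ℝ)} (hn : ∀ z, HasDerivAt n (n' z) z)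
    (y : P.FormSpace) : P.bulkEnd (P.weightForm n n' y) = n P.ℓ * P.bulkEnd y :=
  P.bulkFun_weightForm hn y P.ℓ_mem

theorem incl_weightForm {n n' : C(ℝ, ℝ)} (hn : ∀ z, HasDerivAt n (n' z) z) (y : P.FormSpace) :
    P.incl (P.weightForm n n' y) = P.weightOp n (P.incl y) :=
  WithLp.ofLp_injective 2 (Prod.ext (P.bulkClass_weightForm hn y) rfl)

/-- Moving the weight from the test vector into the form costs only a commutator with `∂_z`; all
other terms, boundary terms included, are local. -/
theorem inner_weightForm_formOp {n n' : C(ℝ, ℝ)} (hn : ∀ z, HasDerivAt n (n' z) z)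
    (y x : P.FormSpace) : inner ℂ (P.weightForm n n' y) (P.formOp 1 x)
      = inner ℂ y (P.formOp n x) + inner ℂ (P.bulkClass y) (P.mulOp n' (P.coordD x)) := by
  have hC : P.coordC (P.weightForm n n' y) = (n 0 : ℂ) * P.coordC y := rfl
  have hV : P.coordV (P.weightForm n n' y) = (n P.ℓ : ℂ) * P.coordV y := rfl
  have hD : P.coordD (P.weightForm n n' y)
    = P.mulOp n (P.coordD y) + P.mulOp n' (P.bulkClass y) := rfl
  rw [inner_formOp, inner_formOp, P.bulkClass_weightForm hn, P.bulkEnd_weightForm hn, hC, hV, hD,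
    inner_add_left, mulOp_symm, mulOp_symm, mulOp_symm, mulOp_one, one_mul, mulOp_mul]
  simp only [ContinuousMap.one_apply, one_mul, Complex.ofReal_one, map_mul, Complex.conj_ofReal]
  push_cast
  ring

variable {P}

/-- A weighted energy estimate for `∂_t² y + A y = 0`, `y(0) = 0`, `∂_t y(0) = φ`. -/
theorem PositivityHypotheses.re_inner_weightOp_waveCos_le (hP : P.PositivityHypotheses)
    {n n' : C(ℝ, ℝ)} (hn : ∀ z, HasDerivAt n (n' z) z) {L : ℝ} (hL0 : 0 ≤ L) (hn0 : ∀ z, 0 ≤ n z)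
    (hL : ∀ z, |n' z| ≤ L * n z) (φ : GraphDomain P.A) {t : ℝ} (ht : 0 ≤ t) :
    (inner ℂ (waveCos P.A t (GraphDomain.incl P.A φ))
      (P.weightOp n (waveCos P.A t (GraphDomain.incl P.A φ)))).re
      ≤ Real.exp ((L + 1) * t)
        * (inner ℂ (GraphDomain.incl P.A φ) (P.weightOp n (GraphDomain.incl P.A φ))).re := by
  have hR := hP.isNonnegResolvent
  set φ₀ := GraphDomain.incl P.A φ with hφ₀
  set ψ₀ := GraphDomain.op P.A φ with hψ₀
  have hRφ : P.resolvent (φ₀ + ψ₀) = φ₀ := (hR.mem_graph_iff _ _).1 φ.mem_graph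
  -- Form coordinates of the solution `y = sin(√A t)/√A φ₀`. Writing `φ₀ = R (φ₀ + ψ₀)` makes `x`
  -- differentiable in the norm of the form domain.
  set x : ℝ → P.FormSpace := fun t => - P.formSolve (waveKernel P.A t (φ₀ + ψ₀)) with hx
  set x' : ℝ → P.FormSpace := fun t => P.formSolve (waveCos P.A t (φ₀ + ψ₀)) with hx'
  set y' : ℝ → P.Hil := fun t => waveCos P.A t φ₀ with hy'
  have dx : ∀ t, HasDerivAt x (x' t) t := fun t => by
    have h1 := (P.formSolve.restrictScalars ℝ).hasFDerivAt.comp_hasDerivAt t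
      (hR.hasDerivAt_waveKernel (φ₀ + ψ₀) t)
    refine h1.neg.congr_deriv ?_
    change - P.formSolve (- waveCos P.A t (φ₀ + ψ₀)) = _
    rw [map_neg, neg_neg]
  have dy : ∀ t, HasDerivAt y' (waveKernel P.A t ψ₀) t := 
    hR.hasDerivAt_waveCos φ
  have hyx : ∀ t, y' t = P.incl (x' t) := fun t => by
    change waveCos P.A t φ₀ = P.resolvent (waveCos P.A t (φ₀ + ψ₀))
    rw [← hR.waveCos_resolvent, hRφ]
  -- The wave equation as `y'' = y - (A + 1) y`.
  have hKψ : ∀ t, waveKernel P.A t ψ₀ = P.incl (x t) + waveKernel P.A t (φ₀ + ψ₀) := fun t => by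
    have : P.incl (x t) = - waveKernel P.A t φ₀ := by
      rw [hx, map_neg, ← resolvent_apply, ← hR.waveKernel_resolvent, hRφ]
    rw [this, map_add]
    abel
  set e : ℝ → ℝ := fun t => (inner ℂ (y' t) (P.weightOp n (y' t))).re
    + (inner ℂ (x t) (P.formOp n (x t))).re with he
  -- The `(A + 1) y` contributions of the kinetic and the form energy cancel. What survives is the
  -- lower order term due to the added 1 and the flux term with `n'`.
  have de : ∀ t, HasDerivAt e (2 * (inner ℂ (y' t) (P.weightOp n (P.incl (x t)))).re
      - 2 * (inner ℂ (P.bulkClass (x' t)) (P.mulOp n' (P.coordD (x t)))).re) t := fun t => by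
    refine ((hasDerivAt_re_inner_apply_self (P.weightOp_symm n) (dy t)).add
      (hasDerivAt_re_inner_apply_self (P.formOp_symm n) (dx t))).congr_deriv ?_
    have e1 := P.inner_weightForm_formOp hn (x' t) (x t)
    have e2 : inner ℂ (P.weightForm n n' (x' t)) (P.formOp 1 (x t))
        = - inner ℂ (P.weightOp n (y' t)) (waveKernel P.A t (φ₀ + ψ₀)) := by
      rw [hx, map_neg, inner_neg_right, hP.inner_formOp_formSolve, P.incl_weightForm hn, ← hyx]
    have e3 : (inner ℂ (waveKernel P.A t ψ₀) (P.weightOp n (y' t))).re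
        = (inner ℂ (y' t) (P.weightOp n (P.incl (x t)))).re
          + (inner ℂ (P.weightOp n (y' t)) (waveKernel P.A t (φ₀ + ψ₀))).re := by
      rw [← inner_conj_symm, Complex.conj_re, hKψ, inner_add_right, Complex.add_re, weightOp_symm,
        weightOp_symm]
    have e4 := congrArg Complex.re (e2.symm.trans e1)
    rw [Complex.neg_re, Complex.add_re] at e4
    rw [e3]
    linarith
  -- The lower order term costs one copy of the energy, and the flux term `L` copies because `|n'| ≤
  -- L n`; hence the rate `L + 1`, to be integrated by Grönwall.
  have hle : ∀ t, 2 * (inner ℂ (y' t) (P.weightOp n (P.incl (x t)))).re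
      - 2 * (inner ℂ (P.bulkClass (x' t)) (P.mulOp n' (P.coordD (x t)))).re
      ≤ (L + 1) * e t := fun t => by
    have h1 := P.two_mul_re_inner_weightOp_le (fun z _ => hn0 z) (y' t) (P.incl (x t))
    have h2 := P.two_mul_re_inner_mulOp_le (n := L • n) (k := (-1 : ℝ) • n')
      (fun z _ => by simpa using hL z) (P.bulkClass (x' t)) (P.coordD (x t))
    have h3 := hP.le_re_inner_formOp (fun z _ => hn0 z) (x t)
    have h4 := P.re_inner_weightOp n (P.incl (x t))
    have h5 := P.re_inner_weightOp n (y' t)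
    have h6 : (P.incl (x t)).fst = P.bulkClass (x t) := rfl
    have h7 : (P.incl (x t)).snd = P.coordB (x t) := rfl
    have h8 : (y' t).fst = P.bulkClass (x' t) := by rw [hyx]; rfl
    rw [h6, h7] at h4
    rw [h8] at h5
    have h9 : 0 ≤ n 0 * P.leftCoeff * ‖P.coordC (x t)‖ ^ 2 :=
      mul_nonneg (mul_nonneg (hn0 _) hP.leftCoeff_nonneg) (sq_nonneg _)
    have h10 : 0 ≤ n P.ℓ * ‖P.coordB (x t)‖ ^ 2 := mul_nonneg (hn0 _) (sq_nonneg _)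
    have h11 : 0 ≤ n P.ℓ * ‖(y' t).snd‖ ^ 2 := mul_nonneg (hn0 _) (sq_nonneg _)
    have h12 := P.re_inner_mulOp_nonneg (fun z _ => hn0 z) (P.bulkClass (x t))
    have h13 := P.re_inner_mulOp_nonneg (fun z _ => hn0 z) (P.coordD (x t))
    have h14 := P.re_inner_mulOp_nonneg (fun z _ => hn0 z) (P.bulkClass (x' t))
    simp only [mulOp_smul, inner_smul_right, Complex.re_ofReal_mul] at h2
    simp only [he]
    have h15 := mul_le_mul_of_nonneg_left h3 hL0
    have h16 := mul_nonneg hL0 h12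
    have h17 := mul_nonneg hL0 h9
    have h18 := mul_nonneg hL0 h10
    have h19 := mul_nonneg hL0 h11
    rw [h5] at h1 ⊢
    linarith
  have hanti : Antitone fun t => Real.exp (-((L + 1) * t)) * e t := by
    refine antitone_of_hasDerivAt_nonpos (f' := fun t => Real.exp (-((L + 1) * t)) * -(L + 1) * e t
      + Real.exp (-((L + 1) * t)) * (2 * (inner ℂ (y' t) (P.weightOp n (P.incl (x t)))).re
      - 2 * (inner ℂ (P.bulkClass (x' t)) (P.mulOp n' (P.coordD (x t)))).re)) (fun t => ?_)
      fun t => ?_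
    · refine HasDerivAt.mul ?_ (de t)
      have h1 := (((hasDerivAt_id' t).const_mul (L + 1)).neg).exp
      simpa using h1
    · have := mul_le_mul_of_nonneg_left (hle t) (Real.exp_pos (-((L + 1) * t))).le
      change _ ≤ (0 : ℝ)
      linarith
  have h0 := hanti ht
  have hx0 : x 0 = 0 := by
    simp only [hx]
    rw [hR.waveKernel_zero]
    simp
  have hy0 : y' 0 = φ₀ := by
    simp only [hy']
    rw [hR.waveCos_zero]
    rfl
  have hform : 0 ≤ (inner ℂ (x t) (P.formOp n (x t))).re := by
    refine le_trans ?_ (hP.le_re_inner_formOp (fun z _ => hn0 z) (x t))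
    have h1 := P.re_inner_mulOp_nonneg (fun z _ => hn0 z) (P.bulkClass (x t))
    have h2 := P.re_inner_mulOp_nonneg (fun z _ => hn0 z) (P.coordD (x t))
    have h3 : 0 ≤ n 0 * P.leftCoeff * ‖P.coordC (x t)‖ ^ 2 :=
      mul_nonneg (mul_nonneg (hn0 _) hP.leftCoeff_nonneg) (sq_nonneg _)
    have h4 : 0 ≤ n P.ℓ * ‖P.coordB (x t)‖ ^ 2 := mul_nonneg (hn0 _) (sq_nonneg _)
    positivity
  have he0 : e 0 = (inner ℂ φ₀ (P.weightOp n φ₀)).re := by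
    simp [he, hx0, hy0]
  beta_reduce at h0
  rw [he0, mul_zero, neg_zero, Real.exp_zero, one_mul, Real.exp_neg, inv_mul_le_iff₀
    (Real.exp_pos _)] at h0
  exact (le_add_of_nonneg_right hform).trans h0

end BulkBoundarySystem

/-! ### Exponentially localised weights and cutoffs -/

/-- The weight `1 / cosh (L (z - z₀))`. -/
def sechWeight (L z₀ : ℝ) : C(ℝ, ℝ) where
  toFun z := (Real.cosh (L * (z - z₀)))⁻¹
  continuous_toFun := by
    have h : ∀ z, Real.cosh (L * (z - z₀)) ≠ 0 := fun z => (Real.cosh_pos _).ne'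
    fun_prop (disch := exact h _)

/-- The derivative of `sechWeight`. -/
def sechWeightDeriv (L z₀ : ℝ) : C(ℝ, ℝ) where
  toFun z := -(Real.sinh (L * (z - z₀)) * L) / Real.cosh (L * (z - z₀)) ^ 2
  continuous_toFun := by
    have h : ∀ z, Real.cosh (L * (z - z₀)) ^ 2 ≠ 0 := fun z => (pow_pos (Real.cosh_pos _) 2).ne'
    have h1 : Continuous fun z => Real.sinh (L * (z - z₀)) :=
      Real.continuous_sinh.comp (by fun_prop)
    have h2 : Continuous fun z => Real.cosh (L * (z - z₀)) :=
      Real.continuous_cosh.comp (by fun_prop)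
    exact (h1.mul_const L).neg.div (h2.pow 2) h

theorem sechWeight_apply (L z₀ z : ℝ) : sechWeight L z₀ z = (Real.cosh (L * (z - z₀)))⁻¹ := rfl

theorem sechWeight_pos (L z₀ z : ℝ) : 0 < sechWeight L z₀ z := inv_pos.2 (Real.cosh_pos _)

theorem hasDerivAt_sechWeight (L z₀ z : ℝ) :
    HasDerivAt (sechWeight L z₀) (sechWeightDeriv L z₀ z) z := by
  have h1 : HasDerivAt (fun z => L * (z - z₀)) L z := by
    simpa using ((hasDerivAt_id z).sub_const z₀).const_mul L
  exact h1.cosh.inv (Real.cosh_pos _).ne'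

/-- Follows from `|sinh| ≤ cosh`. The weight is a smooth substitute for `exp (-L |z - z₀|)` with the
same logarithmic slope bound, which is what makes the speed exactly 1. -/
theorem abs_sechWeightDeriv_le {L : ℝ} (hL : 0 ≤ L) (z₀ z : ℝ) :
    |sechWeightDeriv L z₀ z| ≤ L * sechWeight L z₀ z := by
  change |-(Real.sinh (L * (z - z₀)) * L) / Real.cosh (L * (z - z₀)) ^ 2|
    ≤ L * (Real.cosh (L * (z - z₀)))⁻¹
  set x := L * (z - z₀)
  have hc := Real.cosh_pos x
  have hs : |Real.sinh x| ≤ Real.cosh x := by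
    rw [Real.abs_sinh, ← Real.cosh_abs x]
    exact (Real.sinh_lt_cosh _).le
  rw [abs_div, abs_neg, abs_mul, abs_of_nonneg hL, abs_of_pos (pow_pos hc 2),
    div_le_iff₀ (pow_pos hc 2)]
  have e : L * (Real.cosh x)⁻¹ * Real.cosh x ^ 2 = L * Real.cosh x := by
    field_simp
  rw [e, mul_comm]
  exact mul_le_mul_of_nonneg_left hs hL

theorem exp_neg_le_sechWeight {L z₀ z d : ℝ} (hL : 0 ≤ L) (h : |z - z₀| ≤ d) :
    Real.exp (-(L * d)) ≤ sechWeight L z₀ z := by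
  rw [sechWeight_apply, Real.exp_neg]
  refine inv_anti₀ (Real.cosh_pos _) ?_
  have h1 : |L * (z - z₀)| ≤ L * d := by
    rw [abs_mul, abs_of_nonneg hL]
    exact mul_le_mul_of_nonneg_left h hL
  have h2 := Real.exp_le_exp.2 ((le_abs_self _).trans h1)
  have h3 := Real.exp_le_exp.2 ((neg_le_abs _).trans h1)
  rw [Real.cosh_eq]
  linarith

theorem sechWeight_le {L z₀ z r : ℝ} (hL : 0 ≤ L) (h : r ≤ |z - z₀|) :
    sechWeight L z₀ z ≤ 2 * Real.exp (-(L * r)) := by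
  rw [sechWeight_apply, Real.exp_neg, ← div_eq_mul_inv, ← Real.cosh_abs, ← inv_div]
  refine inv_anti₀ (by positivity) ?_
  have h1 : L * r ≤ |L * (z - z₀)| := by
    rw [abs_mul, abs_of_nonneg hL]
    exact mul_le_mul_of_nonneg_left h hL
  have h2 := Real.exp_le_exp.2 h1
  have h3 := Real.exp_pos (-|L * (z - z₀)|)
  rw [Real.cosh_eq]
  linarith

/-- The bump function `max 0 (d - |z - z₀|)`. -/
def tentFun (z₀ d : ℝ) : C(ℝ, ℝ) where
  toFun z := max 0 (d - |z - z₀|)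
  continuous_toFun := by fun_prop

theorem tentFun_nonneg (z₀ d z : ℝ) : 0 ≤ tentFun z₀ d z := le_max_left _ _

theorem tentFun_pos {z₀ d z : ℝ} (h : |z - z₀| < d) : 0 < tentFun z₀ d z :=
  lt_max_of_lt_right (sub_pos.2 h)

theorem tentFun_le_sechWeight {L z₀ d : ℝ} (hL : 0 ≤ L) (hd : 0 ≤ d) (z : ℝ) :
    tentFun z₀ d z ≤ (d * Real.exp (L * d)) * sechWeight L z₀ z := by
  refine max_le (by have := (sechWeight_pos L z₀ z).le; positivity) ?_
  rcases le_or_gt |z - z₀| d with h | h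
  · have h1 := mul_le_mul_of_nonneg_left (exp_neg_le_sechWeight hL h)
      (by positivity : 0 ≤ d * Real.exp (L * d))
    rw [mul_assoc, ← Real.exp_add, add_neg_cancel, Real.exp_zero, mul_one] at h1
    have h2 := abs_nonneg (z - z₀)
    linarith
  · have := (sechWeight_pos L z₀ z).le
    have h1 : 0 ≤ (d * Real.exp (L * d)) * sechWeight L z₀ z := by positivity
    linarith

/-! ### Finite propagation speed of the kernels -/

namespace BulkBoundarySystem

open UnboundedOp

variable (P : BulkBoundarySystem)

theorem re_inner_weightOp_sechWeight_le {L z₀ r : ℝ} (hL : 0 ≤ L) {φ : P.Hil}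
    (h1 : ∀ᵐ z ∂P.μ, |z - z₀| < r → φ.fst z = 0) (h2 : |P.ℓ - z₀| < r → φ.snd = 0) :
    (inner ℂ φ (P.weightOp (sechWeight L z₀) φ)).re ≤ 2 * Real.exp (-(L * r)) * ‖φ‖ ^ 2 := by
  have e1 : (inner ℂ φ.fst (P.mulOp (sechWeight L z₀) φ.fst)).re
      ≤ 2 * Real.exp (-(L * r)) * ‖φ.fst‖ ^ 2 := by
    have e : ‖φ.fst‖ ^ 2 = ∫ z, ‖φ.fst z‖ ^ 2 ∂P.μ := by
      have := P.re_inner_mulOp 1 φ.fst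
      simp only [ContinuousMap.one_apply, one_mul] at this
      have hone : P.mulOp 1 φ.fst = φ.fst := by
        refine Lp.ext ?_
        filter_upwards [P.coeFn_mulOp 1 φ.fst] with z hz
        simp [hz]
      have hnorm : (inner ℂ φ.fst φ.fst : ℂ).re = ‖φ.fst‖ ^ 2 :=
        inner_self_eq_norm_sq (𝕜 := ℂ) φ.fst
      rw [← this, hone, hnorm]
    rw [re_inner_mulOp, e, ← integral_const_mul]
    refine integral_mono_ae (P.integrable_mul_conj _ _) ?_ ?_
    · refine Integrable.const_mul ?_ _
      simpa using P.integrable_mul_conj 1 φ.fst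
    · filter_upwards [h1] with z hz
      rcases lt_or_ge |z - z₀| r with h | h
      · simp [hz h]
      · exact mul_le_mul_of_nonneg_right (sechWeight_le hL h) (sq_nonneg _)
  have e2 : sechWeight L z₀ P.ℓ * ‖φ.snd‖ ^ 2 ≤ 2 * Real.exp (-(L * r)) * ‖φ.snd‖ ^ 2 := by
    rcases lt_or_ge |P.ℓ - z₀| r with h | h
    · simp [h2 h]
    · exact mul_le_mul_of_nonneg_right (sechWeight_le hL h) (sq_nonneg _)
  rw [re_inner_weightOp, WithLp.prod_norm_sq_eq_of_L2, mul_add]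
  exact add_le_add e1 e2

/-- Multiplication of the bulk component by a function. -/
def bulkMul (n : C(ℝ, ℝ)) : P.Hil →L[ℂ] P.L2 :=
  (P.mulOp n).comp (WithLp.fstL 2 ℂ P.L2 P.BoundarySpace)

theorem bulkMul_apply (n : C(ℝ, ℝ)) (φ : P.Hil) : P.bulkMul n φ = P.mulOp n φ.fst := rfl

theorem mulOp_eq_zero_of_re_inner {n : C(ℝ, ℝ)} (hn : ∀ z, 0 ≤ n z) {g : P.L2}
    (h : (inner ℂ g (P.mulOp n g)).re ≤ 0) : P.mulOp n g = 0 := by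
  have h0 := le_antisymm h (P.re_inner_mulOp_nonneg (fun z _ => hn z) g)
  rw [re_inner_mulOp, integral_eq_zero_iff_of_nonneg (fun z => mul_nonneg (hn z) (sq_nonneg _))
    (P.integrable_mul_conj n g)] at h0
  rw [Lp.eq_zero_iff_ae_eq_zero]
  filter_upwards [P.coeFn_mulOp n g, h0] with z h1 h2
  rw [h1]
  rcases mul_eq_zero.1 h2 with h3 | h3
  · simp [h3]
  · have : g z = 0 := by simpa using h3
    simp [this]

variable {P}

/-- The tent function costs `exp (L d)`, the energy growth `exp ((L + 1) t)` and the data gain `exp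
(-L r)`; their product tends to zero as `L → ∞` because `t + d < r`. -/
theorem PositivityHypotheses.bulkMul_waveCos_eq_zero_of_nonneg (hP : P.PositivityHypotheses)
    {φ : GraphDomain P.A} {z₀ r d t : ℝ} (hd : 0 ≤ d) (ht : 0 ≤ t) (hr : t + d < r)
    (h1 : ∀ᵐ z ∂P.μ, |z - z₀| < r → (GraphDomain.incl P.A φ).fst z = 0)
    (h2 : |P.ℓ - z₀| < r → (GraphDomain.incl P.A φ).snd = 0) :
    P.bulkMul (tentFun z₀ d) (waveCos P.A t (GraphDomain.incl P.A φ)) = 0 := by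
  refine P.mulOp_eq_zero_of_re_inner (tentFun_nonneg z₀ d) ?_
  set φ₀ := GraphDomain.incl P.A φ
  set y := waveCos P.A t φ₀
  have hle : ∀ L : ℝ, 0 ≤ L → (inner ℂ y.fst (P.mulOp (tentFun z₀ d) y.fst)).re
      ≤ (d * (2 * Real.exp t * ‖φ₀‖ ^ 2)) * Real.exp (-(L * (r - d - t))) := by
    intro L hL
    have e1 := hP.re_inner_weightOp_waveCos_le (hasDerivAt_sechWeight L z₀) hL
      (fun z => (sechWeight_pos L z₀ z).le) (abs_sechWeightDeriv_le hL z₀) φ ht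
    have e2 := P.re_inner_weightOp_sechWeight_le hL h1 h2
    have e3 := e1.trans (mul_le_mul_of_nonneg_left e2 (Real.exp_pos _).le)
    have e4 : (inner ℂ y.fst (P.mulOp (sechWeight L z₀) y.fst)).re
        ≤ (inner ℂ y (P.weightOp (sechWeight L z₀) y)).re := by
      rw [re_inner_weightOp]
      exact le_add_of_nonneg_right (mul_nonneg (sechWeight_pos _ _ _).le (sq_nonneg _))
    have e5 : (inner ℂ y.fst (P.mulOp (tentFun z₀ d) y.fst)).re
        ≤ (d * Real.exp (L * d)) * (inner ℂ y.fst (P.mulOp (sechWeight L z₀) y.fst)).re := by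
      rw [re_inner_mulOp, re_inner_mulOp, ← integral_const_mul]
      refine integral_mono (P.integrable_mul_conj _ _)
        ((P.integrable_mul_conj _ _).const_mul _) fun z => ?_
      beta_reduce
      rw [← mul_assoc]
      exact mul_le_mul_of_nonneg_right (tentFun_le_sechWeight hL hd z) (sq_nonneg _)
    refine e5.trans ((mul_le_mul_of_nonneg_left (e4.trans e3) (by positivity)).trans_eq ?_)
    have e6 : Real.exp (-(L * (r - d - t)))
        = Real.exp (L * d) * (Real.exp (L * t) * Real.exp (-(L * r))) := by
      rw [← Real.exp_add, ← Real.exp_add]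
      congr 1
      ring
    rw [e6, add_mul, one_mul, Real.exp_add]
    ring
  have hlim : Filter.Tendsto (fun L : ℝ => (d * (2 * Real.exp t * ‖φ₀‖ ^ 2))
      * Real.exp (-(L * (r - d - t)))) Filter.atTop (nhds 0) := by
    have h3 : Filter.Tendsto (fun L : ℝ => L * (r - d - t)) Filter.atTop Filter.atTop :=
      Filter.tendsto_id.atTop_mul_const (by linarith)
    simpa using (Real.tendsto_exp_neg_atTop_nhds_zero.comp h3).const_mul
      (d * (2 * Real.exp t * ‖φ₀‖ ^ 2))
  exact ge_of_tendsto hlim ((Filter.eventually_ge_atTop 0).mono hle)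

/-- The sine kernel vanishes at time 0 and has derivative `-cos(√A t)`, which vanishes near `z₀` at
all earlier non-negative times. Negative times follow since the kernel is odd. -/
theorem PositivityHypotheses.bulkMul_waveKernel_eq_zero (hP : P.PositivityHypotheses)
    {φ : GraphDomain P.A} {z₀ r d t : ℝ} (hd : 0 ≤ d) (hr : |t| + d < r)
    (h1 : ∀ᵐ z ∂P.μ, |z - z₀| < r → (GraphDomain.incl P.A φ).fst z = 0)
    (h2 : |P.ℓ - z₀| < r → (GraphDomain.incl P.A φ).snd = 0) :
    P.bulkMul (tentFun z₀ d) (waveKernel P.A t (GraphDomain.incl P.A φ)) = 0 := by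
  have hR := hP.isNonnegResolvent
  set φ₀ := GraphDomain.incl P.A φ
  have hpos : ∀ t : ℝ, 0 ≤ t → t + d < r →
      P.bulkMul (tentFun z₀ d) (waveKernel P.A t φ₀) = 0 := by
    intro t ht htr
    have hder : ∀ s, HasDerivAt (fun s => P.bulkMul (tentFun z₀ d) (waveKernel P.A s φ₀))
        (P.bulkMul (tentFun z₀ d) (-waveCos P.A s φ₀)) s := fun s =>
      ((P.bulkMul (tentFun z₀ d)).restrictScalars ℝ).hasFDerivAt.comp_hasDerivAt s
        (hR.hasDerivAt_waveKernel φ₀ s)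
    have h := (convex_Icc 0 t).norm_image_sub_le_of_norm_hasDerivWithin_le (C := 0)
      (fun s _ => (hder s).hasDerivWithinAt) (fun s hs => by
        rw [map_neg, hP.bulkMul_waveCos_eq_zero_of_nonneg hd hs.1 (by linarith [hs.2]) h1 h2]
        simp) (left_mem_Icc.2 ht) (right_mem_Icc.2 ht)
    rw [hR.waveKernel_zero] at h
    simpa using h
  rcases le_total 0 t with ht | ht
  · exact hpos t ht (by rwa [abs_of_nonneg ht] at hr)
  · have h := hpos (-t) (by linarith) (by rwa [abs_of_nonpos ht] at hr)
    rw [hR.waveKernel_neg] at h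
    simpa using h

end BulkBoundarySystem

/-! ### Supports, causal hulls and the causal propagator -/

namespace BulkBoundarySystem

open UnboundedOp

variable (P : BulkBoundarySystem)

theorem exists_isGraphPair (φ : GraphDomain P.A) : ∃ u v w : ℝ → ℂ,
    P.IsGraphPair (GraphDomain.incl P.A φ) (GraphDomain.op P.A φ) u v w := by
  have h := φ.mem_graph
  rw [A_graph] at h
  exact h

theorem ae_fst_eq_zero_of_contRep {φ : GraphDomain P.A} {z₀ r : ℝ}
    (h : ∀ z ∈ Icc 0 P.ℓ, |z - z₀| < r → P.contRep (GraphDomain.incl P.A φ).fst z = 0) :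
    ∀ᵐ z ∂P.μ, |z - z₀| < r → (GraphDomain.incl P.A φ).fst z = 0 := by
  obtain ⟨u, v, w, hu⟩ := P.exists_isGraphPair φ
  filter_upwards [hu.profile.rep, P.ae_mem] with z h1 h2 h3
  have h2' := Ioo_subset_Icc_self h2
  rw [h1, ← P.contRep_eqOn hu.profile.continuousOn hu.profile.rep h2', h z h2' h3]

/-- If the bulk field vanishes near `ℓ`, so does its one-sided derivative at `ℓ`, and the domain
condition then kills the boundary component. This is why the bulk support alone governs causality.
-/
theorem snd_eq_zero_of_contRep {φ : GraphDomain P.A} {z₀ r : ℝ}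
    (h : ∀ z ∈ Icc 0 P.ℓ, |z - z₀| < r → P.contRep (GraphDomain.incl P.A φ).fst z = 0)
    (hℓ : |P.ℓ - z₀| < r) : (GraphDomain.incl P.A φ).snd = 0 := by
  obtain ⟨u, v, w, hu⟩ := P.exists_isGraphPair φ
  have hz : ∀ z ∈ Icc 0 P.ℓ, |z - z₀| < r → u z = 0 := fun z hz1 hz2 => by
    rw [← P.contRep_eqOn hu.profile.continuousOn hu.profile.rep hz1, h z hz1 hz2]
  have hv : v P.ℓ = 0 := by
    refine (uniqueDiffOn_Icc P.ℓ_pos P.ℓ P.ℓ_mem).eq_deriv _ (hu.profile.deriv_u P.ℓ P.ℓ_mem)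
      ((hasDerivWithinAt_const P.ℓ (Icc 0 P.ℓ) (0 : ℂ)).congr_of_eventuallyEq ?_ (hz _ P.ℓ_mem hℓ))
    have hopen : IsOpen {z : ℝ | |z - z₀| < r} := isOpen_lt (by fun_prop) continuous_const
    filter_upwards [self_mem_nhdsWithin, nhdsWithin_le_nhds (hopen.mem_nhds hℓ)] with z h1 h2
    exact hz z h1 h2
  have e : (GraphDomain.incl P.A φ).snd.val = 0 := by
    rw [hu.bc_right, hz _ P.ℓ_mem hℓ, hv]
    simp
  exact e

theorem bulkField_eq_zero {f : ℝ → GraphDomain P.A} {t : ℝ} (h : f t = 0)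
    (z : Icc (0 : ℝ) P.ℓ) : P.bulkField f t z = 0 := by
  rw [bulkField, h, map_zero]
  exact P.contRep_eqOn (u := fun _ => 0) continuousOn_const (Lp.coeFn_zero ℂ 2 P.μ) z.2

theorem isCompact_bulkSupport {f : ℝ → GraphDomain P.A} (hf : HasCompactSupport f) :
    IsCompact (P.bulkSupport f) := by
  refine (hf.isCompact.prod isCompact_univ).of_isClosed_subset isClosed_closure
    (closure_minimal ?_ ((isClosed_tsupport f).prod isClosed_univ))
  exact fun p hp => ⟨subset_tsupport f fun h0 => hp (P.bulkField_eq_zero h0 p.2), mem_univ _⟩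

theorem mem_causalHull {O : Set P.Spacetime} {q : P.Spacetime} :
    q ∈ P.causalHull O ↔ ∃ p ∈ O, |(q.2 : ℝ) - p.2| ≤ |q.1 - p.1| := by
  simp only [causalHull, causalFuture, causalPast, mem_union, mem_ofPred_eq, le_abs, neg_sub,
    and_or_left, exists_or]

theorem isClosed_causalHull {O : Set P.Spacetime} (hO : IsCompact O) :
    IsClosed (P.causalHull O) := by
  have := isCompact_iff_compactSpace.1 hO
  have hc : IsClosed {x : P.Spacetime × O |
      |(x.1.2 : ℝ) - (x.2 : P.Spacetime).2| ≤ |x.1.1 - (x.2 : P.Spacetime).1|} :=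
    isClosed_le (by fun_prop) (by fun_prop)
  convert isClosedMap_fst_of_compactSpace _ hc using 1
  ext q
  rw [mem_causalHull]
  constructor
  · rintro ⟨p, hp, h⟩
    exact ⟨(q, ⟨p, hp⟩), h, rfl⟩
  · rintro ⟨⟨q, p⟩, h, rfl⟩
    exact ⟨p, p.2, h⟩

/-- By compactness the strict spacelike separation has a uniform margin, which leaves room for a
tent of radius `ε / 2`. -/
theorem exists_pos_of_notMem_causalHull {O : Set P.Spacetime} (hO : IsCompact O)
    {q : P.Spacetime} (hq : q ∉ P.causalHull O) :
    ∃ ε : ℝ, 0 < ε ∧ ∀ p ∈ O, |q.1 - p.1| + ε ≤ |(q.2 : ℝ) - p.2| := by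
  rcases O.eq_empty_or_nonempty with rfl | hne
  · exact ⟨1, one_pos, by simp⟩
  · have hcont : Continuous fun p : P.Spacetime => |(q.2 : ℝ) - p.2| - |q.1 - p.1| := by fun_prop
    obtain ⟨p₀, hp₀, hmin⟩ := hO.exists_isMinOn hne hcont.continuousOn
    refine ⟨|(q.2 : ℝ) - p₀.2| - |q.1 - p₀.1|, ?_, fun p hp => ?_⟩
    · rw [mem_causalHull] at hq
      push Not at hq
      exact sub_pos.2 (hq p₀ hp₀)
    · have h : |(q.2 : ℝ) - p₀.2| - |q.1 - p₀.1| ≤ |(q.2 : ℝ) - p.2| - |q.1 - p.1| := hmin hp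
      linarith

variable {P}

theorem PositivityHypotheses.bulkField_propagate_eq_zero (hP : P.PositivityHypotheses)
    {f : ℝ → GraphDomain P.A} (hf : f ∈ C2c P.A) {q : P.Spacetime} {ε : ℝ} (hε : 0 < ε)
    (h : ∀ p : P.Spacetime, P.bulkField f p.1 p.2 ≠ 0 →
      |q.1 - p.1| + ε ≤ |(q.2 : ℝ) - p.2|) :
    P.bulkField (hP.isNonnegResolvent.propagate f) q.1 q.2 = 0 := by
  have hR := hP.isNonnegResolvent
  obtain ⟨t, z₀⟩ := q
  simp only at h ⊢
  set S := P.bulkMul (tentFun z₀ (ε / 2))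
  have hS : S (GraphDomain.incl P.A (hR.propagate f t)) = 0 := by
    have hi := (GraphDomain.incl P.A).integrable_comp
      (hR.integrable_propagate hf.2 hf.1.continuous t)
    rw [hR.incl_propagate hf.2 hf.1.continuous]
    refine (S.integral_comp_comm hi).symm.trans (integral_eq_zero_of_ae
      (Filter.Eventually.of_forall fun s => ?_))
    -- For each delay `s`, the source at time `t - s` is zero within distance `|s| + ε` of `z₀`, too
    -- far to reach the tent in time `|s|`.
    have h0 : ∀ z ∈ Icc 0 P.ℓ, |z - z₀| < |s| + ε →
        P.contRep (GraphDomain.incl P.A (f (t - s))).fst z = 0 := by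
      intro z hz hlt
      by_contra hne
      have h1 := h (t - s, ⟨z, hz⟩) hne
      simp only [sub_sub_cancel] at h1
      rw [abs_sub_comm] at hlt
      linarith
    exact hP.bulkMul_waveKernel_eq_zero (r := |s| + ε) (half_pos hε).le (by linarith)
      (P.ae_fst_eq_zero_of_contRep h0) (P.snd_eq_zero_of_contRep h0)
  obtain ⟨u, v, w, hu⟩ := P.exists_isGraphPair (hR.propagate f t)
  have h1 : EqOn (fun z => (tentFun z₀ (ε / 2) z : ℂ) * u z) (fun _ => 0) (Icc 0 P.ℓ) := by
    refine P.eqOn_of_ae_eq ?_ continuousOn_const ?_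
    · exact ((Complex.continuous_ofReal.comp (tentFun z₀ (ε / 2)).continuous).continuousOn).mul
        hu.profile.continuousOn
    · rw [bulkMul_apply, Lp.eq_zero_iff_ae_eq_zero] at hS
      filter_upwards [hS, P.coeFn_mulOp (tentFun z₀ (ε / 2))
        (GraphDomain.incl P.A (hR.propagate f t)).fst, hu.profile.rep] with z e1 e2 e3
      rw [← e3, ← e2, e1, Pi.zero_apply]
  have h2 : u z₀ = 0 := by
    have h3 : (tentFun z₀ (ε / 2) z₀ : ℂ) ≠ 0 :=
      Complex.ofReal_ne_zero.2 (tentFun_pos (by simpa using hε)).ne'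
    exact (mul_eq_zero.1 (h1 z₀.2)).resolve_left h3
  rw [bulkField, P.contRep_eqOn hu.profile.continuousOn hu.profile.rep z₀.2, h2]

theorem PositivityHypotheses.bulkSupport_propagate_subset (hP : P.PositivityHypotheses)
    {f : ℝ → GraphDomain P.A} (hf : f ∈ C2c P.A) :
    P.bulkSupport (hP.isNonnegResolvent.propagate f) ⊆ P.causalHull (P.bulkSupport f) := by
  have hc := P.isCompact_bulkSupport hf.2
  -- The causal hull of a compact set is closed, so only points where the field is nonzero need be
  -- considered.
  refine closure_minimal (fun q hq => ?_) (P.isClosed_causalHull hc)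
  by_contra hq'
  obtain ⟨ε, hε, h⟩ := P.exists_pos_of_notMem_causalHull hc hq'
  exact hq (hP.bulkField_propagate_eq_zero hf hε fun p hp => h p (subset_closure hp))

theorem PositivityHypotheses.isCausalPropagator (hP : P.PositivityHypotheses) :
    P.IsCausalPropagator hP.isNonnegResolvent.propagator (waveKernel P.A) where
  integralOperator := hP.isNonnegResolvent.isIntegralOperator_propagator
  solution f t := hP.isNonnegResolvent.kleinGordon_propagate f.2 t
  annihilates f t := hP.isNonnegResolvent.integralOp_kleinGordon f.2 t
  causal_support f := hP.bulkSupport_propagate_subset f.2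
  kernel_zero := hP.isNonnegResolvent.waveKernel_zero
  kernel_deriv φ := by
    have h := hP.isNonnegResolvent.hasDerivAt_waveKernel φ 0
    rw [hP.isNonnegResolvent.waveCos_zero] at h
    exact h

end BulkBoundarySystem

end

theorem mainTheorem1 (P : BulkBoundarySystem) (hP : P.PositivityHypotheses) (hβ₂ : P.β₂ ≠ 0) :
    IsSelfAdjoint P.A ∧
    (∀ lam : ℝ, UnboundedOp.eigenspace P.A lam ≠ ⊥ → 0 ≤ lam) ∧
    ∃ K : ℝ → P.Hil →L[ℂ] P.Hil,
      (∀ t : ℝ, UnboundedOp.IsFunctionOf P.A (fun lam => - sinSqrtDivSqrt t lam) (K t)) ∧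
      ∃ Eop : UnboundedOp.C2c P.A →ₗ[ℂ] UnboundedOp.C2 P.A, P.IsCausalPropagator Eop K := by
  have hR := hP.isNonnegResolvent
  exact ⟨hR.isSelfAdjoint, fun lam h => hR.eigenspace_nonneg h, UnboundedOp.waveKernel P.A,
    fun t => hR.isFunctionOf_diag (abs_nonneg t) (UnboundedOp.boundedOnNonneg_sin t),
    hR.propagator, hP.isCausalPropagator⟩
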